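/- **Setting.** A $q$-spin system $\mathcal S=(G,[q],\boldsymbol h,\boldsymbol A)$ consists of a finite simple graph $G=(V,E)$ with $n=|V|\ge 1$, an external field $\boldsymbol h\in\mathbb R_{\ge 0}^q$ and a symmetric interaction matrix $\boldsymbol A\in\mathbb R_{\ge 0}^{q\times q}$. A configuration $\sigma\in[q]^V$ has weight $w(\sigma)=\prod_{v\in V}\boldsymbol h(\sigma_v)\prod_{\{u,v\}\in E}\boldsymbol A(\sigma_u,\sigma_v)$. The partition function is $Z=\sum_{\sigma\in[q]^V} w(\sigma)$, and the Gibbs distribution is $\mu=w/Z$. A partial configuration on $\Lambda\subseteq V$ is *feasible* if it extends to a configuration of positive weight; for feasible $\sigma\in[q]^\Lambda$, $\mu_v^\sigma$ is the marginal at $v$ of $\mu$ conditioned on $\sigma$. The system is *permissive* if every partial configuration $\sigma$ on any $\Lambda\subseteq V$ with $\boldsymbol h(\sigma_v)>0$ for all $v\in\Lambda$ and $\boldsymbol A(\sigma_u,\sigma_v)>0$ for all edges $\{u,v\}$ inside $\Lambda$ is feasible (so $Z>0$). * $b>0$ is a *marginal lower bound* if for all $\Lambda$, $v\notin\Lambda$,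 feasible $\sigma\in[q]^\Lambda$ and $i\in[q]$, either $\mu^\sigma_v(i)\ge b$ or $\mu^\sigma_v(i)=0$. * For a non-increasing $\delta:\mathbb N\to\mathbb R_{\ge0}$, $\mathcal S$ has *strong spatial mixing with rate $\delta$* if for all $\Lambda$, $v\notin\Lambda$ and feasible $\sigma,\tau\in[q]^\Lambda$ with $\ell=\min\{\mathrm{dist}_G(u,v): u\in\Lambda,\ \sigma_u\ne\tau_u\}$ (finite), $d_{TV}(\mu_v^\sigma,\mu_v^\tau)\le\delta(\ell)$. * For $s:\mathbb N\to\mathbb N$, $G$ has *sub-exponential neighbourhood growth within rate $s$* if $s(\ell)=\exp(o(\ell))$ and $|\{u:\mathrm{dist}_G(u,v)=\ell\}|\le s(\ell)$ for all $v\in V$ and all integers $\ell>0$. The machine model is the real RAM: addition, truncated subtraction and comparison of natural numbers, exact arithmetic ($+,-,\times,/$) and comparison of real numbers, and memory accesses (also indirect ones) take unit time, with no rounding of reals to integers. **Theorem.** There are a deterministic real-RAM algorithm and an absolute constant $C>0$ such that the following holds. For all integers $q\ge2$, $L\ge1$ and all $s:\mathbb N\to\mathbb N$ there is a constant $K=K(q,s,L)>0$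 such that, for every non-increasing $\delta:\mathbb N\to\mathbb R_{\ge0}$ with $$2\mathrm e\,q\,(1+s(\ell))\,\delta(\ell)\le 1\qquad\text{for all integers }\ell\ge L,$$ every permissive $q$-spin system $\mathcal S$ on a graph with $n\geq 1$ vertices which has sub-exponential neighbourhood growth within rate $s$, such that $\mathcal S$ has strong spatial mixing with rate $\delta$ and marginal lower bound $b>0$, and every $\varepsilon\in(0,1)$, the algorithm, on input $(\mathcal S,\varepsilon)$ alone, halts within time $$K\cdot\Big(\frac{n}{b\varepsilon}\Big)^{C\,\max\{1,s(L)\}\,\log q}$$ and outputs a number $\widehat Z$ with $(1-\varepsilon)Z\le\widehat Z\le(1+\varepsilon)Z$. -/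

import Mathlib

/-! ## Spin systems -/

/-- A `q`-spin system on the vertex set `V`: a graph, an external field `h`, and an interaction
matrix `A`. The matrix is symmetric, so that the factor of an undirected edge is well defined. -/
structure SpinSystem (V : Type) (q : ℕ) where
  G : SimpleGraph V
  h : Fin q → ℝ
  A : Matrix (Fin q) (Fin q) ℝ
  h_nonneg : ∀ i, 0 ≤ h i
  A_nonneg : ∀ i j, 0 ≤ A i j
  A_symm : ∀ i j, A i j = A j i

namespace SpinSystem

noncomputable section

variable {V : Type} {q : ℕ}

/-- The factor that the edge `e` contributes to the weight of the configuration `σ`. -/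
def edgeFactor (S : SpinSystem V q) (σ : V → Fin q) (e : Sym2 V) : ℝ :=
  Sym2.lift ⟨fun u v => S.A (σ u) (σ v), fun u v => S.A_symm (σ u) (σ v)⟩ e

variable [Fintype V] [DecidableEq V]

open Classical in
/-- `w(σ) = ∏_v h(σ_v) ∏_{uv ∈ E} A(σ_u, σ_v)`. -/
def weight (S : SpinSystem V q) (σ : V → Fin q) : ℝ :=
  (∏ v, S.h (σ v)) * ∏ e ∈ S.G.edgeFinset, S.edgeFactor σ e

/-- The partition function `Z`. -/
def partitionFunction (S : SpinSystem V q) : ℝ :=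
  ∑ σ : V → Fin q, S.weight σ

/-- The Gibbs distribution `μ`. -/
def gibbs (S : SpinSystem V q) (σ : V → Fin q) : ℝ :=
  S.weight σ / S.partitionFunction

/-- The configurations that extend the partial configuration `σ` on `Λ`. Throughout, a partial
configuration on `Λ` is given by a total function whose values outside `Λ` are ignored. -/
def extensions (Λ : Finset V) (σ : V → Fin q) : Finset (V → Fin q) :=
  Finset.univ.filter fun ρ => ∀ u ∈ Λ, ρ u = σ u

/-- The partial configuration `σ` on `Λ` extends to a configuration of positive weight. -/
def Feasible (S : SpinSystem V q) (Λ : Finset V) (σ : V → Fin q) : Prop :=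
  ∃ ρ ∈ extensions Λ σ, 0 < S.weight ρ

/-- `μ_v^{σ_Λ}(i)`: the probability that `v` has spin `i`, under the Gibbs distribution
conditioned on the partial configuration `σ` on `Λ`. -/
def condMarginal (S : SpinSystem V q) (Λ : Finset V) (σ : V → Fin q) (v : V) (i : Fin q) : ℝ :=
  (∑ ρ ∈ (extensions Λ σ).filter (fun ρ => ρ v = i), S.gibbs ρ) /
    ∑ ρ ∈ extensions Λ σ, S.gibbs ρ

/-- Total variation distance of two distributions on the spins. -/
def tvDist (p p' : Fin q → ℝ) : ℝ := (∑ i, |p i - p' i|) / 2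

/-- `b` is a marginal lower bound of the Gibbs distribution. -/
def MarginalLowerBound (S : SpinSystem V q) (b : ℝ) : Prop :=
  ∀ (Λ : Finset V) (v : V), v ∉ Λ → ∀ σ : V → Fin q, S.Feasible Λ σ → ∀ i : Fin q,
    b ≤ S.condMarginal Λ σ v i ∨ S.condMarginal Λ σ v i = 0

/-- Strong spatial mixing with rate `δ`. Distances are taken in `ℕ∞`, vertices in different
components being at distance `∞`. -/
def StrongSpatialMixing (S : SpinSystem V q) (δ : ℕ → ℝ) : Prop :=
  ∀ (Λ : Finset V) (v : V), v ∉ Λ → ∀ σ τ : V → Fin q, S.Feasible Λ σ → S.Feasible Λ τ →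
    ∀ ℓ : ℕ, IsLeast {d : ℕ∞ | ∃ u ∈ Λ, σ u ≠ τ u ∧ S.G.edist u v = d} (ℓ : ℕ∞) →
      tvDist (S.condMarginal Λ σ v) (S.condMarginal Λ τ v) ≤ δ ℓ

/-- The system is permissive: a partial configuration that violates no hard constraint among the
vertices of `Λ` is feasible. With `Λ = ∅`: the partition function is positive. -/
def Permissive (S : SpinSystem V q) : Prop :=
  ∀ (Λ : Finset V) (σ : V → Fin q), (∀ v ∈ Λ, 0 < S.h (σ v)) →
    (∀ u ∈ Λ, ∀ v ∈ Λ, S.G.Adj u v → 0 < S.A (σ u) (σ v)) → S.Feasible Λ σ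

end

end SpinSystem

/-- `s(ℓ) = exp(o(ℓ))`. -/
def IsSubexponential (s : ℕ → ℕ) : Prop :=
  ∀ c : ℝ, 1 < c → ∃ N : ℕ, ∀ ℓ, N ≤ ℓ → (s ℓ : ℝ) < c ^ ℓ

/-- `G` has sub-exponential neighbourhood growth within rate `s`: the growth function `s` is
sub-exponential, and every sphere of positive radius `ℓ` has at most `s ℓ` vertices. -/
def HasSubexpGrowth {V : Type} (G : SimpleGraph V) (s : ℕ → ℕ) : Prop :=
  IsSubexponential s ∧ ∀ (v : V) (ℓ : ℕ), 0 < ℓ → {u : V | G.edist u v = ℓ}.encard ≤ s ℓ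

/-! ## The machine model: while-programs on a real RAM

The memory consists of two-dimensional arrays of natural numbers and two-dimensional arrays of
real numbers, the arrays being named by natural numbers. A program mentions finitely many arrays.
Addition, truncated subtraction and comparison of naturals, exact field operations and comparison
of reals, and memory accesses take one time unit each. There is no conversion from reals to
naturals (no rounding), and no multiplication of naturals. -/

namespace RealRAM

/-- Memory contents: array name, row, column. -/
structure State where
  nat : ℕ → ℕ → ℕ → ℕ
  real : ℕ → ℕ → ℕ → ℝ

/-- Expressions with natural values. -/
inductive NExp where
  | const (k : ℕ)
  | read (a : ℕ) (i j : NExp)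
  | add (e f : NExp)
  | sub (e f : NExp)

namespace NExp

def eval (m : State) : NExp → ℕ
  | const k => k
  | read a i j => m.nat a (i.eval m) (j.eval m)
  | add e f => e.eval m + f.eval m
  | sub e f => e.eval m - f.eval m

def cost : NExp → ℕ
  | const _ => 1
  | read _ i j => i.cost + j.cost + 1
  | add e f => e.cost + f.cost + 1
  | sub e f => e.cost + f.cost + 1

end NExp

/-- Expressions with real values. -/
inductive RExp where
  | ofNat (e : NExp)
  | read (a : ℕ) (i j : NExp)
  | add (e f : RExp)
  | sub (e f : RExp)
  | mul (e f : RExp)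
  | div (e f : RExp)

namespace RExp

noncomputable def eval (m : State) : RExp → ℝ
  | ofNat e => (e.eval m : ℝ)
  | read a i j => m.real a (i.eval m) (j.eval m)
  | add e f => e.eval m + f.eval m
  | sub e f => e.eval m - f.eval m
  | mul e f => e.eval m * f.eval m
  | div e f => e.eval m / f.eval m

def cost : RExp → ℕ
  | ofNat e => e.cost + 1
  | read _ i j => i.cost + j.cost + 1
  | add e f => e.cost + f.cost + 1
  | sub e f => e.cost + f.cost + 1
  | mul e f => e.cost + f.cost + 1
  | div e f => e.cost + f.cost + 1

end RExp

/-- Tests. -/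
inductive Test where
  | natLe (e f : NExp)
  | realLe (e f : RExp)
  | not (c : Test)

namespace Test

def Holds (m : State) : Test → Prop
  | natLe e f => e.eval m ≤ f.eval m
  | realLe e f => e.eval m ≤ f.eval m
  | not c => ¬ c.Holds m

def cost : Test → ℕ
  | natLe e f => e.cost + f.cost + 1
  | realLe e f => e.cost + f.cost + 1
  | not c => c.cost + 1

end Test

/-- Programs. `writeNat a i j e` stores the value of `e` in the entry `(i, j)` of the array `a` of
naturals; `writeReal` does the same for reals. -/
inductive Prog where
  | writeNat (a : ℕ) (i j e : NExp)
  | writeReal (a : ℕ) (i j : NExp) (e : RExp)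
  | seq (p p' : Prog)
  | ite (c : Test) (p p' : Prog)
  | while (c : Test) (p : Prog)

namespace State

def setNat (m : State) (a i j x : ℕ) : State where
  nat a' i' j' := if a' = a ∧ i' = i ∧ j' = j then x else m.nat a' i' j'
  real := m.real

def setReal (m : State) (a i j : ℕ) (x : ℝ) : State where
  nat := m.nat
  real a' i' j' := if a' = a ∧ i' = i ∧ j' = j then x else m.real a' i' j'

end State

/-- `Exec p m m' t`: the program `p`, started on the memory `m`, halts with the memory `m'` after
exactly `t` time units. -/
inductive Exec : Prog → State → State → ℕ → Prop
  | writeNat (a : ℕ) (i j e : NExp) (m : State) :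
      Exec (.writeNat a i j e) m (m.setNat a (i.eval m) (j.eval m) (e.eval m))
        (i.cost + j.cost + e.cost + 1)
  | writeReal (a : ℕ) (i j : NExp) (e : RExp) (m : State) :
      Exec (.writeReal a i j e) m (m.setReal a (i.eval m) (j.eval m) (e.eval m))
        (i.cost + j.cost + e.cost + 1)
  | seq {p p' : Prog} {m m' m'' : State} {t t' : ℕ} :
      Exec p m m' t → Exec p' m' m'' t' → Exec (.seq p p') m m'' (t + t')
  | ite_true {c : Test} {p p' : Prog} {m m' : State} {t : ℕ} :
      c.Holds m → Exec p m m' t → Exec (.ite c p p') m m' (c.cost + t + 1)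
  | ite_false {c : Test} {p p' : Prog} {m m' : State} {t : ℕ} :
      ¬ c.Holds m → Exec p' m m' t → Exec (.ite c p p') m m' (c.cost + t + 1)
  | while_true {c : Test} {p : Prog} {m m' m'' : State} {t t' : ℕ} :
      c.Holds m → Exec p m m' t → Exec (.while c p) m' m'' t' →
        Exec (.while c p) m m'' (c.cost + t + t' + 1)
  | while_false {c : Test} {p : Prog} {m : State} :
      ¬ c.Holds m → Exec (.while c p) m m (c.cost + 1)

end RealRAM

open Classical in
/-- The initial memory for the spin system `S` on the vertices `0, …, n - 1` and the accuracy `ε`.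
Arrays of naturals: array 0 holds `n` and array 1 holds `q`, both at `(0, 0)`; array 2 holds the
adjacency matrix. Arrays of reals: array 0 holds `ε` at `(0, 0)`, array 1 holds `h` in column 0,
and array 2 holds `A`. All other entries are zero. In particular the program is told neither the
growth function, nor the mixing rate, nor any marginal lower bound. -/
noncomputable def SpinSystem.input {n q : ℕ} (S : SpinSystem (Fin n) q) (ε : ℝ) :
    RealRAM.State where
  nat a i j :=
    if a = 0 ∧ i = 0 ∧ j = 0 then n
    else if a = 1 ∧ i = 0 ∧ j = 0 then q
    else if a = 2 ∧ ∃ (hi : i < n) (hj : j < n), S.G.Adj ⟨i, hi⟩ ⟨j, hj⟩ then 1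
    else 0
  real a i j :=
    if a = 0 ∧ i = 0 ∧ j = 0 then ε
    else if hh : a = 1 ∧ i < q ∧ j = 0 then S.h ⟨i, hh.2.1⟩
    else if hA : a = 2 ∧ i < q ∧ j < q then S.A ⟨i, hA.2.1⟩ ⟨j, hA.2.2⟩
    else 0

/-- A halting program returns the entry `(0, 0)` of the array 3 of reals. -/
def RealRAM.State.output (m : RealRAM.State) : ℝ := m.real 3 0 0

/-! The algorithm fixes the spins of the vertices one after another and uses $Z =
w(\sigma)/\mu(\sigma)$: the weight of the resulting configuration is computed exactly, and its
probability is a product of conditional marginals. It thus suffices to bound each marginal from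
below by a vector $y$ that is provably correct. Since marginals sum to 1, the slack $1-\sum_i y_i$
also yields upper bounds. The spin of largest $y$ is chosen, so that its marginal is not small. A
result is returned only when the product of the upper bounds is at most $1+\varepsilon$ times that
of the lower bounds. Hence correctness depends on neither the mixing rate nor the growth function,
and rounds with growing budgets can simply try all pairs of a radius and a recursion level until one
of them certifies itself.

The lower bounds at $v$ come from a recursion of radius $L$ and level $k$. If the sphere of radius
$L$ about $v$ is assigned, it separates the ball from the rest, and enumerating the ball gives the
exact marginal (`partialWeight_mul_total`, `isLowerBound_of_ballWeight`). Otherwise an unassigned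
sphere vertex $u$ is chosen, bounds $f_a$ for the marginals at $v$ given spin $a$ at $u$ are
computed at the same level, and bounds $lo_a$ for the marginals at $u$ at level $k-1$. The new bound
is $\sum_a lo_a f_a + (1-\sum_a lo_a)\min_a f_a$, which is correct by the law of total probability.
Level 1 returns the zero vector.

Mixing at the single distance $L$, with $d=\delta(L)$, makes this accurate (`isLowerBound_branch`):
only the slack at $u$ is misallocated, and misallocating it costs at most $d$ times the slack. At
most $s=s(L)$ sphere vertices and $q$ spins turn a slack $\eta$ at level $k-1$ into $q s
d\,\eta\le\eta/2$ at level $k$. So $k=O(\log(qn/\varepsilon))$ levels suffice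
(`suffices_of_mixing`).

The recursion tree has at most $(q+2)^{B+sk}$ nodes, where $B$ exceeds the size of the balls
(`Branching.size_le`). With logarithmic $k$ this is polynomial in $n/\varepsilon$ with exponent
$O(\max\{1,s\}\log q)$ (`budget_pow_le`). The program uses counted loops in each round, so its time
is polynomial in $n$, $q$ and the budget. -/

/-! ## Loop programs

A fragment of the while-programs in which all loops are counted. Its programs have a semantics
given by a function on states, and their running time is polynomial in the loop bounds. -/

namespace RealRAM

/-- Programs with counted loops: `loop r b p` runs `p` with the register `r` set to
`0, 1, …, N - 1`, where `N` is the value of the register `b`. -/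
inductive LoopProg where
  | skip
  | writeNat (a : ℕ) (i j e : NExp)
  | writeReal (a : ℕ) (i j : NExp) (e : RExp)
  | seq (p p' : LoopProg)
  | ite (c : Test) (p p' : LoopProg)
  | loop (r b : ℕ) (p : LoopProg)

/-- The register `r`, which is the entry `(0, 0)` of the array `r` of naturals. -/
def NExp.reg (r : ℕ) : NExp := .read r (.const 0) (.const 0)

/-- The real register `r`. -/
def RExp.reg (r : ℕ) : RExp := .read r (.const 0) (.const 0)

@[simp] theorem NExp.eval_reg (m : State) (r : ℕ) : (NExp.reg r).eval m = m.nat r 0 0 := rfl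

@[simp] theorem RExp.eval_reg (m : State) (r : ℕ) : (RExp.reg r).eval m = m.real r 0 0 := rfl

namespace State

@[simp] theorem setNat_nat (m : State) (a i j x a' i' j' : ℕ) :
    (m.setNat a i j x).nat a' i' j' = if a' = a ∧ i' = i ∧ j' = j then x else m.nat a' i' j' := rfl

@[simp] theorem setNat_real (m : State) (a i j x : ℕ) : (m.setNat a i j x).real = m.real := rfl

@[simp] theorem setReal_nat (m : State) (a i j : ℕ) (x : ℝ) : (m.setReal a i j x).nat = m.nat := rfl

@[simp] theorem setReal_real (m : State) (a i j : ℕ) (x : ℝ) (a' i' j' : ℕ) :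
    (m.setReal a i j x).real a' i' j' =
      if a' = a ∧ i' = i ∧ j' = j then x else m.real a' i' j' := rfl

theorem setNat_nat_of_ne (m : State) {a a' : ℕ} (h : a' ≠ a) (i j x : ℕ) :
    (m.setNat a i j x).nat a' = m.nat a' := by
  funext i' j'; simp [h]

theorem setReal_real_of_ne (m : State) {a a' : ℕ} (h : a' ≠ a) (i j : ℕ) (x : ℝ) :
    (m.setReal a i j x).real a' = m.real a' := by
  funext i' j'; simp [h]

@[simp] theorem setNat_setNat (m : State) (a i j x y : ℕ) :
    (m.setNat a i j x).setNat a i j y = m.setNat a i j y := by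
  simp only [setNat, State.mk.injEq, and_true]
  funext a' i' j'
  split_ifs <;> rfl

end State

/-- Applies `f` to the state repeatedly, with the register `r` set to `0, 1, …`. -/
def iterate (r : ℕ) (f : State → State) : ℕ → State → State
  | 0, m => m
  | i + 1, m => f ((iterate r f i m).setNat r 0 0 i)

namespace LoopProg

open Classical in
/-- The state in which the program halts. -/
noncomputable def run : LoopProg → State → State
  | skip, m => m
  | writeNat a i j e, m => m.setNat a (i.eval m) (j.eval m) (e.eval m)
  | writeReal a i j e, m => m.setReal a (i.eval m) (j.eval m) (e.eval m)
  | seq p p', m => p'.run (p.run m)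
  | ite c p p', m => if c.Holds m then p.run m else p'.run m
  | loop r b p, m => (iterate r p.run (m.nat b 0 0) m).setNat r 0 0 (m.nat b 0 0)

/-- Translation into while-programs. -/
def compile : LoopProg → Prog
  | skip => .while (.natLe (.const 1) (.const 0)) (.writeNat 0 (.const 0) (.const 0) (.const 0))
  | writeNat a i j e => .writeNat a i j e
  | writeReal a i j e => .writeReal a i j e
  | seq p p' => .seq p.compile p'.compile
  | ite c p p' => .ite c p.compile p'.compile
  | loop r b p =>
      .seq (.writeNat r (.const 0) (.const 0) (.const 0))
        (.while (.not (.natLe (.reg b) (.reg r)))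
          (.seq p.compile (.writeNat r (.const 0) (.const 0) (.add (.reg r) (.const 1)))))

/-- The arrays of naturals that the program may change. -/
def natWrites : LoopProg → List ℕ
  | skip => []
  | writeNat a _ _ _ => [a]
  | writeReal _ _ _ _ => []
  | seq p p' => p.natWrites ++ p'.natWrites
  | ite _ p p' => p.natWrites ++ p'.natWrites
  | loop r _ p => r :: p.natWrites

/-- The arrays of reals that the program may change. -/
def realWrites : LoopProg → List ℕ
  | skip => []
  | writeNat _ _ _ _ => []
  | writeReal a _ _ _ => [a]
  | seq p p' => p.realWrites ++ p'.realWrites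
  | ite _ p p' => p.realWrites ++ p'.realWrites
  | loop _ _ p => p.realWrites

/-- Loop bounds are taken from the registers `bs`, which the program does not change; and no loop
body changes its own counter. -/
def wellFormed (bs : List ℕ) : LoopProg → Bool
  | skip => true
  | writeNat a _ _ _ => a ∉ bs
  | writeReal _ _ _ _ => true
  | seq p p' => p.wellFormed bs && p'.wellFormed bs
  | ite _ p p' => p.wellFormed bs && p'.wellFormed bs
  | loop r b p => r ∉ bs && b ∈ bs && r ∉ p.natWrites && p.wellFormed bs

/-- A bound for the running time when all loop bounds are at most `X`. -/
def cost (X : ℕ) : LoopProg → ℕ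
  | skip => 4
  | writeNat _ i j e => i.cost + j.cost + e.cost + 1
  | writeReal _ i j e => i.cost + j.cost + e.cost + 1
  | seq p p' => p.cost X + p'.cost X
  | ite c p p' => c.cost + (p.cost X + p'.cost X) + 1
  | loop _ _ p => X * (p.cost X + 17) + 13

/-- A loop raises the degree by one and sequencing adds degrees, so the exponent depends on the
program alone. This is the only source of polynomial running-time bounds. -/
theorem exists_cost_le (p : LoopProg) : ∃ c d : ℕ, ∀ X, 1 ≤ X → p.cost X ≤ c * X ^ d := by
  have key : ∀ (c d d' X : ℕ), 1 ≤ X → d ≤ d' → c * X ^ d ≤ c * X ^ d' := fun c d d' X hX h =>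
    Nat.mul_le_mul_left _ (Nat.pow_le_pow_right hX h)
  induction p with
  | skip => exact ⟨4, 0, fun X _ => by simp [cost]⟩
  | writeNat a i j e => exact ⟨_, 0, fun X _ => by rw [cost, pow_zero, mul_one]⟩
  | writeReal a i j e => exact ⟨_, 0, fun X _ => by rw [cost, pow_zero, mul_one]⟩
  | seq p p' ih ih' =>
    obtain ⟨c, d, h⟩ := ih
    obtain ⟨c', d', h'⟩ := ih'
    refine ⟨c + c', d + d', fun X hX => ?_⟩
    have := key c d (d + d') X hX (by omega)
    have := key c' d' (d + d') X hX (by omega)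
    rw [cost, add_mul]
    linarith [h X hX, h' X hX]
  | ite t p p' ih ih' =>
    obtain ⟨c, d, h⟩ := ih
    obtain ⟨c', d', h'⟩ := ih'
    refine ⟨c + c' + (t.cost + 1), d + d', fun X hX => ?_⟩
    have := key c d (d + d') X hX (by omega)
    have := key c' d' (d + d') X hX (by omega)
    have := key (t.cost + 1) 0 (d + d') X hX (by omega)
    rw [cost, add_mul, add_mul]
    linarith [h X hX, h' X hX]
  | loop r b p ih =>
    obtain ⟨c, d, h⟩ := ih
    refine ⟨c + 30, d + 1, fun X hX => ?_⟩
    have := Nat.mul_le_mul_left X (h X hX)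
    have := key 17 1 (d + 1) X hX (by omega)
    have := key 13 0 (d + 1) X hX (by omega)
    rw [cost, add_mul]
    have e : X * (c * X ^ d) = c * X ^ (d + 1) := by ring
    nlinarith

variable {p p' : LoopProg} {m m' : State} {a : ℕ}

theorem run_nat (p : LoopProg) (m : State) (h : a ∉ p.natWrites) : (p.run m).nat a = m.nat a := by
  induction p generalizing m with
  | skip => rfl
  | writeNat a' i j e =>
    exact m.setNat_nat_of_ne (by simpa [natWrites] using h) _ _ _
  | writeReal => rfl
  | seq p p' ih ih' =>
    simp only [natWrites, List.mem_append, not_or] at h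
    rw [run, ih' _ h.2, ih _ h.1]
  | ite c p p' ih ih' =>
    simp only [natWrites, List.mem_append, not_or] at h
    rw [run]
    split_ifs
    exacts [ih _ h.1, ih' _ h.2]
  | loop r b p ih =>
    simp only [natWrites, List.mem_cons, not_or] at h
    have : ∀ N, (iterate r p.run N m).nat a = m.nat a := by
      intro N
      induction N with
      | zero => rfl
      | succ N ihN => rw [iterate, ih _ h.2, State.setNat_nat_of_ne _ h.1, ihN]
    rw [run, State.setNat_nat_of_ne _ h.1, this]

theorem run_real (p : LoopProg) (m : State) (h : a ∉ p.realWrites) :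
    (p.run m).real a = m.real a := by
  induction p generalizing m with
  | skip => rfl
  | writeNat => rfl
  | writeReal a' i j e =>
    exact m.setReal_real_of_ne (by simpa [realWrites] using h) _ _ _
  | seq p p' ih ih' =>
    simp only [realWrites, List.mem_append, not_or] at h
    rw [run, ih' _ h.2, ih _ h.1]
  | ite c p p' ih ih' =>
    simp only [realWrites, List.mem_append, not_or] at h
    rw [run]
    split_ifs
    exacts [ih _ h.1, ih' _ h.2]
  | loop r b p ih =>
    simp only [realWrites] at h
    have : ∀ N, (iterate r p.run N m).real a = m.real a := by
      intro N
      induction N with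
      | zero => rfl
      | succ N ihN => rw [iterate, ih _ h, State.setNat_real, ihN]
    rw [run, State.setNat_real, this]

/-- The states agree on the arrays that the program does not change. -/
structure Agree (p : LoopProg) (m m' : State) : Prop where
  nat : ∀ a, a ∉ p.natWrites → m'.nat a = m.nat a
  real : ∀ a, a ∉ p.realWrites → m'.real a = m.real a

theorem agree_run (p : LoopProg) (m : State) : Agree p m (p.run m) :=
  ⟨fun _ h => run_nat p m h, fun _ h => run_real p m h⟩

theorem agree_iterate (r b : ℕ) (p : LoopProg) (m : State) (N : ℕ) :
    Agree (loop r b p) m (iterate r p.run N m) := by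
  induction N with
  | zero => exact ⟨fun _ _ => rfl, fun _ _ => rfl⟩
  | succ N ih =>
    refine ⟨fun a h => ?_, fun a h => ?_⟩
    · have h' := h
      simp only [natWrites, List.mem_cons, not_or] at h'
      rw [iterate, run_nat _ _ h'.2, State.setNat_nat_of_ne _ h'.1, ih.nat a h]
    · have h' : a ∉ p.realWrites := h
      rw [iterate, run_real _ _ h', State.setNat_real, ih.real a h]

/-- The rule for loops: `I i` holds before the `i`-th iteration. -/
theorem run_loop {r b : ℕ} {Q : State → Prop} (I : ℕ → State → Prop) (h0 : I 0 m)
    (hs : ∀ i m', i < m.nat b 0 0 → Agree (loop r b p) m m' → I i m' →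
      I (i + 1) (p.run (m'.setNat r 0 0 i)))
    (hQ : ∀ m', Agree (loop r b p) m m' → I (m.nat b 0 0) m' →
      Q (m'.setNat r 0 0 (m.nat b 0 0))) : Q ((loop r b p).run m) := by
  have key : ∀ N, N ≤ m.nat b 0 0 → I N (iterate r p.run N m) := by
    intro N
    induction N with
    | zero => exact fun _ => h0
    | succ N ih =>
      intro hN
      exact hs N _ (by omega) (agree_iterate r b p m N) (ih (by omega))
  exact hQ _ (agree_iterate r b p m _) (key _ le_rfl)

/-- Well-formedness freezes the loop bounds and protects each counter from its own body. The
translated `while` therefore makes exactly as many passes as the counted loop, and the bound `X`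
remains valid throughout. -/
theorem exec_compile {bs : List ℕ} {X : ℕ} (p : LoopProg) (m : State)
    (hp : p.wellFormed bs = true) (hm : ∀ b ∈ bs, m.nat b 0 0 ≤ X) :
    ∃ t ≤ p.cost X, Exec p.compile m (p.run m) t ∧
      ∀ b ∈ bs, (p.run m).nat b = m.nat b := by
  induction p generalizing m with
  | skip =>
    exact ⟨4, le_rfl, Exec.while_false (by simp [Test.Holds, NExp.eval]), fun _ _ => rfl⟩
  | writeNat a i j e =>
    refine ⟨_, le_rfl, Exec.writeNat a i j e m, fun b hb => m.setNat_nat_of_ne ?_ _ _ _⟩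
    rintro rfl
    simp [wellFormed, hb] at hp
  | writeReal a i j e => exact ⟨_, le_rfl, Exec.writeReal a i j e m, fun b hb => rfl⟩
  | seq p p' ih ih' =>
    simp only [wellFormed, Bool.and_eq_true] at hp
    obtain ⟨t, ht, he, hf⟩ := ih m hp.1 hm
    obtain ⟨t', ht', he', hf'⟩ := ih' (p.run m) hp.2 fun b hb => by rw [hf b hb]; exact hm b hb
    exact ⟨t + t', by rw [cost]; omega, Exec.seq he he', fun b hb => by
      rw [run, hf' b hb, hf b hb]⟩
  | ite c p p' ih ih' =>
    simp only [wellFormed, Bool.and_eq_true] at hp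
    by_cases hc : c.Holds m
    · obtain ⟨t, ht, he, hf⟩ := ih m hp.1 hm
      rw [run, if_pos hc]
      exact ⟨_, by rw [cost]; omega, Exec.ite_true hc he, hf⟩
    · obtain ⟨t, ht, he, hf⟩ := ih' m hp.2 hm
      rw [run, if_neg hc]
      exact ⟨_, by rw [cost]; omega, Exec.ite_false hc he, hf⟩
  | loop r b p ih =>
    simp only [wellFormed, Bool.and_eq_true, decide_eq_true_eq] at hp
    obtain ⟨⟨⟨hr, hb⟩, hrp⟩, hwf⟩ := hp
    have hne : ∀ b' ∈ bs, b' ≠ r := fun b' hb' h => hr (h ▸ hb')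
    set N := m.nat b 0 0 with hN
    have frame : ∀ i, ∀ b' ∈ bs, (iterate r p.run i m).nat b' = m.nat b' := by
      intro i
      induction i with
      | zero => exact fun _ _ => rfl
      | succ i ihi =>
        intro b' hb'
        obtain ⟨_, _, _, hf⟩ := ih ((iterate r p.run i m).setNat r 0 0 i) hwf fun b'' hb'' => by
          rw [State.setNat_nat_of_ne _ (hne _ hb''), ihi _ hb'']; exact hm _ hb''
        rw [iterate, hf b' hb', State.setNat_nat_of_ne _ (hne _ hb'), ihi _ hb']
    -- Induction on the number `j` of passes still to come. A pass costs the body plus 17: 8 for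
    -- incrementing the counter, 8 for the test and 1 for the loop. The final failing test costs 9,
    -- and the initial assignment accounts for the remaining 4 of the 13.
    have main : ∀ j i, i + j = N → ∃ t ≤ j * (p.cost X + 17) + 9,
        Exec (.while (.not (.natLe (.reg b) (.reg r)))
          (.seq p.compile (.writeNat r (.const 0) (.const 0) (.add (.reg r) (.const 1)))))
          ((iterate r p.run i m).setNat r 0 0 i)
          ((iterate r p.run N m).setNat r 0 0 N) t := by
      intro j
      induction j with
      | zero =>
        intro i hi
        obtain rfl : i = N := by omega
        refine ⟨_, ?_, Exec.while_false ?_⟩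
        · simp [Test.cost, NExp.reg, NExp.cost]
        · simp [Test.Holds, (hne b hb), frame N b hb, ← hN]
      | succ j ihj =>
        intro i hi
        obtain ⟨t', ht', he'⟩ := ihj (i + 1) (by omega)
        obtain ⟨t, ht, he, -⟩ := ih ((iterate r p.run i m).setNat r 0 0 i) hwf fun b'' hb'' => by
          rw [State.setNat_nat_of_ne _ (hne _ hb''), frame _ _ hb'']; exact hm _ hb''
        have hi' : (p.run ((iterate r p.run i m).setNat r 0 0 i)).nat r 0 0 = i := by
          rw [run_nat _ _ hrp]; simp
        have hw := Exec.writeNat r (.const 0) (.const 0) (.add (.reg r) (.const 1))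
          (p.run ((iterate r p.run i m).setNat r 0 0 i))
        simp only [NExp.eval, NExp.eval_reg, hi'] at hw
        refine ⟨_, ?_, Exec.while_true ?_ (Exec.seq he hw) he'⟩
        · simp only [Test.cost, NExp.reg, NExp.cost]
          have : (j + 1) * (p.cost X + 17) = j * (p.cost X + 17) + (p.cost X + 17) := by ring
          omega
        · simp [Test.Holds, (hne b hb), frame i b hb, ← hN]; omega
    obtain ⟨t, ht, he⟩ := main N 0 (by omega)
    refine ⟨_, ?_, Exec.seq (Exec.writeNat r (.const 0) (.const 0) (.const 0) m) he, ?_⟩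
    · have : N * (p.cost X + 17) ≤ X * (p.cost X + 17) := Nat.mul_le_mul_right _ (hm b hb)
      simp only [cost, NExp.cost]
      omega
    · intro b' hb'
      rw [run, State.setNat_nat_of_ne _ (hne b' hb'), frame _ _ hb']

end LoopProg

end RealRAM

/-! ## Partial configurations and conditional marginals -/

namespace SpinSystem

noncomputable section

open Function

set_option linter.unusedSectionVars false

variable {V : Type} {q : ℕ}

/-- The external field, extended by `1` to unassigned vertices. -/
def optH (S : SpinSystem V q) (o : Option (Fin q)) : ℝ := o.elim 1 S.h

/-- The interaction, extended by `1` to unassigned vertices. -/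
def optA (S : SpinSystem V q) : Option (Fin q) → Option (Fin q) → ℝ
  | some i, some j => S.A i j
  | _, _ => 1

theorem optA_symm (S : SpinSystem V q) (o o' : Option (Fin q)) : S.optA o o' = S.optA o' o := by
  cases o <;> cases o' <;> simp [optA, S.A_symm]

theorem optH_nonneg (S : SpinSystem V q) (o : Option (Fin q)) : 0 ≤ S.optH o := by
  cases o <;> simp [optH, S.h_nonneg]

theorem optA_nonneg (S : SpinSystem V q) (o o' : Option (Fin q)) : 0 ≤ S.optA o o' := by
  cases o <;> cases o' <;> simp [optA, S.A_nonneg]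

@[simp] theorem optA_none_left (S : SpinSystem V q) (o : Option (Fin q)) : S.optA none o = 1 := rfl

@[simp] theorem optA_none_right (S : SpinSystem V q) (o : Option (Fin q)) :
    S.optA o none = 1 := by
  cases o <;> rfl

/-- The factor that an edge contributes to the weight of a partial configuration. -/
def optEdge (S : SpinSystem V q) (τ : V → Option (Fin q)) (e : Sym2 V) : ℝ :=
  Sym2.lift ⟨fun u v => S.optA (τ u) (τ v), fun u v => S.optA_symm (τ u) (τ v)⟩ e

@[simp] theorem optEdge_mk (S : SpinSystem V q) (τ : V → Option (Fin q)) (u v : V) :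
    S.optEdge τ s(u, v) = S.optA (τ u) (τ v) := rfl

theorem optEdge_nonneg (S : SpinSystem V q) (τ : V → Option (Fin q)) (e : Sym2 V) :
    0 ≤ S.optEdge τ e := by
  induction e with | _ u v => exact S.optA_nonneg _ _

theorem edgeFactor_nonneg (S : SpinSystem V q) (σ : V → Fin q) (e : Sym2 V) :
    0 ≤ S.edgeFactor σ e := by
  induction e with | _ u v => exact S.A_nonneg _ _

/-- The full configuration `ρ` extends the partial configuration `τ`. -/
def Extends (τ : V → Option (Fin q)) (ρ : V → Fin q) : Prop := ∀ x i, τ x = some i → ρ x = i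

variable [Fintype V]

open Classical in
/-- The weight of a partial configuration: the weight in the subgraph of the assigned vertices. -/
def partialWeight (S : SpinSystem V q) (τ : V → Option (Fin q)) : ℝ :=
  (∏ v, S.optH (τ v)) * ∏ e ∈ S.G.edgeFinset, S.optEdge τ e

theorem partialWeight_nonneg (S : SpinSystem V q) (τ : V → Option (Fin q)) :
    0 ≤ S.partialWeight τ :=
  mul_nonneg (Finset.prod_nonneg fun _ _ => S.optH_nonneg _)
    (Finset.prod_nonneg fun _ _ => S.optEdge_nonneg _ _)

variable [DecidableEq V]

open Classical in
/-- The total weight of the configurations that extend `τ`. -/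
def total (S : SpinSystem V q) (τ : V → Option (Fin q)) : ℝ :=
  ∑ ρ with Extends τ ρ, S.weight ρ

/-- The marginal at `v`, conditioned on the partial configuration `τ`. -/
def marg (S : SpinSystem V q) (τ : V → Option (Fin q)) (v : V) (i : Fin q) : ℝ :=
  S.total (update τ v (some i)) / S.total τ

theorem weight_nonneg (S : SpinSystem V q) (ρ : V → Fin q) : 0 ≤ S.weight ρ :=
  mul_nonneg (Finset.prod_nonneg fun _ _ => S.h_nonneg _)
    (Finset.prod_nonneg fun _ _ => S.edgeFactor_nonneg _ _)

theorem partialWeight_some (S : SpinSystem V q) (ρ : V → Fin q) :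
    S.partialWeight (fun x => some (ρ x)) = S.weight ρ := by
  unfold partialWeight weight
  congr 1

theorem total_nonneg (S : SpinSystem V q) (τ : V → Option (Fin q)) : 0 ≤ S.total τ :=
  Finset.sum_nonneg fun _ _ => S.weight_nonneg _

theorem total_some (S : SpinSystem V q) (ρ : V → Fin q) :
    S.total (fun x => some (ρ x)) = S.weight ρ := by
  classical
  refine (Finset.sum_congr ?_ fun _ _ => rfl).trans (Finset.sum_singleton S.weight ρ)
  ext ρ'
  simp only [Finset.mem_filter, Finset.mem_univ, true_and, Finset.mem_singleton, Extends,
    Option.some.injEq]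
  exact ⟨fun h => funext fun x => h x _ rfl, fun h x i hi => by rw [h, hi]⟩

theorem total_none (S : SpinSystem V q) : S.total (fun _ => none) = S.partitionFunction := by
  classical
  unfold total partitionFunction
  exact Finset.sum_congr (Finset.filter_true_of_mem fun _ _ _ _ h => by simp at h) fun _ _ => rfl

theorem extends_update {τ : V → Option (Fin q)} {u : V} (hu : τ u = none) (a : Fin q)
    (ρ : V → Fin q) : Extends (update τ u (some a)) ρ ↔ Extends τ ρ ∧ ρ u = a := by
  constructor
  · intro h
    refine ⟨fun x i hx => h x i ?_, h u a (by simp)⟩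
    rw [update_of_ne, hx]
    rintro rfl
    simp [hu] at hx
  · rintro ⟨h, h'⟩ x i hx
    by_cases hxu : x = u
    · subst hxu; rw [update_self, Option.some.injEq] at hx; rw [h', hx]
    · rw [update_of_ne hxu] at hx; exact h x i hx

theorem total_eq_sum (S : SpinSystem V q) {τ : V → Option (Fin q)} {u : V} (hu : τ u = none) :
    S.total τ = ∑ a, S.total (update τ u (some a)) := by
  classical
  unfold total
  rw [← Finset.sum_fiberwise _ (fun ρ => ρ u)]
  refine Finset.sum_congr rfl fun a _ => Finset.sum_congr ?_ fun _ _ => rfl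
  ext ρ
  simp [extends_update hu]

theorem total_update_le (S : SpinSystem V q) {τ : V → Option (Fin q)} {u : V} (hu : τ u = none)
    (a : Fin q) : S.total (update τ u (some a)) ≤ S.total τ := by
  rw [S.total_eq_sum hu]
  exact Finset.single_le_sum (f := fun a => S.total (update τ u (some a)))
    (fun _ _ => S.total_nonneg _) (Finset.mem_univ a)

theorem exists_pos_of_total_pos (S : SpinSystem V q) {τ : V → Option (Fin q)}
    (h : 0 < S.total τ) : ∃ ρ, Extends τ ρ ∧ 0 < S.weight ρ := by
  classical
  obtain ⟨ρ, hρ, hw⟩ := Finset.exists_ne_zero_of_sum_ne_zero h.ne'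
  exact ⟨ρ, (Finset.mem_filter.1 hρ).2, (S.weight_nonneg ρ).lt_of_ne' hw⟩

theorem total_pos (S : SpinSystem V q) {τ : V → Option (Fin q)} {ρ : V → Fin q}
    (h : Extends τ ρ) (hw : 0 < S.weight ρ) : 0 < S.total τ := by
  classical
  exact hw.trans_le (Finset.single_le_sum (f := S.weight) (fun _ _ => S.weight_nonneg _)
    (Finset.mem_filter.2 ⟨Finset.mem_univ ρ, h⟩))

/-- Every factor of the partial weight is either 1 or a factor of the weight of an extension. -/
theorem partialWeight_pos_of_total_pos (S : SpinSystem V q) {τ : V → Option (Fin q)}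
    (h : 0 < S.total τ) : 0 < S.partialWeight τ := by
  obtain ⟨ρ, hρ, hw⟩ := S.exists_pos_of_total_pos h
  have h1 := left_ne_zero_of_mul hw.ne'
  have h2 := right_ne_zero_of_mul hw.ne'
  rw [Finset.prod_ne_zero_iff] at h1 h2
  refine mul_pos (Finset.prod_pos fun v _ => ?_) (Finset.prod_pos fun e he => ?_)
  · refine (S.optH_nonneg _).lt_of_ne' ?_
    cases hv : τ v with
    | none => simp [optH]
    | some i => rw [← hρ v i hv]; exact h1 v (Finset.mem_univ v)
  · refine (S.optEdge_nonneg _ _).lt_of_ne' ?_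
    have := h2 e he
    induction e with | _ u v =>
    rw [optEdge_mk]
    cases hu : τ u with
    | none => simp
    | some i =>
      cases hv : τ v with
      | none => simp
      | some j => rw [← hρ u i hu, ← hρ v j hv]; exact this

theorem total_eq_zero_of_partialWeight (S : SpinSystem V q) {τ : V → Option (Fin q)}
    (h : S.partialWeight τ = 0) : S.total τ = 0 := by
  by_contra hne
  exact (S.partialWeight_pos_of_total_pos ((S.total_nonneg τ).lt_of_ne' hne)).ne' h

section Bridge

variable [NeZero q]

/-- The set of vertices assigned by `τ`. -/
def assigned (τ : V → Option (Fin q)) : Finset V := Finset.univ.filter fun x => τ x ≠ none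

/-- A total function that agrees with `τ` on the assigned vertices. -/
def values (τ : V → Option (Fin q)) (x : V) : Fin q := (τ x).getD 0

theorem mem_extensions {τ : V → Option (Fin q)} {ρ : V → Fin q} :
    ρ ∈ extensions (assigned τ) (values τ) ↔ Extends τ ρ := by
  simp only [extensions, assigned, values, Finset.mem_filter, Finset.mem_univ, true_and, Extends]
  refine forall_congr' fun x => ?_
  cases τ x <;> simp

theorem feasible_iff (S : SpinSystem V q) (τ : V → Option (Fin q)) :
    S.Feasible (assigned τ) (values τ) ↔ 0 < S.total τ := by
  constructor
  · rintro ⟨ρ, hρ, hw⟩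
    exact S.total_pos (mem_extensions.1 hρ) hw
  · intro h
    obtain ⟨ρ, hρ, hw⟩ := S.exists_pos_of_total_pos h
    exact ⟨ρ, mem_extensions.2 hρ, hw⟩

/-- Permissiveness makes feasibility local: it can be read off from the partial weight, a finite
product that the program can compute, with no search for an extension. -/
theorem Permissive.total_pos {S : SpinSystem V q} (hS : S.Permissive) {τ : V → Option (Fin q)}
    (h : 0 < S.partialWeight τ) : 0 < S.total τ := by
  rw [← feasible_iff]
  have h1 := left_ne_zero_of_mul h.ne'
  have h2 := right_ne_zero_of_mul h.ne'
  rw [Finset.prod_ne_zero_iff] at h1 h2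
  refine hS _ _ (fun v hv => ?_) (fun u hu v hv huv => ?_)
  · have := h1 v (Finset.mem_univ v)
    simp only [assigned, Finset.mem_filter, Finset.mem_univ, true_and] at hv
    obtain ⟨i, hi⟩ := Option.ne_none_iff_exists'.1 hv
    refine (S.h_nonneg _).lt_of_ne' ?_
    simpa [values, hi, optH] using this
  · have := h2 s(u, v) (by simpa using huv)
    simp only [assigned, Finset.mem_filter, Finset.mem_univ, true_and] at hu hv
    obtain ⟨i, hi⟩ := Option.ne_none_iff_exists'.1 hu
    obtain ⟨j, hj⟩ := Option.ne_none_iff_exists'.1 hv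
    refine (S.A_nonneg _ _).lt_of_ne' ?_
    simpa [values, hi, hj, optA] using this

theorem Permissive.partitionFunction_pos {S : SpinSystem V q} (hS : S.Permissive) :
    0 < S.partitionFunction := by
  rw [← total_none]
  refine hS.total_pos (τ := fun _ => none) ?_
  simp only [partialWeight, optH, Option.elim_none, Finset.prod_const_one, one_mul]
  refine Finset.prod_pos fun e _ => ?_
  induction e with | _ u v => simp

/-- The normalization by $Z$ cancels, $Z$ being nonzero for a permissive system. From here on
conditional marginals are quotients of unnormalized totals. -/
theorem condMarginal_eq_marg {S : SpinSystem V q} (hS : S.Permissive) {τ : V → Option (Fin q)}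
    {v : V} (hv : τ v = none) (i : Fin q) :
    S.condMarginal (assigned τ) (values τ) v i = S.marg τ v i := by
  classical
  have hZ := hS.partitionFunction_pos.ne'
  have e1 : ∑ ρ ∈ extensions (assigned τ) (values τ), S.gibbs ρ =
      S.total τ / S.partitionFunction := by
    rw [total, Finset.sum_div]
    refine Finset.sum_congr ?_ fun _ _ => rfl
    ext ρ
    rw [mem_extensions]
    simp
  have e2 : ∑ ρ ∈ (extensions (assigned τ) (values τ)).filter (fun ρ => ρ v = i), S.gibbs ρ =
      S.total (update τ v (some i)) / S.partitionFunction := by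
    rw [total, Finset.sum_div]
    refine Finset.sum_congr ?_ fun _ _ => rfl
    ext ρ
    simp [mem_extensions, extends_update hv]
  rw [condMarginal, e1, e2, marg, div_div_div_cancel_right₀ hZ]

end Bridge

theorem marg_nonneg (S : SpinSystem V q) (τ : V → Option (Fin q)) (v : V) (i : Fin q) :
    0 ≤ S.marg τ v i := div_nonneg (S.total_nonneg _) (S.total_nonneg _)

theorem sum_marg (S : SpinSystem V q) {τ : V → Option (Fin q)} {v : V} (hv : τ v = none)
    (hτ : 0 < S.total τ) : ∑ i, S.marg τ v i = 1 := by
  unfold marg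
  rw [← Finset.sum_div, ← S.total_eq_sum hv, div_self hτ.ne']

theorem marg_le_one (S : SpinSystem V q) {τ : V → Option (Fin q)} {v : V} (hv : τ v = none)
    (hτ : 0 < S.total τ) (i : Fin q) : S.marg τ v i ≤ 1 := by
  rw [← S.sum_marg hv hτ]
  exact Finset.single_le_sum (f := fun i => S.marg τ v i) (fun _ _ => S.marg_nonneg _ _ _)
    (Finset.mem_univ i)

theorem marg_ne_zero_iff (S : SpinSystem V q) {τ : V → Option (Fin q)} {v : V}
    (hτ : 0 < S.total τ) (i : Fin q) :
    S.marg τ v i ≠ 0 ↔ 0 < S.total (update τ v (some i)) := by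
  rw [marg, div_ne_zero_iff]
  exact ⟨fun h => (S.total_nonneg _).lt_of_ne' h.1, fun h => ⟨h.ne', hτ.ne'⟩⟩

/-- The law of total probability. -/
theorem marg_eq_sum (S : SpinSystem V q) {τ : V → Option (Fin q)} {u v : V} (huv : u ≠ v)
    (hu : τ u = none) (hv : τ v = none) (i : Fin q) :
    S.marg τ v i = ∑ a, S.marg τ u a * S.marg (update τ u (some a)) v i := by
  have hu' : update τ v (some i) u = none := by rw [update_of_ne huv, hu]
  rw [marg, S.total_eq_sum hu', Finset.sum_div]
  refine Finset.sum_congr rfl fun a _ => ?_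
  unfold marg
  rw [update_comm huv.symm]
  -- For an infeasible spin `a` the conditional marginal is a division by zero, but then the joint
  -- total vanishes as well.
  by_cases h : S.total (update τ u (some a)) = 0
  · have : S.total (update (update τ u (some a)) v (some i)) = 0 := by
      refine le_antisymm (h ▸ S.total_update_le ?_ i) (S.total_nonneg _)
      rw [update_of_ne huv.symm, hv]
    rw [h, this]; simp
  · rw [div_mul_div_comm, mul_comm, mul_div_mul_right _ _ h]

end

end SpinSystem

namespace SpinSystem

noncomputable section

open Function

set_option linter.unusedSectionVars false

variable {V : Type} {q : ℕ} [Fintype V] [DecidableEq V]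

/-! ## Factorization over a separator -/

/-- The new factor is the field at `u` times the interactions with the assigned neighbours of `u`,
so it is determined by the spins of these neighbours. Edges at an unassigned vertex contributed 1
before. -/
theorem partialWeight_update (S : SpinSystem V q) {τ₁ τ₂ : V → Option (Fin q)} {u : V}
    (h₁ : τ₁ u = none) (h₂ : τ₂ u = none) (hN : ∀ y, S.G.Adj u y → τ₁ y = τ₂ y) (a : Fin q) :
    ∃ g, S.partialWeight (update τ₁ u (some a)) = S.partialWeight τ₁ * g ∧
      S.partialWeight (update τ₂ u (some a)) = S.partialWeight τ₂ * g := by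
  classical
  have hH : ∀ τ : V → Option (Fin q), τ u = none →
      ∏ v, S.optH (update τ u (some a) v) = (∏ v, S.optH (τ v)) * S.h a := by
    intro τ hτ
    rw [← Finset.mul_prod_erase _ _ (Finset.mem_univ u),
      ← Finset.mul_prod_erase _ (fun v => S.optH (τ v)) (Finset.mem_univ u), hτ, update_self,
      mul_comm]
    simp only [optH, Option.elim_none, Option.elim_some, one_mul]
    congr 1
    refine Finset.prod_congr rfl fun x hx => ?_
    rw [update_of_ne (Finset.ne_of_mem_erase hx)]
  have hE : ∀ τ : V → Option (Fin q), τ u = none →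
      ∏ e ∈ S.G.edgeFinset, S.optEdge (update τ u (some a)) e =
        (∏ e ∈ S.G.edgeFinset, S.optEdge τ e) *
          ∏ e ∈ S.G.edgeFinset, if u ∈ e then S.optEdge (update τ u (some a)) e else 1 := by
    intro τ hτ
    rw [← Finset.prod_mul_distrib]
    refine Finset.prod_congr rfl fun e _ => ?_
    induction e with | _ x y =>
    split_ifs with h
    · have : S.optEdge τ s(x, y) = 1 := by
        rcases Sym2.mem_iff.1 h with rfl | rfl <;> simp [hτ]
      rw [this, one_mul]
    · rw [Sym2.mem_iff, not_or] at h
      rw [mul_one, optEdge_mk, optEdge_mk, update_of_ne (Ne.symm h.1), update_of_ne (Ne.symm h.2)]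
  refine ⟨S.h a * ∏ e ∈ S.G.edgeFinset,
    if u ∈ e then S.optEdge (update τ₁ u (some a)) e else 1, ?_, ?_⟩
  · rw [partialWeight, partialWeight, hH _ h₁, hE _ h₁]; ring
  · have : (∏ e ∈ S.G.edgeFinset,
        if u ∈ e then S.optEdge (update τ₁ u (some a)) e else 1) =
        ∏ e ∈ S.G.edgeFinset, if u ∈ e then S.optEdge (update τ₂ u (some a)) e else 1 := by
      refine Finset.prod_congr rfl fun e he => ?_
      split_ifs with h
      · obtain ⟨y, rfl⟩ := h
        have hy : S.G.Adj u y := by simpa using he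
        rw [optEdge_mk, optEdge_mk, update_self, update_self, update_of_ne hy.ne', hN y hy,
          update_of_ne hy.ne']
      · rfl
    rw [this, partialWeight, partialWeight, hH _ h₂, hE _ h₂]; ring

/-- If the two partial configurations assign the same vertices, and agree on the neighbours of the
unassigned ones, then the unassigned part contributes the same factor to both totals. -/
theorem partialWeight_mul_total (S : SpinSystem V q) {τ₁ τ₂ : V → Option (Fin q)}
    (hd : ∀ x, τ₁ x = none ↔ τ₂ x = none)
    (hN : ∀ x y, τ₁ x = none → S.G.Adj x y → τ₁ y = τ₂ y) :
    S.partialWeight τ₂ * S.total τ₁ = S.partialWeight τ₁ * S.total τ₂ := by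
  induction hk : (Finset.univ.filter fun x => τ₁ x = none).card generalizing τ₁ τ₂ with
  | zero =>
    rw [Finset.card_eq_zero, Finset.filter_eq_empty_iff] at hk
    have key : ∀ τ : V → Option (Fin q), (∀ x, τ x ≠ none) → S.total τ = S.partialWeight τ := by
      intro τ h
      choose ρ hρ using fun x => Option.ne_none_iff_exists'.1 (h x)
      obtain rfl : τ = fun x => some (ρ x) := funext hρ
      rw [total_some, partialWeight_some]
    have h₁ : ∀ x, τ₁ x ≠ none := fun x => hk (Finset.mem_univ x)
    rw [key τ₁ h₁, key τ₂ fun x => (hd x).not.1 (h₁ x), mul_comm]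
  | succ k ih =>
    obtain ⟨u, hu⟩ : (Finset.univ.filter fun x => τ₁ x = none).Nonempty := by
      rw [← Finset.card_pos]; omega
    have h₁ : τ₁ u = none := (Finset.mem_filter.1 hu).2
    have h₂ := (hd u).1 h₁
    rw [S.total_eq_sum h₁, S.total_eq_sum h₂, Finset.mul_sum, Finset.mul_sum]
    refine Finset.sum_congr rfl fun a _ => ?_
    obtain ⟨g, hg₁, hg₂⟩ := S.partialWeight_update h₁ h₂ (fun y => hN u y h₁) a
    -- If `g` is zero it cannot be cancelled, but then both updated configurations have partial
    -- weight 0 and hence total 0.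
    by_cases hg : g = 0
    · rw [S.total_eq_zero_of_partialWeight (hg₁.trans (by simp [hg])),
        S.total_eq_zero_of_partialWeight (hg₂.trans (by simp [hg])), mul_zero, mul_zero]
    have := ih (τ₁ := update τ₁ u (some a)) (τ₂ := update τ₂ u (some a)) ?_ ?_ ?_
    · rw [hg₁, hg₂] at this
      refine mul_right_cancel₀ hg ?_
      linarith
    · intro x
      by_cases hx : x = u
      · subst hx; simp
      · rw [update_of_ne hx, update_of_ne hx, hd]
    · intro x y hx hxy
      by_cases hxu : x = u
      · subst hxu; simp at hx
      rw [update_of_ne hxu] at hx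
      by_cases hy : y = u
      · subst hy; simp
      · rw [update_of_ne hy, update_of_ne hy, hN x y hx hxy]
    · have : (Finset.univ.filter fun x => update τ₁ u (some a) x = none) =
          (Finset.univ.filter fun x => τ₁ x = none).erase u := by
        ext x
        by_cases hx : x = u
        · subst hx; simp
        · simp [hx]
      rw [this, Finset.card_erase_of_mem hu, hk, Nat.add_sub_cancel]

/-! ## Mixing at one distance -/

/-- Changing the spin of one vertex changes the marginals at distance `L` by at most `d`. -/
def MixesAt (S : SpinSystem V q) (L : ℕ) (d : ℝ) : Prop :=
  ∀ (τ : V → Option (Fin q)) (u v : V) (a a' i : Fin q), τ u = none → τ v = none → u ≠ v →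
    S.G.edist u v = L → 0 < S.total (update τ u (some a)) → 0 < S.total (update τ u (some a')) →
    S.marg (update τ u (some a)) v i - S.marg (update τ u (some a')) v i ≤ d

/-- The differences sum to zero, so the one at `i` is balanced by the others and counts twice in the
$\ell^1$ norm. -/
theorem sub_le_tvDist {p p' : Fin q → ℝ} (h : ∑ i, p i = ∑ i, p' i) (i : Fin q) :
    p i - p' i ≤ tvDist p p' := by
  have h0 : ∑ j, (p j - p' j) = 0 := by rw [Finset.sum_sub_distrib, h, sub_self]
  rw [← Finset.add_sum_erase _ _ (Finset.mem_univ i)] at h0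
  have h1 := Finset.abs_sum_le_sum_abs (fun j => p j - p' j) (Finset.univ.erase i)
  have h2 := neg_abs_le (∑ j ∈ Finset.univ.erase i, (p j - p' j))
  have h3 := le_abs_self (p i - p' i)
  rw [tvDist, ← Finset.add_sum_erase _ _ (Finset.mem_univ i)]
  have h4 := neg_abs_le (∑ j ∈ Finset.univ.erase i, (p j - p' j))
  linarith [le_abs_self (p i - p' i)]

/-- For distinct spins the two boundary conditions differ exactly at `u`, so the distance of the
nearest disagreement is exactly `L`. For equal spins there is no disagreement and the claim is `0 ≤
δ L`. -/
theorem StrongSpatialMixing.mixesAt [NeZero q] {S : SpinSystem V q} (hP : S.Permissive)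
    {δ : ℕ → ℝ} (hS : S.StrongSpatialMixing δ) {L : ℕ} (hδ : 0 ≤ δ L) : S.MixesAt L (δ L) := by
  intro τ u v a a' i hu hv huv hL ha ha'
  by_cases haa : a = a'
  · subst haa; simpa using hδ
  have hva : ∀ a, update τ u (some a) v = none := fun a => by rw [update_of_ne huv.symm, hv]
  have hd : assigned (update τ u (some a')) = assigned (update τ u (some a)) := by
    ext x
    by_cases hx : x = u
    · subst hx; simp [assigned]
    · simp [assigned, hx]
  have hval : ∀ x, values (update τ u (some a)) x ≠ values (update τ u (some a')) x ↔ x = u := by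
    intro x
    by_cases hx : x = u
    · subst hx; simpa [values] using haa
    · simp [values, hx]
  have f := (S.feasible_iff _).2 ha
  have f' := (S.feasible_iff _).2 ha'
  rw [hd] at f'
  have hmem : u ∈ assigned (update τ u (some a)) := by simp [assigned]
  have hvm : v ∉ assigned (update τ u (some a)) := by simp [assigned, hva]
  refine (sub_le_tvDist ?_ i).trans ?_
  · rw [S.sum_marg (hva a) ha, S.sum_marg (hva a') ha']
  have key := hS _ v hvm _ _ f f' L ?_
  · rw [funext fun i => condMarginal_eq_marg hP (hva a) i, ← hd,
      funext fun i => condMarginal_eq_marg hP (hva a') i] at key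
    exact key
  · refine ⟨⟨u, hmem, (hval u).2 rfl, hL⟩, ?_⟩
    rintro _ ⟨x, -, hx, rfl⟩
    rw [(hval x).1 hx, hL]

/-- Marginals sum to 1, so some spin has a nonzero one, which lies between `b` and 1. -/
theorem MarginalLowerBound.le_one [NeZero q] {S : SpinSystem V q} (hP : S.Permissive) {b : ℝ}
    (hb : S.MarginalLowerBound b) (v : V) : b ≤ 1 := by
  have hpos : 0 < S.total fun _ => none := by
    rw [total_none]; exact hP.partitionFunction_pos
  have hv : (fun _ => none : V → Option (Fin q)) v = none := rfl
  obtain ⟨i, -, hi⟩ := Finset.exists_ne_zero_of_sum_ne_zero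
    ((S.sum_marg hv hpos).trans_ne one_ne_zero)
  have := hb (assigned fun _ => none) v (by simp [assigned]) _ ((S.feasible_iff _).2 hpos) i
  rw [condMarginal_eq_marg hP hv] at this
  exact (this.resolve_right hi).trans (S.marg_le_one hv hpos i)

/-! ## Certified lower bounds for marginals -/

variable (S : SpinSystem V q) (L : ℕ)

/-- The number of unassigned vertices at distance `L` from `v`. -/
def unassignedSphere (v : V) (τ : V → Option (Fin q)) : ℕ :=
  {x : V | S.G.edist x v = L ∧ τ x = none}.ncard

/-- `z` is, up to a factor that does not depend on the spins at distance less than `L` from `v`,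
the total weight of the extensions of `τ`, provided that the sphere of radius `L` is assigned. -/
structure IsBallWeight (v : V) (τ : V → Option (Fin q)) (z : ℝ) : Prop where
  eq_zero : S.total τ = 0 → z = 0
  mul_total : (∀ x, S.G.edist x v = L → τ x ≠ none) →
    ∀ τ' : V → Option (Fin q), (∀ x, ¬ S.G.edist x v < L → τ' x = τ x) →
      (∀ x, S.G.edist x v < L → τ' x ≠ none) →
      S.partialWeight τ' * S.total τ = z * S.total τ'

/-- `y` is a vector of lower bounds for the marginals at `v`. If the system mixes at distance `L`,
then the bounds are tight up to an error that is exponentially small in `k`. -/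
structure IsLowerBound (k : ℕ) (v : V) (τ : V → Option (Fin q)) (y : Fin q → ℝ) : Prop where
  nonneg : 0 < S.total τ → ∀ i, 0 ≤ y i
  le_marg : 0 < S.total τ → ∀ i, y i ≤ S.marg τ v i
  eq_one : 2 ≤ k → S.total τ = 0 → ∀ i, y i = 1
  marg_sub_le : ∀ (d : ℝ) (s : ℕ), 0 ≤ d → S.MixesAt L d →
    (∀ v, {x : V | S.G.edist x v = L}.ncard ≤ s) → 0 < S.total τ → 2 ≤ k → ∀ i,
      S.marg τ v i - y i ≤ S.unassignedSphere L v τ * d * (q * s * d) ^ (k - 2)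
  one_sub_le : ∀ (d : ℝ) (s : ℕ), 0 ≤ d → S.MixesAt L d →
    (∀ v, {x : V | S.G.edist x v = L}.ncard ≤ s) → 0 < S.total τ →
      1 - ∑ i, y i ≤ (q * s * d) ^ (k - 1)

variable {S L}

/-- Once the ball and the sphere are assigned, an unassigned vertex has distance more than `L` from
`v`, and its neighbours lie outside the open ball, where `τ'` and `τ` agree. So the separator
identity applies. Permissiveness ensures that an infeasible `τ` is seen as a zero weight. -/
theorem isBallWeight_leaf [NeZero q] (hP : S.Permissive) {v : V} {τ : V → Option (Fin q)}
    (h : ∀ x, S.G.edist x v < L → τ x ≠ none) : S.IsBallWeight L v τ (S.partialWeight τ) where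
  eq_zero h0 := by
    by_contra hne
    exact (hP.total_pos ((S.partialWeight_nonneg τ).lt_of_ne' hne)).ne' h0
  mul_total hs τ' h₁ h₂ := by
    refine S.partialWeight_mul_total (fun x => ?_) fun x y hx hxy => ?_
    · by_cases hx : S.G.edist x v < L
      · simp [h x hx, h₂ x hx]
      · rw [h₁ x hx]
    · refine (h₁ y fun hy => ?_).symm
      have hle : S.G.edist x v ≤ L := by
        have h3 : S.G.edist x v ≤ S.G.edist x y + S.G.edist y v := S.G.edist_triangle
        rw [SimpleGraph.edist_eq_one_iff_adj.2 hxy, add_comm] at h3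
        exact h3.trans (Order.add_one_le_of_lt hy)
      rcases hle.lt_or_eq with hlt | heq
      · exact h x hlt hx
      · exact hs x heq hx

theorem isBallWeight_branch {u v : V} {τ : V → Option (Fin q)} {z : Fin q → ℝ}
    (hu : τ u = none) (huv : S.G.edist u v < L)
    (h : ∀ a, S.IsBallWeight L v (update τ u (some a)) (z a)) :
    S.IsBallWeight L v τ (∑ a, z a) where
  eq_zero h0 := by
    refine Finset.sum_eq_zero fun a _ => (h a).eq_zero ?_
    exact le_antisymm (h0 ▸ S.total_update_le hu a) (S.total_nonneg _)
  mul_total hs τ' h₁ h₂ := by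
    rw [S.total_eq_sum hu, Finset.mul_sum, Finset.sum_mul]
    refine Finset.sum_congr rfl fun a _ => (h a).mul_total (fun x hx => ?_) τ' (fun x hx => ?_) h₂
    · rw [update_of_ne]
      · exact hs x hx
      · rintro rfl; exact huv.ne hx
    · rw [update_of_ne]
      · exact h₁ x hx
      · rintro rfl; exact hx huv

/-- The base of the recursion: the zero vector has slack $1=(qsd)^0$. The convention for infeasible
configurations and the pointwise error bound are required only from level 2 on. -/
theorem isLowerBound_zero {v : V} {τ : V → Option (Fin q)} : S.IsLowerBound L 1 v τ 0 where
  nonneg _ _ := le_rfl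
  le_marg _ _ := S.marg_nonneg _ _ _
  eq_one h := by omega
  marg_sub_le _ _ _ _ _ _ h := by omega
  one_sub_le _ _ _ _ _ _ := by simp

/-- The pointwise errors are summed over the `q` spins, with at most `s` unassigned sphere vertices.
This supplies the missing factor `q * s * d`. -/
theorem one_sub_sum_le {k s : ℕ} {v : V} {τ : V → Option (Fin q)} {y : Fin q → ℝ} {d : ℝ}
    (hk : 2 ≤ k) (hd : 0 ≤ d) (hs : ∀ v, {x : V | S.G.edist x v = L}.ncard ≤ s)
    (hv : τ v = none) (hτ : 0 < S.total τ)
    (h : ∀ i, S.marg τ v i - y i ≤ S.unassignedSphere L v τ * d * (q * s * d) ^ (k - 2)) :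
    1 - ∑ i, y i ≤ (q * s * d) ^ (k - 1) := by
  have hu : (S.unassignedSphere L v τ : ℝ) ≤ s := by
    exact_mod_cast (Set.ncard_le_ncard (fun x (hx : _ ∧ _) => hx.1)
      (Set.toFinite _)).trans (hs v)
  have hpow : (0 : ℝ) ≤ (q * s * d) ^ (k - 2) := by positivity
  rw [← S.sum_marg hv hτ, ← Finset.sum_sub_distrib]
  calc ∑ i, (S.marg τ v i - y i) ≤ ∑ _i : Fin q, s * d * (q * s * d) ^ (k - 2) :=
        Finset.sum_le_sum fun i _ => (h i).trans (by gcongr)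
    _ = (q * s * d) ^ (k - 1) := by
        rw [Finset.sum_const, Finset.card_univ, Fintype.card_fin, nsmul_eq_mul,
          show k - 1 = k - 2 + 1 by omega, pow_succ]
        ring

/-- The ball weights are proportional to the true totals with a factor common to all spins at `v`,
so normalizing them gives the exact marginal. A vanishing sum indicates an infeasible `τ`; the value
is then 1, so that it does not lower the minimum taken at the parent. -/
theorem isLowerBound_of_ballWeight {k : ℕ} {v : V} {τ : V → Option (Fin q)}
    {z : Fin q → ℝ} (hL : 1 ≤ L) (hv : τ v = none)
    (hs : ∀ x, S.G.edist x v = L → τ x ≠ none)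
    (h : ∀ a, S.IsBallWeight L v (update τ v (some a)) (z a)) :
    S.IsLowerBound L k v τ fun i => if ∑ a, z a ≤ 0 then 1 else z i / ∑ a, z a := by
  have hvv : S.G.edist v v < L := by
    rw [SimpleGraph.edist_self]; exact_mod_cast hL
  have hB := isBallWeight_branch hv hvv h
  have h0 : S.total τ = 0 → ∀ i : Fin q,
      (if ∑ a, z a ≤ 0 then 1 else z i / ∑ a, z a) = 1 := by
    intro h0 i
    rw [hB.eq_zero h0, if_pos le_rfl]
  have h1 : 0 < S.total τ → ∀ i : Fin q,
      (if ∑ a, z a ≤ 0 then 1 else z i / ∑ a, z a) = S.marg τ v i := by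
    intro hτ i
    obtain ⟨ρ, hρ, hw⟩ := S.exists_pos_of_total_pos hτ
    classical
    -- A feasible completion of the open ball serves as reference: the common factor is `S.total τ'
    -- / S.partialWeight τ'`, with both terms positive.
    let τ' : V → Option (Fin q) := fun x => if S.G.edist x v < L then some (ρ x) else τ x
    have hτ' : 0 < S.total τ' := by
      refine S.total_pos (ρ := ρ) (fun x j hx => ?_) hw
      simp only [τ'] at hx
      split_ifs at hx
      · simpa using hx
      · exact hρ x j hx
    have hpw := S.partialWeight_pos_of_total_pos hτ'
    have e1 := hB.mul_total hs τ' (fun x hx => by simp [τ', hx]) (fun x hx => by simp [τ', hx])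
    have e2 := (h i).mul_total (fun x hx => by
      rw [update_of_ne (by rintro rfl; exact hvv.ne hx)]; exact hs x hx) τ'
      (fun x hx => by
        rw [update_of_ne (by rintro rfl; exact hx hvv)]; simp [τ', hx])
      (fun x hx => by simp [τ', hx])
    have hpos : 0 < ∑ a, z a := by
      refine pos_of_mul_pos_left (b := S.total τ') ?_ hτ'.le
      rw [← e1]; positivity
    rw [if_neg hpos.not_ge, marg, div_eq_div_iff hpos.ne' hτ.ne']
    refine mul_left_cancel₀ (mul_pos hpw hτ').ne' ?_
    calc S.partialWeight τ' * S.total τ' * (z i * S.total τ)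
        = (S.partialWeight τ' * S.total τ) * (z i * S.total τ') := by ring
      _ = _ := by rw [e1, ← e2]; ring
  refine ⟨fun hτ i => ?_, fun hτ i => (h1 hτ i).le, fun _ => h0, ?_, ?_⟩
  · rw [h1 hτ i]; exact S.marg_nonneg _ _ _
  · intro d s hd _ _ hτ _ i
    rw [h1 hτ i, sub_self]
    positivity
  · intro d s hd _ _ hτ
    simp only [h1 hτ]
    rw [S.sum_marg hv hτ, sub_self]
    positivity

/-- The heart of the analysis. The mass `1 - ∑ a, lo a` not accounted for at `u` is given the
smallest of the bounds `f a i`, which keeps the result below the marginal. By mixing, the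
conditional marginals at `v` for different feasible spins at `u` differ by at most `d`, so this
loses at most `d` times that mass, and the mass is bounded at level `k - 1`. Infeasible spins at `u`
have marginal 0 and `lo a = 0`; their value 1 is harmless in the minimum. -/
theorem isLowerBound_branch {k : ℕ} {u v : V} {τ : V → Option (Fin q)} {f : Fin q → Fin q → ℝ}
    {lo mn : Fin q → ℝ} (hL : 1 ≤ L) (hk : 2 ≤ k) (hu : τ u = none) (hv : τ v = none)
    (huv : S.G.edist u v = L) (hf : ∀ a, S.IsLowerBound L k v (update τ u (some a)) (f a))
    (hlo : S.IsLowerBound L (k - 1) u τ lo) (hle : ∀ a i, mn i ≤ f a i)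
    (hmn : ∀ i, ∃ a, mn i = f a i) :
    S.IsLowerBound L k v τ fun i => ∑ a, lo a * f a i + (1 - ∑ a, lo a) * mn i := by
  have hne : u ≠ v := by
    rintro rfl
    rw [SimpleGraph.edist_self] at huv
    exact absurd huv (by exact_mod_cast (by omega : (0 : ℕ) ≠ L))
  have hva : ∀ a, update τ u (some a) v = none := fun a => by rw [update_of_ne hne.symm, hv]
  have hzero : ∀ a, ¬ 0 < S.total (update τ u (some a)) → S.total (update τ u (some a)) = 0 :=
    fun a ha => le_antisymm (not_lt.1 ha) (S.total_nonneg _)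
  have hfnn : ∀ a i, 0 ≤ f a i := by
    intro a i
    by_cases ha : 0 < S.total (update τ u (some a))
    · exact (hf a).nonneg ha i
    · rw [(hf a).eq_one hk (hzero a ha)]; exact zero_le_one
  have hmnn : ∀ i, 0 ≤ mn i := fun i => by
    obtain ⟨a, ha⟩ := hmn i
    rw [ha]; exact hfnn a i
  have hsound : 0 < S.total τ → 0 ≤ 1 - ∑ a, lo a := by
    intro hτ
    rw [← S.sum_marg hu hτ, sub_nonneg]
    exact Finset.sum_le_sum fun a _ => hlo.le_marg hτ a
  have hp : 0 < S.total τ → ∀ a, ¬ 0 < S.total (update τ u (some a)) → S.marg τ u a = 0 :=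
    fun hτ a ha => by_contra fun h => ha ((S.marg_ne_zero_iff hτ a).1 h)
  have hp' : 0 < S.total τ → ∀ a, ¬ 0 < S.total (update τ u (some a)) → lo a = 0 :=
    fun hτ a ha => le_antisymm (hp hτ a ha ▸ hlo.le_marg hτ a) (hlo.nonneg hτ a)
  have hsub : ∀ (d : ℝ) (s : ℕ), 0 ≤ d → S.MixesAt L d →
      (∀ v, {x : V | S.G.edist x v = L}.ncard ≤ s) → 0 < S.total τ → ∀ i,
      S.marg τ v i - (∑ a, lo a * f a i + (1 - ∑ a, lo a) * mn i) ≤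
        S.unassignedSphere L v τ * d * (q * s * d) ^ (k - 2) := by
    intro d s hd hmix hs hτ i
    set T : ℝ := (q * s * d) ^ (k - 2) with hT
    have hT0 : 0 ≤ T := by positivity
    have hcard : ∀ a, S.unassignedSphere L v τ =
        S.unassignedSphere L v (update τ u (some a)) + 1 := by
      intro a
      have : {x : V | S.G.edist x v = L ∧ update τ u (some a) x = none} =
          {x : V | S.G.edist x v = L ∧ τ x = none} \ {u} := by
        ext x
        by_cases hx : x = u
        · subst hx; simp
        · simp [hx]
      rw [unassignedSphere, unassignedSphere, this,
        Set.ncard_sdiff_singleton_add_one (s := {x : V | S.G.edist x v = L ∧ τ x = none})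
          ⟨huv, hu⟩ (Set.toFinite _)]
    -- The error bound inherited from the children: once `u` is assigned, the sphere has one
    -- unassigned vertex fewer.
    set E : ℝ := (S.unassignedSphere L v τ - 1 : ℝ) * d * T with hE
    have hfE : ∀ a, 0 < S.total (update τ u (some a)) →
        S.marg (update τ u (some a)) v i - E ≤ f a i := by
      intro a ha
      have := (hf a).marg_sub_le d s hd hmix hs ha hk i
      rw [show (S.unassignedSphere L v (update τ u (some a)) : ℝ) =
        S.unassignedSphere L v τ - 1 by rw [hcard a]; push_cast; ring] at this
      linarith
    have hE0 : 0 ≤ E := by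
      have : (1 : ℝ) ≤ S.unassignedSphere L v τ := by
        have hq : 0 < q := by
          obtain ⟨ρ, -⟩ := S.exists_pos_of_total_pos hτ
          exact (Nat.zero_le _).trans_lt (ρ u).2
        exact_mod_cast (hcard ⟨0, hq⟩).symm ▸ Nat.le_add_left _ _
      have : (0 : ℝ) ≤ S.unassignedSphere L v τ - 1 := by linarith
      positivity
    have ht : 1 - ∑ a, lo a ≤ T := by
      have := hlo.one_sub_le d s hd hmix hs hτ
      rwa [show k - 1 - 1 = k - 2 by omega] at this
    -- The minimum must be compared with a feasible spin. If it is attained at an infeasible one it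
    -- equals 1, which is at least any marginal, and every feasible spin will do.
    obtain ⟨a₀, ha₀, hmin⟩ : ∃ a₀, 0 < S.total (update τ u (some a₀)) ∧
        S.marg (update τ u (some a₀)) v i - E ≤ mn i := by
      obtain ⟨a₁, ha₁⟩ := hmn i
      by_cases h : 0 < S.total (update τ u (some a₁))
      · exact ⟨a₁, h, ha₁ ▸ hfE a₁ h⟩
      · rw [S.total_eq_sum hu] at hτ
        obtain ⟨a₀, -, ha₀⟩ := Finset.exists_ne_zero_of_sum_ne_zero hτ.ne'
        have ha₀ := (S.total_nonneg (update τ u (some a₀))).lt_of_ne' ha₀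
        refine ⟨a₀, ha₀, ?_⟩
        rw [ha₁, (hf a₁).eq_one hk (hzero a₁ h)]
        linarith [S.marg_le_one (hva a₀) ha₀ i]
    set g : Fin q → ℝ := fun a => S.marg (update τ u (some a)) v i
    -- The marginal at `u` is split into the certified part `lo a`, with error `E`, and the rest, on
    -- which `g a` exceeds `g a₀` by at most `d`. Summing and comparing `mn i` with `g a₀ - E` gives
    -- the total error `E + d * T`.
    have hterm : ∀ a, S.marg τ u a * g a - lo a * f a i ≤
        (S.marg τ u a - lo a) * (g a₀ + d) + lo a * E := by
      intro a
      by_cases ha : 0 < S.total (update τ u (some a))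
      · have h1 := hmix τ u v a a₀ i hu hv hne huv ha ha₀
        have h2 := mul_le_mul_of_nonneg_left (hfE a ha) (hlo.nonneg hτ a)
        have h3 : (S.marg τ u a - lo a) * g a ≤ (S.marg τ u a - lo a) * (g a₀ + d) :=
          mul_le_mul_of_nonneg_left (by linarith) (sub_nonneg.2 (hlo.le_marg hτ a))
        linarith
      · simp [hp hτ a ha, hp' hτ a ha]
    have hsum := Finset.sum_le_sum fun a (_ : a ∈ Finset.univ) => hterm a
    rw [Finset.sum_sub_distrib, Finset.sum_add_distrib, ← Finset.sum_mul, ← Finset.sum_mul,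
      Finset.sum_sub_distrib, S.sum_marg hu hτ] at hsum
    rw [S.marg_eq_sum hne hu hv]
    have h4 := mul_le_mul_of_nonneg_left hmin (hsound hτ)
    have h5 := mul_le_mul_of_nonneg_right ht hd
    have h6 : E + d * T = S.unassignedSphere L v τ * d * T := by rw [hE]; ring
    linarith
  refine ⟨fun hτ i => ?_, fun hτ i => ?_, fun _ h0 i => ?_, fun d s hd hm hs hτ _ =>
    hsub d s hd hm hs hτ, fun d s hd hm hs hτ =>
    one_sub_sum_le hk hd hs hv hτ (hsub d s hd hm hs hτ)⟩
  · exact add_nonneg (Finset.sum_nonneg fun a _ => mul_nonneg (hlo.nonneg hτ a) (hfnn a i))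
      (mul_nonneg (hsound hτ) (hmnn i))
  · rw [S.marg_eq_sum hne hu hv]
    have hterm : ∀ a, lo a * f a i + (S.marg τ u a - lo a) * mn i ≤
        S.marg τ u a * S.marg (update τ u (some a)) v i := by
      intro a
      by_cases ha : 0 < S.total (update τ u (some a))
      · have h1 := mul_le_mul_of_nonneg_left (hle a i) (sub_nonneg.2 (hlo.le_marg hτ a))
        have h2 := mul_le_mul_of_nonneg_left ((hf a).le_marg ha i) (S.marg_nonneg τ u a)
        linarith
      · simp [hp hτ a ha, hp' hτ a ha]
    have hsum := Finset.sum_le_sum fun a (_ : a ∈ Finset.univ) => hterm a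
    rw [Finset.sum_add_distrib, ← Finset.sum_mul, Finset.sum_sub_distrib,
      S.sum_marg hu hτ] at hsum
    exact hsum
  · have hf1 : ∀ a, f a i = 1 := fun a => (hf a).eq_one hk
      (le_antisymm (h0 ▸ S.total_update_le hu a) (S.total_nonneg _)) i
    obtain ⟨a, ha⟩ := hmn i
    simp only [hf1, mul_one, ha]
    ring

end

end SpinSystem

/-! ## The algorithm

The program uses the following arrays.
Naturals: 0 is `n`, 1 is `q`, 2 the adjacency matrix, 3 the distances plus one (or zero when not
yet known), 4 the budget, 5 the success flag, 6 the radius minus one, 7 the level minus one,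
8 the current vertex; of the nodes of the recursion tree, 10 holds the partial configurations
(`0` for unassigned vertices, and the spin plus one for the others), 11 the levels, 12 the
vertices, 13 the first child, 14 the kind of branching; 15 is the number of nodes, 16 the node to
be expanded, 21 the validity flag, 27 the node to be evaluated; the others are auxiliary.
Reals: 0 is the accuracy, 1 the field, 2 the interaction, 3 the output, 4 the values of the nodes,
5 and 6 lower and upper bounds for the probability of the configuration; the others are
auxiliary. -/

namespace RealRAM

open LoopProg

/-- A conditional without alternative. -/
def LoopProg.when (c : Test) (p : LoopProg) : LoopProg := .ite c p .skip

/-- The natural constant `k` as a real expression. -/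
def RExp.const (k : ℕ) : RExp := .ofNat (.const k)

/-- Assignment to a register. -/
def LoopProg.set (r : ℕ) (e : NExp) : LoopProg := .writeNat r (.const 0) (.const 0) e

/-- Assignment to a real register. -/
def LoopProg.setR (r : ℕ) (e : RExp) : LoopProg := .writeReal r (.const 0) (.const 0) e

/-- The spin (plus one) of vertex `w` in the partial configuration of the node `id`. -/
def spinAt (id w : ℕ) : NExp := .read 10 (.reg id) (.reg w)

/-- The weight of the partial configuration of the node in register 22, put into register 7. -/
def weightProg : LoopProg :=
  .seq (.setR 7 (.const 1)) <|
  .loop 17 0 <|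
    .when (.natLe (.const 1) (spinAt 22 17)) <|
      .seq (.setR 7 (.mul (.reg 7) (.read 1 (.sub (spinAt 22 17) (.const 1)) (.const 0)))) <|
      .loop 18 0 <|
        .when (.not (.natLe (.reg 17) (.reg 18))) <|
        .when (.natLe (.const 1) (.read 2 (.reg 17) (.reg 18))) <|
        .when (.natLe (.const 1) (spinAt 22 18)) <|
        .setR 7 (.mul (.reg 7)
          (.read 2 (.sub (spinAt 22 17) (.const 1)) (.sub (spinAt 22 18) (.const 1))))

/-- One step of the breadth-first searches from all vertices: the distances equal to the budget
are entered. -/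
def layerProg : LoopProg :=
  .loop 17 0 <| .loop 18 0 <|
    .when (.natLe (.read 3 (.reg 17) (.reg 18)) (.const 0)) <|
    .loop 19 0 <|
      .when (.natLe (.const 1) (.read 2 (.reg 17) (.reg 19))) <|
      .when (.natLe (.read 3 (.reg 19) (.reg 18)) (.reg 4)) <|
      .when (.natLe (.reg 4) (.read 3 (.reg 19) (.reg 18))) <|
      .writeNat 3 (.reg 17) (.reg 18) (.add (.reg 4) (.const 1))

/-- The vertex that the node in register 16 branches on is put into register 26. -/
def pickProg : LoopProg :=
  .seq
    (.ite (.natLe (.read 11 (.reg 16) (.const 0)) (.const 0))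
      (.seq (.set 24 (.const 1)) (.set 25 (.add (.reg 6) (.const 1))))
      (.seq (.set 24 (.add (.reg 6) (.const 2))) (.set 25 (.add (.reg 6) (.const 2))))) <|
  .seq (.set 26 (.reg 0)) <|
  .loop 17 0 <|
    .when (.natLe (spinAt 16 17) (.const 0)) <|
    .when (.natLe (.reg 24) (.read 3 (.reg 17) (.read 12 (.reg 16) (.const 0)))) <|
    .when (.natLe (.read 3 (.reg 17) (.read 12 (.reg 16) (.const 0))) (.reg 25)) <|
    .set 26 (.reg 17)

/-- The kind of branching at the node in register 16 is determined; registers 29 and 31 receive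
the levels of the children. -/
def kindProg : LoopProg :=
  .seq (.writeNat 14 (.reg 16) (.const 0) (.const 1)) <|
  .seq (.set 29 (.read 11 (.reg 16) (.const 0))) <|
  .seq (.set 31 (.const 1)) <|
  .ite (.natLe (.read 11 (.reg 16) (.const 0)) (.const 1))
    (.ite (.natLe (.read 11 (.reg 16) (.const 0)) (.const 0))
      (.when (.natLe (.reg 0) (.reg 26)) (.writeNat 14 (.reg 16) (.const 0) (.const 0)))
      (.writeNat 14 (.reg 16) (.const 0) (.const 0)))
    (.ite (.natLe (.reg 0) (.reg 26))
      (.seq (.writeNat 14 (.reg 16) (.const 0) (.const 2)) <|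
       .seq (.set 26 (.read 12 (.reg 16) (.const 0))) (.set 29 (.const 0)))
      (.set 31 (.sub (.read 11 (.reg 16) (.const 0)) (.const 1))))

/-- The partial configuration of the node in register 16 is copied to the node in register 22. -/
def copyProg : LoopProg :=
  .loop 17 0 (.writeNat 10 (.reg 22) (.reg 17) (spinAt 16 17))

/-- The children of the node in register 16 are appended to the list of nodes. -/
def childrenProg : LoopProg :=
  .seq (.writeNat 13 (.reg 16) (.const 0) (.reg 15)) <|
  .when (.natLe (.const 1) (.read 14 (.reg 16) (.const 0))) <|
  .seq
    (.loop 19 1 <|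
      .seq (.set 22 (.add (.reg 15) (.reg 19))) <|
      .seq copyProg <|
      .seq (.writeNat 10 (.reg 22) (.reg 26) (.add (.reg 19) (.const 1))) <|
      .seq (.writeNat 11 (.reg 22) (.const 0) (.reg 29)) <|
      .writeNat 12 (.reg 22) (.const 0) (.read 12 (.reg 16) (.const 0))) <|
  .seq (.set 22 (.add (.reg 15) (.reg 1))) <|
  .seq copyProg <|
  .seq (.writeNat 11 (.reg 22) (.const 0) (.reg 31)) <|
  .seq (.writeNat 12 (.reg 22) (.const 0) (.reg 26)) <|
  .set 15 (.add (.reg 15) (.add (.reg 1) (.const 1)))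

/-- The tree below the root, which is node 0, is built, up to the budget. -/
def treeProg : LoopProg :=
  .loop 16 4 <|
    .when (.not (.natLe (.reg 15) (.reg 16))) <|
    .seq pickProg <| .seq kindProg childrenProg

/-- The value in column `j` of the child with number `c` of the node in register 27. -/
def childValue (c j : NExp) : RExp := .read 4 (.add (.read 13 (.reg 27) (.const 0)) c) j

/-- Register 8 receives the sum of the values of the children, in column 0. -/
def sumChildrenProg : LoopProg :=
  .seq (.setR 8 (.const 0)) <|
  .loop 19 1 (.setR 8 (.add (.reg 8) (childValue (.reg 19) (.const 0))))

/-- The value of a node that branches on a vertex of the sphere. -/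
def mixProg : LoopProg :=
  .seq (.setR 8 (.const 0)) <|
  .seq (.loop 19 1 (.setR 8 (.add (.reg 8) (childValue (.reg 1) (.reg 19))))) <|
  .loop 20 1 <|
    .seq (.setR 9 (childValue (.const 0) (.reg 20))) <|
    .seq (.setR 10 (.const 0)) <|
    .seq
      (.loop 19 1 <|
        .seq (.setR 10 (.add (.reg 10)
          (.mul (childValue (.reg 1) (.reg 19)) (childValue (.reg 19) (.reg 20))))) <|
        .when (.realLe (childValue (.reg 19) (.reg 20)) (.reg 9)) <|
        .setR 9 (childValue (.reg 19) (.reg 20))) <|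
    .writeReal 4 (.reg 27) (.reg 20)
      (.add (.reg 10) (.mul (.sub (.const 1) (.reg 8)) (.reg 9)))

/-- The value of a node whose sphere is assigned. -/
def normalizeProg : LoopProg :=
  .seq sumChildrenProg <|
  .loop 20 1 <|
    .ite (.realLe (.reg 8) (.const 0))
      (.writeReal 4 (.reg 27) (.reg 20) (.const 1))
      (.writeReal 4 (.reg 27) (.reg 20) (.div (childValue (.reg 20) (.const 0)) (.reg 8)))

/-- The node in register 27 is evaluated. -/
def evalProg : LoopProg :=
  .seq (.set 22 (.reg 27)) <|
  .ite (.natLe (.read 11 (.reg 27) (.const 0)) (.const 1))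
    (.ite (.natLe (.read 11 (.reg 27) (.const 0)) (.const 0))
      (.ite (.natLe (.read 14 (.reg 27) (.const 0)) (.const 0))
        (.seq weightProg (.writeReal 4 (.reg 27) (.const 0) (.reg 7)))
        (.seq sumChildrenProg (.writeReal 4 (.reg 27) (.const 0) (.reg 8))))
      (.loop 20 1 (.writeReal 4 (.reg 27) (.reg 20) (.const 0))))
    (.ite (.natLe (.read 14 (.reg 27) (.const 0)) (.const 1)) mixProg normalizeProg)

/-- All nodes are evaluated, the children before their parents. -/
def valuesProg : LoopProg :=
  .loop 28 4 <|
    .seq (.set 27 (.sub (.reg 4) (.add (.reg 28) (.const 1)))) evalProg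

/-- A spin of largest value at the root is put into register 23, and the sum of the values at the
root into register 8. -/
def argmaxProg : LoopProg :=
  .seq (.set 23 (.const 0)) <|
  .seq (.setR 8 (.const 0)) <|
  .loop 19 1 <|
    .seq (.setR 8 (.add (.reg 8) (.read 4 (.const 0) (.reg 19)))) <|
    .when (.realLe (.read 4 (.const 0) (.reg 23)) (.read 4 (.const 0) (.reg 19))) <|
    .set 23 (.reg 19)

/-- The vertex in register 8 is assigned. -/
def assignProg : LoopProg :=
  .seq (.writeNat 11 (.const 0) (.const 0) (.add (.reg 7) (.const 1))) <|
  .seq (.writeNat 12 (.const 0) (.const 0) (.reg 8)) <|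
  .seq (.set 15 (.const 1)) <|
  .seq treeProg <|
  .seq valuesProg <|
  .seq argmaxProg <|
  .seq (.when (.not (.natLe (.reg 15) (.reg 4))) (.set 21 (.const 0))) <|
  .seq (.when (.realLe (.read 4 (.const 0) (.reg 23)) (.const 0)) (.set 21 (.const 0))) <|
  .seq (.setR 5 (.mul (.reg 5) (.read 4 (.const 0) (.reg 23)))) <|
  .seq (.setR 6 (.mul (.reg 6)
    (.add (.read 4 (.const 0) (.reg 23)) (.sub (.const 1) (.reg 8))))) <|
  .writeNat 10 (.const 0) (.reg 8) (.add (.reg 23) (.const 1))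

/-- One attempt, with the radius and the level given by registers 6 and 7. -/
def attemptProg : LoopProg :=
  .seq (.set 21 (.const 1)) <|
  .seq (.setR 5 (.const 1)) <|
  .seq (.setR 6 (.const 1)) <|
  .seq (.loop 17 0 (.writeNat 10 (.const 0) (.reg 17) (.const 0))) <|
  .seq (.loop 8 0 assignProg) <|
  .seq (.set 22 (.const 0)) <|
  .seq weightProg <|
  .when (.natLe (.const 1) (.reg 21)) <|
  .when (.realLe (.reg 6) (.mul (.add (.const 1) (.reg 0)) (.reg 5))) <|
  .seq (.setR 3 (.div (.reg 7) (.reg 5))) (.set 5 (.const 1))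

/-- All attempts with radius and level at most the budget. -/
def roundProg : LoopProg :=
  .seq layerProg (.loop 6 4 (.loop 7 4 attemptProg))

/-- The distance of a vertex to itself is entered. -/
def initProg : LoopProg := .loop 17 0 (.writeNat 3 (.reg 17) (.reg 17) (.const 1))

/-- The algorithm: rounds with increasing budgets, until one of them succeeds. -/
def countingProg : Prog :=
  .seq initProg.compile <|
  .while (.natLe (.reg 5) (.const 0)) <|
    .seq (.writeNat 4 (.const 0) (.const 0) (.add (.reg 4) (.const 1))) roundProg.compile

/-! ### Evaluation rules, the encoding of the input, and the weight of a stored configuration. -/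

@[simp] theorem NExp.eval_const (m : State) (k : ℕ) : (NExp.const k).eval m = k := rfl

@[simp] theorem NExp.eval_read (m : State) (a : ℕ) (i j : NExp) :
    (NExp.read a i j).eval m = m.nat a (i.eval m) (j.eval m) := rfl

@[simp] theorem NExp.eval_add (m : State) (e f : NExp) :
    (NExp.add e f).eval m = e.eval m + f.eval m := rfl

@[simp] theorem NExp.eval_sub (m : State) (e f : NExp) :
    (NExp.sub e f).eval m = e.eval m - f.eval m := rfl

@[simp] theorem RExp.eval_const (m : State) (k : ℕ) : (RExp.const k).eval m = k := rfl

@[simp] theorem RExp.eval_read (m : State) (a : ℕ) (i j : NExp) :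
    (RExp.read a i j).eval m = m.real a (i.eval m) (j.eval m) := rfl

@[simp] theorem RExp.eval_add (m : State) (e f : RExp) :
    (RExp.add e f).eval m = e.eval m + f.eval m := rfl

@[simp] theorem RExp.eval_sub (m : State) (e f : RExp) :
    (RExp.sub e f).eval m = e.eval m - f.eval m := rfl

@[simp] theorem RExp.eval_mul (m : State) (e f : RExp) :
    (RExp.mul e f).eval m = e.eval m * f.eval m := rfl

@[simp] theorem RExp.eval_div (m : State) (e f : RExp) :
    (RExp.div e f).eval m = e.eval m / f.eval m := rfl

@[simp] theorem Test.holds_natLe (m : State) (e f : NExp) :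
    (Test.natLe e f).Holds m ↔ e.eval m ≤ f.eval m := Iff.rfl

@[simp] theorem Test.holds_realLe (m : State) (e f : RExp) :
    (Test.realLe e f).Holds m ↔ e.eval m ≤ f.eval m := Iff.rfl

@[simp] theorem Test.holds_not (m : State) (c : Test) :
    (Test.not c).Holds m ↔ ¬ c.Holds m := Iff.rfl

@[simp] theorem eval_spinAt (m : State) (id w : ℕ) :
    (spinAt id w).eval m = m.nat 10 (m.nat id 0 0) (m.nat w 0 0) := rfl

@[simp] theorem eval_childValue (m : State) (c j : NExp) :
    (childValue c j).eval m =
      m.real 4 (m.nat 13 (m.nat 27 0 0) 0 + c.eval m) (j.eval m) := rfl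

namespace LoopProg

open Classical in
@[simp] theorem run_when (c : Test) (p : LoopProg) (m : State) :
    (when c p).run m = if c.Holds m then p.run m else m := rfl

open Classical in
@[simp] theorem run_ite (c : Test) (p p' : LoopProg) (m : State) :
    (ite c p p').run m = if c.Holds m then p.run m else p'.run m := rfl

@[simp] theorem run_seq (p p' : LoopProg) (m : State) :
    (seq p p').run m = p'.run (p.run m) := rfl

@[simp] theorem run_writeNat (a : ℕ) (i j e : NExp) (m : State) :
    (writeNat a i j e).run m = m.setNat a (i.eval m) (j.eval m) (e.eval m) := rfl

@[simp] theorem run_writeReal (a : ℕ) (i j : NExp) (e : RExp) (m : State) :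
    (writeReal a i j e).run m = m.setReal a (i.eval m) (j.eval m) (e.eval m) := rfl

@[simp] theorem run_set (r : ℕ) (e : NExp) (m : State) :
    (set r e).run m = m.setNat r 0 0 (e.eval m) := rfl

@[simp] theorem run_setR (r : ℕ) (e : RExp) (m : State) :
    (setR r e).run m = m.setReal r 0 0 (e.eval m) := rfl

end LoopProg

/-- The input part of the memory. -/
structure HasInput {n q : ℕ} (S : SpinSystem (Fin n) q) (ε : ℝ) (m : State) : Prop where
  n_eq : m.nat 0 0 0 = n
  q_eq : m.nat 1 0 0 = q
  adj : ∀ u v : Fin n, 1 ≤ m.nat 2 u v ↔ S.G.Adj u v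
  ε_eq : m.real 0 0 0 = ε
  h_eq : ∀ i : Fin q, m.real 1 i 0 = S.h i
  A_eq : ∀ i j : Fin q, m.real 2 i j = S.A i j

theorem hasInput_input {n q : ℕ} (S : SpinSystem (Fin n) q) (ε : ℝ) :
    HasInput S ε (S.input ε) where
  n_eq := by simp [SpinSystem.input]
  q_eq := by simp [SpinSystem.input]
  adj u v := by by_cases h : S.G.Adj u v <;> simp [SpinSystem.input, h]
  ε_eq := by simp [SpinSystem.input]
  h_eq i := by simp [SpinSystem.input]
  A_eq i j := by simp [SpinSystem.input]

theorem HasInput.congr {n q : ℕ} {S : SpinSystem (Fin n) q} {ε : ℝ} {m m' : State}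
    (h : HasInput S ε m) (h0 : m'.nat 0 = m.nat 0) (h1 : m'.nat 1 = m.nat 1)
    (h2 : m'.nat 2 = m.nat 2) (r0 : m'.real 0 = m.real 0) (r1 : m'.real 1 = m.real 1)
    (r2 : m'.real 2 = m.real 2) : HasInput S ε m' := by
  constructor
  · rw [h0, h.n_eq]
  · rw [h1, h.q_eq]
  · rw [h2]; exact h.adj
  · rw [r0, h.ε_eq]
  · rw [r1]; exact h.h_eq
  · rw [r2]; exact h.A_eq

/-- The code of an optional spin. -/
def code {q : ℕ} (o : Option (Fin q)) : ℕ := o.elim 0 fun i => i + 1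

@[simp] theorem code_none {q : ℕ} : code (none : Option (Fin q)) = 0 := rfl

@[simp] theorem code_some {q : ℕ} (i : Fin q) : code (some i) = i + 1 := rfl

@[simp] theorem code_eq_zero {q : ℕ} {o : Option (Fin q)} : code o = 0 ↔ o = none := by
  cases o <;> simp

theorem optA_eq {n q : ℕ} {S : SpinSystem (Fin n) q} {ε : ℝ} {m : State} (h : HasInput S ε m)
    (o o' : Option (Fin q)) : S.optA o o' =
      if 1 ≤ code o ∧ 1 ≤ code o' then m.real 2 (code o - 1) (code o' - 1) else 1 := by
  cases o <;> cases o' <;> simp [SpinSystem.optA, h.A_eq]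

theorem optH_eq {n q : ℕ} {S : SpinSystem (Fin n) q} {ε : ℝ} {m : State} (h : HasInput S ε m)
    (o : Option (Fin q)) : S.optH o = if 1 ≤ code o then m.real 1 (code o - 1) 0 else 1 := by
  cases o <;> simp [SpinSystem.optH, h.h_eq]

/-- An undirected edge is represented once, with its larger endpoint first; this is the order in
which `weightProg` visits pairs. -/
theorem prod_edgeFinset {n q : ℕ} (S : SpinSystem (Fin n) q) (τ : Fin n → Option (Fin q))
    [DecidableRel S.G.Adj] [Fintype S.G.edgeSet] :
    ∏ e ∈ S.G.edgeFinset, S.optEdge τ e =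
      ∏ u, ∏ v, if v < u ∧ S.G.Adj u v then S.optA (τ u) (τ v) else 1 := by
  rw [← Finset.prod_product', ← Finset.prod_filter]
  symm
  refine Finset.prod_bij (fun x _ => s(x.1, x.2)) ?_ ?_ ?_ ?_
  · rintro ⟨u, v⟩ h
    simpa using (Finset.mem_filter.1 h).2.2
  · rintro ⟨u, v⟩ h ⟨u', v'⟩ h' he
    have h1 := (Finset.mem_filter.1 h).2.1
    have h2 := (Finset.mem_filter.1 h').2.1
    simp only [Sym2.eq_iff] at he
    rcases he with ⟨rfl, rfl⟩ | ⟨rfl, rfl⟩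
    · rfl
    · exact absurd h1 h2.not_gt
  · intro e he
    induction e with | _ u v =>
    have huv : S.G.Adj u v := by simpa using he
    rcases lt_or_gt_of_ne huv.ne with h | h
    · exact ⟨(v, u), by simp [h, huv.symm], Sym2.eq_swap⟩
    · exact ⟨(u, v), by simp [h, huv], rfl⟩
  · rintro ⟨u, v⟩ _
    rfl

/-- The loop invariants are the partial products over rows and over columns. Factors of unassigned
vertices are 1, matching `optH` and `optA`, so skipped iterations are harmless. -/
theorem weightProg_spec {n q : ℕ} {S : SpinSystem (Fin n) q} {ε : ℝ} {m : State}
    (h : HasInput S ε m) {τ : Fin n → Option (Fin q)}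
    (hτ : ∀ w : Fin n, m.nat 10 (m.nat 22 0 0) w = code (τ w)) :
    (weightProg.run m).real 7 0 0 = S.partialWeight τ := by
  classical
  set c : ℕ → ℕ := m.nat 10 (m.nat 22 0 0) with hc
  set f : ℕ → ℕ → ℝ := fun w w' => if w' < w ∧ 1 ≤ m.nat 2 w w' then
    (if 1 ≤ c w ∧ 1 ≤ c w' then m.real 2 (c w - 1) (c w' - 1) else 1) else 1 with hf
  set g : ℕ → ℝ := fun w => if 1 ≤ c w then m.real 1 (c w - 1) 0 else 1 with hg
  have key : (weightProg.run m).real 7 0 0 =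
      ∏ w ∈ Finset.range n, (g w * ∏ w' ∈ Finset.range n, f w w') := by
    rw [weightProg, run_seq]
    refine run_loop (Q := fun s => s.real 7 0 0 = _) (fun i m' => m'.real 7 0 0 =
      ∏ w ∈ Finset.range i, (g w * ∏ w' ∈ Finset.range n, f w w')) ?_ ?_ ?_
    · simp
    · intro i m' _ hA hI
      have a0 := hA.nat 0 (by decide)
      have a2 := hA.nat 2 (by decide)
      have a10 := hA.nat 10 (by decide)
      have a22 := hA.nat 22 (by decide)
      have r1 := hA.real 1 (by decide)
      have r2 := hA.real 2 (by decide)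
      simp only [run_setR, State.setReal_nat] at a0 a2 a10 a22
      rw [run_setR, State.setReal_real_of_ne _ (by decide)] at r1 r2
      rw [Finset.prod_range_succ, ← hI]
      by_cases hi : 1 ≤ c i
      · rw [run_when, if_pos (by simpa [a10, a22, ← hc] using hi), run_seq]
        refine run_loop (Q := fun s => s.real 7 0 0 = _) (fun j m'' => m''.real 7 0 0 =
          m'.real 7 0 0 * (g i * ∏ w' ∈ Finset.range j, f i w')) ?_ ?_ ?_
        · simp [a10, a22, ← hc, hg, hi, r1]
        · intro j m'' _ hB hJ
          have b2 := hB.nat 2 (by decide)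
          have b10 := hB.nat 10 (by decide)
          have b22 := hB.nat 22 (by decide)
          have b17 := hB.nat 17 (by decide)
          have s2 := hB.real 2 (by decide)
          rw [run_setR, State.setReal_real_of_ne _ (by decide), State.setNat_real, r2] at s2
          simp only [run_setR, State.setReal_nat] at b2 b10 b22 b17
          rw [State.setNat_nat_of_ne _ (by decide)] at b2 b10 b22
          rw [a2] at b2
          rw [a10] at b10
          rw [a22] at b22
          rw [Finset.prod_range_succ, ← mul_assoc (g i), ← mul_assoc, ← hJ]
          simp only [run_when, Test.holds_not, Test.holds_natLe, NExp.eval_reg, eval_spinAt,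
            NExp.eval_const, NExp.eval_read]
          simp only [State.setNat_nat, b2, b10, b22, b17]
          by_cases h1 : j < i <;> by_cases h2 : 1 ≤ m.nat 2 i j <;> by_cases h3 : 1 ≤ c j <;>
            simp [h1, h2, h3, hf, hi, s2, b10, b22, b17, ← hc]
        · intro m'' _ hJ
          simpa [a0, h.n_eq] using hJ
      · rw [run_when, if_neg (by simpa [a10, a22, ← hc] using hi)]
        simp [hf, hg, hi]
    · intro m' _ hI
      simpa [h.n_eq] using hI
  rw [key, Finset.prod_mul_distrib, SpinSystem.partialWeight, prod_edgeFinset, Finset.prod_range,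
    Finset.prod_range]
  congr 1
  · refine Finset.prod_congr rfl fun w _ => ?_
    simp only [optH_eq h, hg, hτ]
  · refine Finset.prod_congr rfl fun u _ => ?_
    rw [Finset.prod_range]
    refine Finset.prod_congr rfl fun v _ => ?_
    simp only [hf, hτ, optA_eq h, h.adj, Fin.val_fin_lt]

end RealRAM

/-! ### Breadth-first computation of distances. -/

namespace RealRAM

open LoopProg Function

/-- Distances up to `T` are known: the table holds the distance plus one, or zero. -/
structure HasDistances {n q : ℕ} (S : SpinSystem (Fin n) q) (T : ℕ) (m : State) : Prop where
  iff : ∀ u v : Fin n, ∀ r ≤ T, m.nat 3 u v = r + 1 ↔ S.G.edist u v = r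
  le : ∀ u v : Fin n, m.nat 3 u v ≤ T + 1

theorem HasDistances.congr {n q : ℕ} {S : SpinSystem (Fin n) q} {T : ℕ} {m m' : State}
    (h : HasDistances S T m) (h3 : m'.nat 3 = m.nat 3) : HasDistances S T m' :=
  ⟨by rw [h3]; exact h.iff, by rw [h3]; exact h.le⟩

theorem HasDistances.lt_iff {n q : ℕ} {S : SpinSystem (Fin n) q} {T : ℕ} {m : State}
    (h : HasDistances S T m) {L : ℕ} (hL : L ≤ T) (u v : Fin n) :
    1 ≤ m.nat 3 u v ∧ m.nat 3 u v ≤ L ↔ S.G.edist u v < L := by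
  constructor
  · rintro ⟨h1, h2⟩
    rw [(h.iff u v (m.nat 3 u v - 1) (by omega)).1 (by omega)]
    exact_mod_cast (by omega : m.nat 3 u v - 1 < L)
  · intro hlt
    obtain ⟨r, hr⟩ := ENat.ne_top_iff_exists.1 (ne_top_of_lt hlt)
    rw [← hr] at hlt
    have hlt : r < L := by exact_mod_cast hlt
    have := (h.iff u v r (by omega)).2 hr.symm
    omega

/-- The recursion behind breadth-first search: the next vertex on a shortest walk has distance `r`,
and conversely such a neighbour bounds the distance by `r + 1` while smaller values are excluded. -/
theorem exists_adj_edist {V : Type*} (G : SimpleGraph V) {u v : V} {r : ℕ} :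
    G.edist u v = (r + 1 : ℕ) ↔
      (∀ j ≤ r, G.edist u v ≠ (j : ℕ)) ∧ ∃ w, G.Adj u w ∧ G.edist w v = r := by
  constructor
  · intro h
    refine ⟨fun j hj hj' => ?_, ?_⟩
    · rw [h] at hj'
      have : r + 1 = j := by exact_mod_cast hj'
      omega
    · have hne : G.edist u v ≠ ⊤ := by rw [h]; exact ENat.natCast_ne_top _
      obtain ⟨p, hp⟩ := SimpleGraph.exists_walk_of_edist_ne_top hne
      rw [h] at hp
      have hp : p.length = r + 1 := by exact_mod_cast hp
      cases p with
      | nil => simp at hp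
      | @cons _ w _ huw p =>
        rw [SimpleGraph.Walk.length_cons, Nat.add_right_cancel_iff] at hp
        refine ⟨w, huw, le_antisymm (hp ▸ SimpleGraph.edist_le p) ?_⟩
        have h3 : G.edist u v ≤ G.edist u w + G.edist w v := G.edist_triangle
        rw [h, SimpleGraph.edist_eq_one_iff_adj.2 huw, add_comm] at h3
        push_cast at h3
        exact (ENat.add_le_add_iff_left ENat.one_ne_top).1 h3
  · rintro ⟨h, w, huw, hw⟩
    have h3 : G.edist u v ≤ G.edist u w + G.edist w v := G.edist_triangle
    rw [hw, SimpleGraph.edist_eq_one_iff_adj.2 huw, add_comm] at h3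
    obtain ⟨j, hj⟩ := ENat.ne_top_iff_exists.1
      (ne_top_of_le_ne_top (by exact_mod_cast ENat.natCast_ne_top (r + 1)) h3)
    rw [← hj] at h3
    have h3 : j ≤ r + 1 := by exact_mod_cast h3
    rcases h3.lt_or_eq with hlt | rfl
    · exact absurd hj.symm (h j (by omega))
    · exact hj.symm

/-- The table is updated in place. This is safe because the pass looks for entries `T + 1`, that is
distance `T`, and writes only `T + 2`: a fresh entry is never mistaken for one of the preceding
layer, whatever the order of the loops. -/
theorem layerProg_spec {n q : ℕ} {S : SpinSystem (Fin n) q} {ε : ℝ} {m : State} {T : ℕ}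
    (h : HasInput S ε m) (hD : HasDistances S T m) (hT : m.nat 4 0 0 = T + 1) :
    HasDistances S (T + 1) (layerProg.run m) := by
  set D := m.nat 3 with hDdef
  let nb : ℕ → ℕ → ℕ → Prop := fun u v w => 1 ≤ m.nat 2 u w ∧ D w v = T + 1
  -- The soundness half of the invariant: an entry is unchanged, or it was unknown and has been
  -- filled because of a neighbour at distance `T`. Completeness is tracked separately, for the
  -- pairs already visited.
  let rel : State → Prop := fun m' => ∀ u v, m'.nat 3 u v = D u v ∨
    (D u v = 0 ∧ m'.nat 3 u v = T + 2 ∧ ∃ w < n, nb u v w)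
  have key : rel (layerProg.run m) ∧ ∀ u < n, ∀ v < n, D u v = 0 → (∃ w < n, nb u v w) →
      (layerProg.run m).nat 3 u v ≠ 0 := by
    rw [layerProg]
    refine run_loop (Q := fun s => rel s ∧ ∀ u < n, ∀ v < n, D u v = 0 → (∃ w < n, nb u v w) →
      s.nat 3 u v ≠ 0) (fun i m' => rel m' ∧ ∀ u < i, ∀ v < n, D u v = 0 →
      (∃ w < n, nb u v w) → m'.nat 3 u v ≠ 0) ?_ ?_ ?_
    · exact ⟨fun u v => Or.inl rfl, fun u hu => by omega⟩
    · intro i m' hi hA hI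
      have a0 := hA.nat 0 (by decide)
      have a2 := hA.nat 2 (by decide)
      have a4 := hA.nat 4 (by decide)
      refine run_loop (Q := fun s => rel s ∧ ∀ u < i + 1, ∀ v < n, D u v = 0 →
        (∃ w < n, nb u v w) → s.nat 3 u v ≠ 0) (fun j s => rel s ∧ (∀ u < i, ∀ v < n,
        D u v = 0 → (∃ w < n, nb u v w) → s.nat 3 u v ≠ 0) ∧ ∀ v < j, D i v = 0 →
        (∃ w < n, nb i v w) → s.nat 3 i v ≠ 0) ?_ ?_ ?_
      · exact ⟨hI.1, hI.2, fun v hv => by omega⟩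
      · intro j s hj hB hJ
        have b0 := hB.nat 0 (by decide)
        have b2 := hB.nat 2 (by decide)
        have b4 := hB.nat 4 (by decide)
        have b17 := hB.nat 17 (by decide)
        rw [State.setNat_nat_of_ne _ (by decide)] at b0 b2 b4
        rw [a0] at b0
        rw [a2] at b2
        rw [a4] at b4
        by_cases h0 : s.nat 3 i j = 0
        · rw [run_when, if_pos (by simp [b17, h0])]
          refine run_loop (Q := fun s => rel s ∧ (∀ u < i, ∀ v < n,
            D u v = 0 → (∃ w < n, nb u v w) → s.nat 3 u v ≠ 0) ∧ ∀ v < j + 1, D i v = 0 →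
            (∃ w < n, nb i v w) → s.nat 3 i v ≠ 0) (fun l s => rel s ∧ (∀ u < i, ∀ v < n,
            D u v = 0 → (∃ w < n, nb u v w) → s.nat 3 u v ≠ 0) ∧ (∀ v < j, D i v = 0 →
            (∃ w < n, nb i v w) → s.nat 3 i v ≠ 0) ∧ ((∃ w < l, nb i j w) → s.nat 3 i j ≠ 0))
            ?_ ?_ ?_
          · exact ⟨hJ.1, hJ.2.1, hJ.2.2, fun ⟨w, hw, _⟩ => by omega⟩
          · intro l t hl hC hK
            have c2 := hC.nat 2 (by decide)
            have c4 := hC.nat 4 (by decide)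
            have c17 := hC.nat 17 (by decide)
            have c18 := hC.nat 18 (by decide)
            rw [State.setNat_nat_of_ne _ (by decide)] at c2 c4 c17
            rw [b2] at c2
            rw [b4] at c4
            rw [b17] at c17
            have hln : l < n := by simpa [b0, h.n_eq] using hl
            have hread : t.nat 3 l j = T + 1 ↔ D l j = T + 1 := by
              rcases hK.1 l j with e | ⟨e1, e2, -⟩ <;> omega
            have hread2 : t.nat 3 i j ≠ T + 2 → t.nat 3 i j = D i j := fun hne =>
              (hK.1 i j).resolve_right fun h => hne h.2.1
            have hij0 : D i j = 0 := by
              rcases hJ.1 i j with e | ⟨e1, -⟩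
              · rw [← e, h0]
              · exact e1
            have htest : (run (when (.natLe (.const 1) (.read 2 (.reg 17) (.reg 19))) <|
                when (.natLe (.read 3 (.reg 19) (.reg 18)) (.reg 4)) <|
                when (.natLe (.reg 4) (.read 3 (.reg 19) (.reg 18))) <|
                .writeNat 3 (.reg 17) (.reg 18) (.add (.reg 4) (.const 1))) (t.setNat 19 0 0 l)) =
                if nb i j l then (t.setNat 19 0 0 l).setNat 3 i j (T + 2)
                else t.setNat 19 0 0 l := by
              simp only [run_when, Test.holds_natLe, NExp.eval_const, NExp.eval_read,
                NExp.eval_reg, State.setNat_nat, c17, c18, c4, c2, hT, run_writeNat,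
                NExp.eval_add, nb]
              by_cases e1 : 1 ≤ m.nat 2 i l <;> by_cases e2 : D l j = T + 1
              · simp [e1, e2, hread.2 e2]
              · have e3 : t.nat 3 l j ≠ T + 1 := fun e => e2 (hread.1 e)
                by_cases e4 : t.nat 3 l j ≤ T + 1
                · have : ¬ T + 1 ≤ t.nat 3 l j := by omega
                  simp [e2, this]
                · simp [e2, e4]
              · simp [e1]
              · simp [e1]
            rw [htest]
            have hmono : ∀ u v, t.nat 3 u v ≠ 0 →
                ((t.setNat 19 0 0 l).setNat 3 i j (T + 2)).nat 3 u v ≠ 0 := by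
              intro u v huv
              simp only [State.setNat_nat]
              split_ifs <;> simp_all
            by_cases hnb : nb i j l
            · rw [if_pos hnb]
              refine ⟨fun u v => ?_, fun u hu v hv e1 e2 => hmono _ _ (hK.2.1 u hu v hv e1 e2),
                fun v hv e1 e2 => hmono _ _ (hK.2.2.1 v hv e1 e2), fun _ => by simp⟩
              by_cases huv : u = i ∧ v = j
              · obtain ⟨rfl, rfl⟩ := huv
                exact Or.inr ⟨hij0, by simp, l, hln, hnb⟩
              · simpa [huv] using hK.1 u v
            · rw [if_neg hnb]
              refine ⟨hK.1, hK.2.1, hK.2.2.1, ?_⟩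
              rintro ⟨w, hw, hw'⟩
              rcases Nat.lt_succ_iff_lt_or_eq.1 hw with hlt | rfl
              · exact hK.2.2.2 ⟨w, hlt, hw'⟩
              · exact absurd hw' hnb
          · intro t _ hK
            refine ⟨hK.1, hK.2.1, fun v hv e1 e2 => ?_⟩
            rcases Nat.lt_succ_iff_lt_or_eq.1 hv with hlt | rfl
            · exact hK.2.2.1 v hlt e1 e2
            · refine hK.2.2.2 ?_
              simpa [b0, h.n_eq] using e2
        · rw [run_when, if_neg (by simp [b17, h0])]
          refine ⟨hJ.1, hJ.2.1, fun v hv e1 e2 => ?_⟩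
          rcases Nat.lt_succ_iff_lt_or_eq.1 hv with hlt | rfl
          · exact hJ.2.2 v hlt e1 e2
          · exact h0
      · intro s _ hJ
        refine ⟨hJ.1, fun u hu v hv => ?_⟩
        rcases Nat.lt_succ_iff_lt_or_eq.1 hu with hlt | rfl
        · exact hJ.2.1 u hlt v hv
        · exact hJ.2.2 v (by simpa [a0, h.n_eq] using hv)
    · intro m' _ hI
      refine ⟨hI.1, fun u hu => hI.2 u ?_⟩
      rwa [h.n_eq]
  have hle : ∀ u v : Fin n, D u v ≤ T + 1 := hD.le
  have hiff : ∀ u v : Fin n, ∀ r ≤ T, D u v = r + 1 ↔ S.G.edist u v = r := hD.iff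
  obtain ⟨hrel, hdone⟩ := key
  have hnb : ∀ u v : Fin n, (∃ w < n, nb u v w) ↔ ∃ w, S.G.Adj u w ∧ S.G.edist w v = T := by
    intro u v
    constructor
    · rintro ⟨w, hw, h1, h2⟩
      exact ⟨⟨w, hw⟩, (h.adj u ⟨w, hw⟩).1 h1, (hiff ⟨w, hw⟩ v T le_rfl).1 h2⟩
    · rintro ⟨w, h1, h2⟩
      exact ⟨w, w.2, (h.adj u w).2 h1, (hiff w v T le_rfl).2 h2⟩
  have hzero : ∀ u v : Fin n, D u v = 0 ↔ ∀ j ≤ T, S.G.edist u v ≠ j := by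
    intro u v
    constructor
    · intro h0 j hj e
      have := (hiff u v j hj).2 e
      omega
    · intro hj
      by_contra hne
      have := hle u v
      exact hj (D u v - 1) (by omega) ((hiff u v (D u v - 1) (by omega)).1 (by omega))
  refine ⟨fun u v r hr => ?_, fun u v => ?_⟩
  · rcases Nat.le_or_eq_of_le_succ hr with hr | rfl
    · rw [← hiff u v r hr]
      rcases hrel u v with e | ⟨e1, e2, -⟩
      · rw [e]
      · omega
    · have := hle u v
      rw [exists_adj_edist, ← hzero, ← hnb]
      constructor
      · intro e
        rcases hrel u v with e' | ⟨e1, -, e2⟩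
        · omega
        · exact ⟨e1, e2⟩
      · rintro ⟨e1, e2⟩
        have := hdone u u.2 v v.2 e1 e2
        rcases hrel u v with e' | ⟨-, e2, -⟩
        · omega
        · omega
  · have := hle u v
    rcases hrel u v with e | ⟨-, e, -⟩ <;> omega

theorem initProg_spec {n q : ℕ} (S : SpinSystem (Fin n) q) {ε : ℝ} :
    HasDistances S 0 (initProg.run (S.input ε)) := by
  have key : ∀ u < n, ∀ v < n, (initProg.run (S.input ε)).nat 3 u v = if u = v then 1 else 0 := by
    rw [initProg]
    refine run_loop (Q := fun s => ∀ u < n, ∀ v < n, s.nat 3 u v = if u = v then 1 else 0)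
      (fun i s => ∀ u v, s.nat 3 u v = if u = v ∧ u < i then 1 else 0) ?_ ?_ ?_
    · simp [SpinSystem.input]
    · intro i s _ _ hI u v
      simp only [run_writeNat, State.setNat_nat, NExp.eval_reg, NExp.eval_const, hI]
      by_cases e : u = i <;> by_cases e' : v = i <;> by_cases e2 : u = v <;>
        simp_all <;> split_ifs <;> omega
    · intro s _ hI u hu v hv
      have : (S.input ε).nat 0 0 0 = n := by simp [SpinSystem.input]
      simp [hI, this, hu]
  refine ⟨fun u v r hr => ?_, fun u v => ?_⟩
  · obtain rfl : r = 0 := by omega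
    rw [key u u.2 v v.2, Nat.cast_zero, SimpleGraph.edist_eq_zero_iff]
    simp [Fin.ext_iff]
  · rw [key u u.2 v v.2]
    split_ifs <;> omega

end RealRAM

/-! ### Nodes of the recursion tree and their expansion. -/

namespace RealRAM

open LoopProg Function

/-- A node of the recursion tree. Level `0` stands for the brute-force enumeration of a ball, level
`1` for the trivial lower bound. -/
structure Node (n q : ℕ) where
  level : ℕ
  vertex : Fin n
  config : Fin n → Option (Fin q)

variable {n q : ℕ}

/-- The memory stores the node `x` under the number `id`. -/
structure Stores (m : State) (id : ℕ) (x : Node n q) : Prop where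
  level : m.nat 11 id 0 = x.level
  vertex : m.nat 12 id 0 = x.vertex
  config : ∀ w : Fin n, m.nat 10 id w = code (x.config w)

theorem Stores.congr {m m' : State} {id : ℕ} {x : Node n q} (h : Stores m id x)
    (h10 : ∀ w, m'.nat 10 id w = m.nat 10 id w) (h11 : m'.nat 11 id 0 = m.nat 11 id 0)
    (h12 : m'.nat 12 id 0 = m.nat 12 id 0) : Stores m' id x :=
  ⟨by rw [h11, h.level], by rw [h12, h.vertex], fun w => by rw [h10, h.config]⟩

/-- The children of a node: one for every spin, and an extra one. The number is the kind of
branching, with `0` for leaves. -/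
inductive Branching (S : SpinSystem (Fin n) q) (L : ℕ) :
    Node n q → ℕ → (Fin q → Node n q) → Node n q → Prop
  | trivial {v τ c e} : Branching S L ⟨1, v, τ⟩ 0 c e
  | leaf {v τ c e} : (∀ u, S.G.edist u v < L → τ u ≠ none) → Branching S L ⟨0, v, τ⟩ 0 c e
  | ball {u v τ} : τ u = none → S.G.edist u v < L →
      Branching S L ⟨0, v, τ⟩ 1 (fun a => ⟨0, v, update τ u (some a)⟩) ⟨1, u, τ⟩
  | sphere {k u v τ} : 2 ≤ k → τ u = none → S.G.edist u v = L →
      Branching S L ⟨k, v, τ⟩ 1 (fun a => ⟨k, v, update τ u (some a)⟩) ⟨k - 1, u, τ⟩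
  | center {k v τ} : 2 ≤ k → (∀ u, S.G.edist u v = L → τ u ≠ none) →
      Branching S L ⟨k, v, τ⟩ 2 (fun a => ⟨0, v, update τ v (some a)⟩) ⟨1, v, τ⟩

/-- Register 6 holds `L - 1` and the table holds distances plus one. So the range from 1 to `L`
describes the open ball, searched at level 0, and the single value `L + 1` the sphere. The result
`n`, which is no vertex, signals that the search failed. -/
theorem pickProg_spec {m : State} (lo hi : ℕ)
    (hlo : lo = if m.nat 11 (m.nat 16 0 0) 0 = 0 then 1 else m.nat 6 0 0 + 2)
    (hhi : hi = if m.nat 11 (m.nat 16 0 0) 0 = 0 then m.nat 6 0 0 + 1 else m.nat 6 0 0 + 2) :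
    let c := m.nat 16 0 0
    let P : ℕ → Prop := fun w => m.nat 10 c w = 0 ∧ lo ≤ m.nat 3 w (m.nat 12 c 0) ∧
      m.nat 3 w (m.nat 12 c 0) ≤ hi
    ((pickProg.run m).nat 26 0 0 = m.nat 0 0 0 ∧ ∀ w < m.nat 0 0 0, ¬ P w) ∨
      ((pickProg.run m).nat 26 0 0 < m.nat 0 0 0 ∧ P ((pickProg.run m).nat 26 0 0)) := by
  intro c P
  let m₁ := (((m.setNat 24 0 0 lo).setNat 25 0 0 hi).setNat 26 0 0 (m.nat 0 0 0))
  have e : pickProg.run m = (LoopProg.loop 17 0 <|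
    .when (.natLe (spinAt 16 17) (.const 0)) <|
    .when (.natLe (.reg 24) (.read 3 (.reg 17) (.read 12 (.reg 16) (.const 0)))) <|
    .when (.natLe (.read 3 (.reg 17) (.read 12 (.reg 16) (.const 0))) (.reg 25)) <|
    .set 26 (.reg 17)).run m₁ := by
    rw [pickProg, run_seq, run_seq]
    congr 1
    by_cases h0 : m.nat 11 (m.nat 16 0 0) 0 = 0
    · rw [if_pos h0] at hlo hhi
      simp [h0, m₁, hlo, hhi]
    · rw [if_neg h0] at hlo hhi
      simp [h0, m₁, hlo, hhi]
  rw [e]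
  refine run_loop (Q := fun s => (s.nat 26 0 0 = m.nat 0 0 0 ∧ ∀ w < m.nat 0 0 0, ¬ P w) ∨
      (s.nat 26 0 0 < m.nat 0 0 0 ∧ P (s.nat 26 0 0)))
    (fun i s => (s.nat 26 0 0 = m.nat 0 0 0 ∧ ∀ w < i, ¬ P w) ∨
      (s.nat 26 0 0 < m.nat 0 0 0 ∧ P (s.nat 26 0 0))) ?_ ?_ ?_
  · exact Or.inl ⟨by simp [m₁], fun w hw => by omega⟩
  · intro i s hi' hA hI
    have a3 := hA.nat 3 (by decide)
    have a10 := hA.nat 10 (by decide)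
    have a12 := hA.nat 12 (by decide)
    have a16 := hA.nat 16 (by decide)
    have a24 := hA.nat 24 (by decide)
    have a25 := hA.nat 25 (by decide)
    have e3 : s.nat 3 = m.nat 3 := by rw [a3]; rfl
    have e10 : s.nat 10 = m.nat 10 := by rw [a10]; rfl
    have e12 : s.nat 12 = m.nat 12 := by rw [a12]; rfl
    have e16 : s.nat 16 0 0 = c := by rw [a16]; rfl
    have e24 : s.nat 24 0 0 = lo := by rw [a24]; rfl
    have e25 : s.nat 25 0 0 = hi := by rw [a25]; rfl
    have hin : i < m.nat 0 0 0 := hi'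
    have hrun : (run (.when (.natLe (spinAt 16 17) (.const 0)) <|
        .when (.natLe (.reg 24) (.read 3 (.reg 17) (.read 12 (.reg 16) (.const 0)))) <|
        .when (.natLe (.read 3 (.reg 17) (.read 12 (.reg 16) (.const 0))) (.reg 25)) <|
        .set 26 (.reg 17)) (s.setNat 17 0 0 i)) =
        if P i then (s.setNat 17 0 0 i).setNat 26 0 0 i else s.setNat 17 0 0 i := by
      by_cases h1 : m.nat 10 c i = 0 <;> by_cases h2 : lo ≤ m.nat 3 i (m.nat 12 c 0) <;>
        by_cases h3 : m.nat 3 i (m.nat 12 c 0) ≤ hi <;>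
        simp [P, e3, e10, e12, e16, e24, e25, h1, h2, h3]
    rw [hrun]
    by_cases hP : P i
    · rw [if_pos hP]
      right
      exact ⟨hin, hP⟩
    · rw [if_neg hP]
      rcases hI with ⟨hI1, hI2⟩ | hI
      · refine Or.inl ⟨hI1, fun w hw => ?_⟩
        rcases Nat.lt_succ_iff_lt_or_eq.1 hw with hlt | rfl
        · exact hI2 w hlt
        · exact hP
      · exact Or.inr hI
  · intro s _ hI
    exact hI

/-- The branching chosen by the program is always a legitimate one. For kind 0 the children are
irrelevant, and arbitrary nodes are supplied for them. -/
theorem pickKind_spec {S : SpinSystem (Fin n) q} {ε : ℝ} {m : State} {T : ℕ} {x : Node n q}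
    (h : HasInput S ε m) (hD : HasDistances S T m) (hL : m.nat 6 0 0 + 1 ≤ T)
    (hx : Stores m (m.nat 16 0 0) x) :
    let m' := kindProg.run (pickProg.run m)
    ∃ j c e, Branching S (m.nat 6 0 0 + 1) x j c e ∧ m'.nat 14 (m.nat 16 0 0) 0 = j ∧
      (∀ id, id ≠ m.nat 16 0 0 → m'.nat 14 id 0 = m.nat 14 id 0) ∧
      (1 ≤ j → ∃ u : Fin n, m'.nat 26 0 0 = u ∧
        (∀ a, c a = ⟨m'.nat 29 0 0, x.vertex, update x.config u (some a)⟩) ∧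
        e = ⟨m'.nat 31 0 0, u, x.config⟩) := by
  intro m'
  have hpick := pickProg_spec (m := m) _ _ rfl rfl
  simp only [h.n_eq, hx.vertex, hx.level] at hpick
  have hA := agree_run pickProg m
  have p0 := hA.nat 0 (by decide)
  have p11 := hA.nat 11 (by decide)
  have p12 := hA.nat 12 (by decide)
  have p14 := hA.nat 14 (by decide)
  have p16 := hA.nat 16 (by decide)
  have hm' : m' = kindProg.run (pickProg.run m) := rfl
  clear_value m'
  set m₁ := pickProg.run m with hm₁
  obtain ⟨k, v, τ⟩ := x
  obtain ⟨hk, hv, hτ⟩ := hx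
  simp only at hk hv hτ hpick ⊢
  have e11 : m₁.nat 11 (m.nat 16 0 0) 0 = k := by rw [p11, hk]
  have e12 : m₁.nat 12 (m.nat 16 0 0) 0 = v := by rw [p12, hv]
  have e0 : m₁.nat 0 0 0 = n := by rw [p0, h.n_eq]
  have e16 : m₁.nat 16 0 0 = m.nat 16 0 0 := by rw [p16]
  have frame : ∀ id, id ≠ m.nat 16 0 0 → m'.nat 14 id 0 = m.nat 14 id 0 := by
    intro id hid
    rw [← p14]
    simp only [hm', kindProg, run_seq, run_ite, run_when]
    split_ifs <;> simp [e16, hid]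
  have hcfg : ∀ w : Fin n, m.nat 10 (m.nat 16 0 0) w = 0 ↔ τ w = none := fun w => by
    rw [hτ, code_eq_zero]
  by_cases h0 : k = 0
  · subst h0
    simp only [if_true] at hpick
    rcases hpick with ⟨hp1, hp2⟩ | ⟨hp1, hp2, hp3⟩
    · refine ⟨0, fun _ => ⟨0, v, τ⟩, ⟨0, v, τ⟩, .leaf fun u hu hu' => ?_, ?_, frame,
        fun h => by omega⟩
      · have := (hD.lt_iff hL u v).2 hu
        exact hp2 u u.2 ⟨(hcfg u).2 hu', this⟩
      · simp [hm', kindProg, e11, e16, e0, hp1]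
    · have hu := (hcfg ⟨_, hp1⟩).1 hp2
      have hd := (hD.lt_iff hL ⟨_, hp1⟩ v).1 hp3
      have hnot : ¬ n ≤ m₁.nat 26 0 0 := by omega
      refine ⟨1, _, _, .ball hu hd, ?_, frame, fun _ => ⟨⟨_, hp1⟩, ?_, fun a => ?_, ?_⟩⟩
      · simp [hm', kindProg, e11, e16, e0, hnot]
      · simp [hm', kindProg, e11, e16, e0, hnot]
      · simp [hm', kindProg, e11, e16, e0, hnot]
      · simp [hm', kindProg, e11, e16, e0, hnot]
  · by_cases h1 : k = 1
    · subst h1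
      refine ⟨0, fun _ => ⟨0, v, τ⟩, ⟨0, v, τ⟩, .trivial, ?_, frame, fun h => by omega⟩
      simp [hm', kindProg, e11, e16]
    · have hk2 : 2 ≤ k := by omega
      have hk1 : ¬ k ≤ 1 := by omega
      simp only [if_neg h0] at hpick
      have hsph : ∀ u : Fin n, (m.nat 6 0 0 + 2 ≤ m.nat 3 u v ∧ m.nat 3 u v ≤ m.nat 6 0 0 + 2) ↔
          S.G.edist u v = (m.nat 6 0 0 + 1 : ℕ) := fun u => by
        rw [← hD.iff u v _ hL]; omega
      rcases hpick with ⟨hp1, hp2⟩ | ⟨hp1, hp2, hp3⟩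
      · refine ⟨2, _, _, .center hk2 fun u hu hu' => ?_, ?_, frame,
          fun _ => ⟨v, ?_, fun a => ?_, ?_⟩⟩
        · exact hp2 u u.2 ⟨(hcfg u).2 hu', (hsph u).2 hu⟩
        · simp [hm', kindProg, e11, e16, e0, hp1, hk1]
        · simp [hm', kindProg, e11, e16, e0, hp1, hk1, e12]
        · simp [hm', kindProg, e11, e16, e0, hp1, hk1]
        · simp [hm', kindProg, e11, e16, e0, hp1, hk1]
      · have hu := (hcfg ⟨_, hp1⟩).1 hp2
        have hd := (hsph ⟨_, hp1⟩).1 hp3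
        have hnot : ¬ n ≤ m₁.nat 26 0 0 := by omega
        refine ⟨1, _, _, .sphere hk2 hu hd, ?_, frame, fun _ => ⟨⟨_, hp1⟩, ?_, fun a => ?_, ?_⟩⟩
        · simp [hm', kindProg, e11, e16, e0, hnot, hk1]
        · simp [hm', kindProg, e11, e16, e0, hnot, hk1]
        · simp [hm', kindProg, e11, e16, e0, hnot, hk1]
        · simp [hm', kindProg, e11, e16, e0, hnot, hk1]

theorem copyProg_spec {m : State} (hne : m.nat 22 0 0 ≠ m.nat 16 0 0) (id w : ℕ) :
    (copyProg.run m).nat 10 id w = if id = m.nat 22 0 0 ∧ w < m.nat 0 0 0 then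
      m.nat 10 (m.nat 16 0 0) w else m.nat 10 id w := by
  revert id w
  rw [copyProg]
  refine run_loop (Q := fun s => ∀ id w, s.nat 10 id w = if id = m.nat 22 0 0 ∧ w < m.nat 0 0 0
      then m.nat 10 (m.nat 16 0 0) w else m.nat 10 id w) (fun i s => ∀ id w, s.nat 10 id w =
      if id = m.nat 22 0 0 ∧ w < i then m.nat 10 (m.nat 16 0 0) w else m.nat 10 id w) ?_ ?_ ?_
  · simp
  · intro i s _ hA hI id w
    have a16 := hA.nat 16 (by decide)
    have a22 := hA.nat 22 (by decide)
    simp only [run_writeNat, NExp.eval_reg, eval_spinAt, State.setNat_nat]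
    simp only [Nat.reduceEqDiff, false_and, if_false, true_and, a16, a22, hI, hne.symm, and_self,
      if_true]
    by_cases e : id = m.nat 22 0 0
    · subst e
      by_cases e1 : w = i
      · subst e1; simp
      · have : w < i + 1 ↔ w < i := by omega
        simp [e1, this]
    · simp [e]
  · intro s _ hI
    exact hI

/-- The children occupy `q + 1` consecutive fresh numbers, the extra child last. Since the fresh
block starts at the node counter, earlier nodes stay intact and every child has a larger number than
its parent. -/
theorem childrenProg_spec {S : SpinSystem (Fin n) q} {ε : ℝ} {m : State} {x : Node n q}
    (h : HasInput S ε m) (hx : Stores m (m.nat 16 0 0) x) (hc : m.nat 16 0 0 < m.nat 15 0 0)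
    (u : Fin n) (hu : 1 ≤ m.nat 14 (m.nat 16 0 0) 0 → m.nat 26 0 0 = u) :
    let m' := childrenProg.run m
    (∀ id, m'.nat 13 id 0 = if id = m.nat 16 0 0 then m.nat 15 0 0 else m.nat 13 id 0) ∧
    (∀ id < m.nat 15 0 0, (∀ w, m'.nat 10 id w = m.nat 10 id w) ∧
      m'.nat 11 id 0 = m.nat 11 id 0 ∧ m'.nat 12 id 0 = m.nat 12 id 0) ∧
    (m.nat 14 (m.nat 16 0 0) 0 = 0 → m'.nat 15 0 0 = m.nat 15 0 0) ∧
    (1 ≤ m.nat 14 (m.nat 16 0 0) 0 → m'.nat 15 0 0 = m.nat 15 0 0 + (q + 1) ∧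
      (∀ a : Fin q, Stores m' (m.nat 15 0 0 + a)
        ⟨m.nat 29 0 0, x.vertex, update x.config u (some a)⟩) ∧
      Stores m' (m.nat 15 0 0 + q) ⟨m.nat 31 0 0, u, x.config⟩) := by
  intro m'
  by_cases h0 : 1 ≤ m.nat 14 (m.nat 16 0 0) 0
  swap
  · have e : m' = m.setNat 13 (m.nat 16 0 0) 0 (m.nat 15 0 0) := by
      simp [m', childrenProg, h0]
    refine ⟨fun id => by simp [e], fun id _ => by simp [e], fun _ => by simp [e],
      fun h => absurd h h0⟩
  set m₁ := m.setNat 13 (m.nat 16 0 0) 0 (m.nat 15 0 0) with hm₁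
  set p : LoopProg := .loop 19 1 <|
      .seq (.set 22 (.add (.reg 15) (.reg 19))) <|
      .seq copyProg <|
      .seq (.writeNat 10 (.reg 22) (.reg 26) (.add (.reg 19) (.const 1))) <|
      .seq (.writeNat 11 (.reg 22) (.const 0) (.reg 29)) <|
      .writeNat 12 (.reg 22) (.const 0) (.read 12 (.reg 16) (.const 0)) with hp
  let I : ℕ → State → Prop := fun i s =>
    (∀ id < m.nat 15 0 0, (∀ w, s.nat 10 id w = m.nat 10 id w) ∧
      s.nat 11 id 0 = m.nat 11 id 0 ∧ s.nat 12 id 0 = m.nat 12 id 0) ∧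
    ∀ a : Fin q, (a : ℕ) < i → Stores s (m.nat 15 0 0 + a)
        ⟨m.nat 29 0 0, x.vertex, update x.config u (some a)⟩
  have hI : I q (p.run m₁) := by
    rw [hp]
    refine run_loop (Q := I q) I ?_ ?_ ?_
    · exact ⟨fun id _ => by simp [m₁], fun a ha => by omega⟩
    · intro i s hi hA hI
      have e0 : s.nat 0 0 0 = n := by rw [hA.nat 0 (by decide), ← h.n_eq]; rfl
      have e15 : s.nat 15 0 0 = m.nat 15 0 0 := by rw [hA.nat 15 (by decide)]; rfl
      have e16 : s.nat 16 0 0 = m.nat 16 0 0 := by rw [hA.nat 16 (by decide)]; rfl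
      have e26 : s.nat 26 0 0 = u := by rw [hA.nat 26 (by decide), ← hu h0]; rfl
      have e29 : s.nat 29 0 0 = m.nat 29 0 0 := by rw [hA.nat 29 (by decide)]; rfl
      set s₁ := (s.setNat 19 0 0 i).setNat 22 0 0 (m.nat 15 0 0 + i) with hs₁
      have hcopy := copyProg_spec (m := s₁) (by simp [s₁, e16]; omega)
      have hB := agree_run copyProg s₁
      have b11 : (copyProg.run s₁).nat 11 = s.nat 11 := by rw [hB.nat 11 (by decide)]; rfl
      have b12 : (copyProg.run s₁).nat 12 = s.nat 12 := by rw [hB.nat 12 (by decide)]; rfl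
      have b16 : (copyProg.run s₁).nat 16 = s.nat 16 := by rw [hB.nat 16 (by decide)]; rfl
      have b19 : (copyProg.run s₁).nat 19 0 0 = i := by rw [hB.nat 19 (by decide)]; simp [s₁]
      have b22 : (copyProg.run s₁).nat 22 0 0 = m.nat 15 0 0 + i := by
        rw [hB.nat 22 (by decide)]; simp [s₁]
      have b26 : (copyProg.run s₁).nat 26 0 0 = u := by
        rw [hB.nat 26 (by decide), ← e26]; simp [s₁]
      have b29 : (copyProg.run s₁).nat 29 0 0 = m.nat 29 0 0 := by
        rw [hB.nat 29 (by decide), ← e29]; simp [s₁]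
      have b10 : ∀ id w, (copyProg.run s₁).nat 10 id w = if id = m.nat 15 0 0 + i ∧ w < n then
          m.nat 10 (m.nat 16 0 0) w else s.nat 10 id w := by
        intro id w
        rw [hcopy, ← (hI.1 _ hc).1 w]
        simp [s₁, e0, e16]
      simp only [run_seq, run_set, NExp.eval_add, NExp.eval_reg]
      have hrun : (s.setNat 19 0 0 i).setNat 22 0 0
          ((s.setNat 19 0 0 i).nat 15 0 0 + (s.setNat 19 0 0 i).nat 19 0 0) = s₁ := by
        simp [s₁, e15]
      rw [hrun]
      refine ⟨fun id hid => ?_, fun a ha => ?_⟩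
      · have hne : id ≠ m.nat 15 0 0 + i := by omega
        simpa [b22, hne, b10, b11, b12] using hI.1 id hid
      · by_cases hai : (a : ℕ) = i
        · refine ⟨?_, ?_, fun w => ?_⟩
          · simp [b22, b29, hai]
          · have := (hI.1 _ hc).2.2
            rw [hx.vertex] at this
            simp [b22, b12, b16, e16, this, hai]
          · by_cases hw : w = u
            · subst hw
              simp [b22, b26, b19, hai]
            · have hw' : (w : ℕ) ≠ u := fun e => hw (Fin.ext e)
              simp [b22, b26, b10, hai, hw, hw', hx.config]
        · have hne : m.nat 15 0 0 + (a : ℕ) ≠ m.nat 15 0 0 + i := by omega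
          refine (hI.2 a (by omega)).congr (fun w => ?_) ?_ ?_
          · simp [b22, b10, hai]
          · simp [b22, b11, hai]
          · simp [b22, b12, hai]
    · intro s _ hI
      have : m₁.nat 1 0 0 = q := by rw [← h.q_eq]; rfl
      rw [this] at hI
      exact ⟨hI.1, fun a ha => (hI.2 a ha).congr (fun _ => rfl) rfl rfl⟩
  have hA := agree_run p m₁
  set s := p.run m₁ with hs
  have e0 : s.nat 0 0 0 = n := by rw [hA.nat 0 (by decide), ← h.n_eq]; rfl
  have e1 : s.nat 1 0 0 = q := by rw [hA.nat 1 (by decide), ← h.q_eq]; rfl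
  have e13 : s.nat 13 = m₁.nat 13 := hA.nat 13 (by decide)
  have e15 : s.nat 15 0 0 = m.nat 15 0 0 := by rw [hA.nat 15 (by decide)]; rfl
  have e16 : s.nat 16 0 0 = m.nat 16 0 0 := by rw [hA.nat 16 (by decide)]; rfl
  have e26 : s.nat 26 0 0 = u := by rw [hA.nat 26 (by decide), ← hu h0]; rfl
  have e31 : s.nat 31 0 0 = m.nat 31 0 0 := by rw [hA.nat 31 (by decide)]; rfl
  set s₁ := s.setNat 22 0 0 (m.nat 15 0 0 + q) with hs₁
  have hcopy := copyProg_spec (m := s₁) (by simp [s₁, e16]; omega)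
  have hB := agree_run copyProg s₁
  have b1 : (copyProg.run s₁).nat 1 0 0 = q := by rw [hB.nat 1 (by decide), ← e1]; simp [s₁]
  have b11 : (copyProg.run s₁).nat 11 = s.nat 11 := by rw [hB.nat 11 (by decide)]; rfl
  have b12 : (copyProg.run s₁).nat 12 = s.nat 12 := by rw [hB.nat 12 (by decide)]; rfl
  have b13 : (copyProg.run s₁).nat 13 = s.nat 13 := by rw [hB.nat 13 (by decide)]; rfl
  have b15 : (copyProg.run s₁).nat 15 0 0 = m.nat 15 0 0 := by
    rw [hB.nat 15 (by decide), ← e15]; rfl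
  have b22 : (copyProg.run s₁).nat 22 0 0 = m.nat 15 0 0 + q := by
    rw [hB.nat 22 (by decide)]; simp [s₁]
  have b26 : (copyProg.run s₁).nat 26 0 0 = u := by
    rw [hB.nat 26 (by decide), ← e26]; simp [s₁]
  have b31 : (copyProg.run s₁).nat 31 0 0 = m.nat 31 0 0 := by
    rw [hB.nat 31 (by decide), ← e31]; simp [s₁]
  have b10 : ∀ id w, (copyProg.run s₁).nat 10 id w = if id = m.nat 15 0 0 + q ∧ w < n then
      m.nat 10 (m.nat 16 0 0) w else s.nat 10 id w := by
    intro id w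
    rw [hcopy, ← (hI.1 _ hc).1 w]
    simp [s₁, e0, e16]
  have hrun : m' = ((((copyProg.run s₁).setNat 11 (m.nat 15 0 0 + q) 0 (m.nat 31 0 0)).setNat 12
      (m.nat 15 0 0 + q) 0 u).setNat 15 0 0 (m.nat 15 0 0 + (q + 1))) := by
    simp only [m', childrenProg, run_seq, run_when]
    rw [if_pos (by simpa using h0)]
    simp only [run_writeNat, run_set, NExp.eval_reg, NExp.eval_const]
    rw [← hm₁, ← hp, ← hs]
    simp [e15, e1, ← hs₁, b22, b31, b26, b15, b1]
  refine ⟨fun id => ?_, fun id hid => ?_, fun h => by omega, fun _ => ⟨?_, fun a => ?_, ?_⟩⟩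
  · simp [hrun, b13, e13, m₁]
  · have hne : id ≠ m.nat 15 0 0 + q := by omega
    simpa [hrun, hne, b10, b11, b12] using hI.1 id hid
  · simp [hrun]
  · have hne : (a : ℕ) ≠ q := a.2.ne
    refine (hI.2 a a.2).congr (fun w => ?_) ?_ ?_
    · simp [hrun, hne, b10]
    · simp [hrun, hne, b11]
    · simp [hrun, hne, b12]
  · refine ⟨?_, ?_, fun w => ?_⟩
    · simp [hrun]
    · simp [hrun]
    · simp [hrun, b10, hx.config]

end RealRAM

namespace RealRAM

open LoopProg Function SpinSystem

variable {n q : ℕ}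

/-! ### The size of the recursion tree -/

/-- A bound for the size of the tree below a node, when spheres of radius `L` have at most `s`
vertices and open balls at most `b`. -/
noncomputable def Node.size (S : SpinSystem (Fin n) q) (L s b : ℕ) (x : Node n q) : ℕ :=
  if x.level = 0 then (q + 2) ^ {w | S.G.edist w x.vertex < L ∧ x.config w = none}.ncard
  else if x.level = 1 then 1
  else (q + 2) ^ (b + 1 + s * (x.level - 1) + S.unassignedSphere L x.vertex x.config)

theorem Node.one_le_size (S : SpinSystem (Fin n) q) (L s b : ℕ) (x : Node n q) :
    1 ≤ x.size S L s b := by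
  unfold Node.size
  split_ifs
  exacts [Nat.one_le_pow _ _ (by omega), le_rfl, Nat.one_le_pow _ _ (by omega)]

theorem ncard_update_none {P : Fin n → Prop} {τ : Fin n → Option (Fin q)} {u : Fin n}
    (hP : P u) (hu : τ u = none) (a : Fin q) :
    {w | P w ∧ τ w = none}.ncard = {w | P w ∧ update τ u (some a) w = none}.ncard + 1 := by
  have : {w | P w ∧ update τ u (some a) w = none} = {w | P w ∧ τ w = none} \ {u} := by
    ext x
    by_cases hx : x = u
    · subst hx; simp
    · simp [hx]
  rw [this, Set.ncard_sdiff_singleton_add_one (s := {w | P w ∧ τ w = none}) ⟨hP, hu⟩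
    (Set.toFinite _)]

/-- The size is a potential: each of the `q + 1` children has an exponent smaller by at least one,
and $1+(q+1)Y\le(q+2)Y$ for $Y\ge1$. This explains the base `q + 2`, the summand 1 being the node
itself. -/
theorem Branching.size_le {S : SpinSystem (Fin n) q} {L s b : ℕ} {x : Node n q} {j : ℕ}
    {c : Fin q → Node n q} {e : Node n q} (h : Branching S L x j c e) (hj : 1 ≤ j)
    (hs : ∀ v, {u | S.G.edist u v = L}.ncard ≤ s) (hb : ∀ v, {u | S.G.edist u v < L}.ncard ≤ b) :
    1 + (∑ a, (c a).size S L s b + e.size S L s b) ≤ x.size S L s b := by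
  have key : ∀ Y X : ℕ, 1 ≤ Y → (∀ a, (c a).size S L s b ≤ Y) → e.size S L s b ≤ Y →
      (q + 2) * Y ≤ X → 1 + (∑ a, (c a).size S L s b + e.size S L s b) ≤ X := by
    intro Y X hY hc he hX
    have : ∑ a, (c a).size S L s b ≤ ∑ _a : Fin q, Y := Finset.sum_le_sum fun a _ => hc a
    rw [Finset.sum_const, Finset.card_univ, Fintype.card_fin, smul_eq_mul] at this
    nlinarith
  cases h with
  | trivial => omega
  | leaf => omega
  | @ball u v τ hu huv =>
    refine key ((q + 2) ^ ({w | S.G.edist w v < L ∧ τ w = none}.ncard - 1)) _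
      (Nat.one_le_pow _ _ (by omega)) (fun a => ?_) ?_ ?_
    · rw [ncard_update_none (P := fun w => S.G.edist w v < L) huv hu a]
      simp [Node.size]
    · simpa [Node.size] using Nat.one_le_pow _ _ (by omega)
    · have : 0 < {w | S.G.edist w v < L ∧ τ w = none}.ncard :=
        (Set.ncard_pos (Set.toFinite _)).2 ⟨u, huv, hu⟩
      rw [Node.size, if_pos rfl, ← pow_succ', Nat.sub_add_cancel this]
  | @sphere k u v τ hk hu huv =>
    have hpos : 0 < S.unassignedSphere L v τ := (Set.ncard_pos (Set.toFinite _)).2 ⟨u, huv, hu⟩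
    have h0 : k ≠ 0 := by omega
    have h1 : k ≠ 1 := by omega
    refine key ((q + 2) ^ (b + 1 + s * (k - 1) + (S.unassignedSphere L v τ - 1))) _
      (Nat.one_le_pow _ _ (by omega)) (fun a => ?_) ?_ ?_
    · have : S.unassignedSphere L v τ = _ :=
        ncard_update_none (P := fun w => S.G.edist w v = L) huv hu a
      rw [this]
      simp [Node.size, h0, h1, unassignedSphere]
    · have h0' : k - 1 ≠ 0 := by omega
      by_cases h1' : k - 1 = 1
      · simpa [Node.size, h1'] using Nat.one_le_pow _ _ (by omega)
      · rw [Node.size, if_neg h0', if_neg h1']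
        refine Nat.pow_le_pow_right (by omega) ?_
        -- The extra child starts with a new sphere of up to `s` unassigned vertices, but its level
        -- is smaller by one, which frees exactly `s` in the exponent.
        have h2 : S.unassignedSphere L u τ ≤ s :=
          (Set.ncard_le_ncard (fun x (hx : _ ∧ _) => hx.1) (Set.toFinite _)).trans (hs u)
        have h3 : s * (k - 1) = s * (k - 1 - 1) + s := by
          rw [← Nat.mul_succ]; congr 1; omega
        simp only
        omega
    · rw [Node.size, if_neg h0, if_neg h1, ← pow_succ']
      refine Nat.pow_le_pow_right (by omega) ?_
      simp only
      omega
  | @center k v τ hk _ =>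
    have h0 : k ≠ 0 := by omega
    have h1 : k ≠ 1 := by omega
    refine key ((q + 2) ^ b) _ (Nat.one_le_pow _ _ (by omega)) (fun a => ?_) ?_ ?_
    · rw [Node.size, if_pos rfl]
      refine Nat.pow_le_pow_right (by omega) ?_
      exact (Set.ncard_le_ncard (fun x (hx : _ ∧ _) => hx.1) (Set.toFinite _)).trans (hb v)
    · simpa [Node.size] using Nat.one_le_pow _ _ (by omega)
    · rw [Node.size, if_neg h0, if_neg h1, ← pow_succ']
      refine Nat.pow_le_pow_right (by omega) ?_
      simp only
      omega

/-- The memory stores a tree of nodes with root `x₀`, in which the nodes with numbers less than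
`i` have been expanded. -/
structure IsTree (S : SpinSystem (Fin n) q) (L : ℕ) (x₀ : Node n q) (nodes : ℕ → Node n q)
    (i : ℕ) (m : State) : Prop where
  root : nodes 0 = x₀
  count_pos : 1 ≤ m.nat 15 0 0
  stores : ∀ id < m.nat 15 0 0, Stores m id (nodes id)
  vertex : ∀ id < m.nat 15 0 0, (nodes id).level ≠ 0 →
    (nodes id).config (nodes id).vertex = none
  branching : ∀ id < m.nat 15 0 0, id < i → ∃ j c e, Branching S L (nodes id) j c e ∧
    m.nat 14 id 0 = j ∧ (1 ≤ j → id < m.nat 13 id 0 ∧ m.nat 13 id 0 + q < m.nat 15 0 0 ∧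
      (∀ a : Fin q, nodes (m.nat 13 id 0 + a) = c a) ∧ nodes (m.nat 13 id 0 + q) = e)
  size : ∀ s b, (∀ v, {u | S.G.edist u v = L}.ncard ≤ s) →
    (∀ v, {u | S.G.edist u v < L}.ncard ≤ b) →
    min i (m.nat 15 0 0) + ∑ id ∈ Finset.Ico i (m.nat 15 0 0), (nodes id).size S L s b ≤
      x₀.size S L s b

theorem IsTree.congr {S : SpinSystem (Fin n) q} {L : ℕ} {x₀ : Node n q} {nodes : ℕ → Node n q}
    {i : ℕ} {m m' : State} (h : IsTree S L x₀ nodes i m) (h10 : m'.nat 10 = m.nat 10)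
    (h11 : m'.nat 11 = m.nat 11) (h12 : m'.nat 12 = m.nat 12) (h13 : m'.nat 13 = m.nat 13)
    (h14 : m'.nat 14 = m.nat 14) (h15 : m'.nat 15 = m.nat 15) : IsTree S L x₀ nodes i m' where
  root := h.root
  count_pos := by rw [h15]; exact h.count_pos
  stores id hid := by
    rw [h15] at hid
    exact (h.stores id hid).congr (fun w => by rw [h10]) (by rw [h11]) (by rw [h12])
  vertex := by rw [h15]; exact h.vertex
  branching := by rw [h15, h14, h13]; exact h.branching
  size := by rw [h15]; exact h.size

/-- Were there more than `T` nodes, `T` of them would be expanded and another would be waiting with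
size at least 1, exceeding the potential of the root. -/
theorem IsTree.count_le {S : SpinSystem (Fin n) q} {L : ℕ} {x₀ : Node n q}
    {nodes : ℕ → Node n q} {T : ℕ} {m : State} (h : IsTree S L x₀ nodes T m) {s b : ℕ}
    (hs : ∀ v, {u | S.G.edist u v = L}.ncard ≤ s) (hb : ∀ v, {u | S.G.edist u v < L}.ncard ≤ b)
    (hT : x₀.size S L s b ≤ T) : m.nat 15 0 0 ≤ T := by
  by_contra! hlt
  have h1 := h.size s b hs hb
  have h2 := Finset.single_le_sum (f := fun id => (nodes id).size S L s b)
    (fun _ _ => Nat.zero_le _) (Finset.mem_Ico.2 ⟨le_rfl, hlt⟩)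
  have h3 := (nodes T).one_le_size S L s b
  omega

/-- Marginals are meaningful only at unassigned vertices. Assigning a sphere vertex does not touch
the centre because `L ≥ 1`; level 0 is exempt, as the enumeration of a ball assigns its centre
first. -/
theorem Branching.vertex {S : SpinSystem (Fin n) q} {L : ℕ} {x : Node n q} {j : ℕ}
    {c : Fin q → Node n q} {e : Node n q} (h : Branching S L x j c e) (hj : 1 ≤ j) (hL : 1 ≤ L)
    (hx : x.level ≠ 0 → x.config x.vertex = none) :
    (∀ a, (c a).level ≠ 0 → (c a).config (c a).vertex = none) ∧ e.config e.vertex = none := by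
  cases h with
  | trivial => omega
  | leaf => omega
  | ball hu _ => exact ⟨fun a h => absurd rfl h, hu⟩
  | @sphere k u v τ hk hu huv =>
    refine ⟨fun a h => ?_, hu⟩
    have hne : v ≠ u := by
      rintro rfl
      rw [SimpleGraph.edist_self] at huv
      exact absurd huv (by exact_mod_cast (by omega : (0 : ℕ) ≠ L))
    simpa [hne] using hx h
  | center hk _ => exact ⟨fun a h => absurd rfl h, hx (by simp only; omega)⟩

/-- Expanding node `i` replaces its size in the potential by 1 and the sizes of its children. For a
leaf, its size of at least 1 pays for counting it as expanded. -/
theorem isTree_step {S : SpinSystem (Fin n) q} {ε : ℝ} {m : State} {T i : ℕ} {x₀ : Node n q}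
    {nodes : ℕ → Node n q} (h : HasInput S ε m) (hD : HasDistances S T m)
    (hL : m.nat 6 0 0 + 1 ≤ T) (ht : IsTree S (m.nat 6 0 0 + 1) x₀ nodes i m)
    (h16 : m.nat 16 0 0 = i) (hi : i < m.nat 15 0 0) :
    ∃ nodes', IsTree S (m.nat 6 0 0 + 1) x₀ nodes' (i + 1)
      (childrenProg.run (kindProg.run (pickProg.run m))) := by
  have hxi : Stores m (m.nat 16 0 0) (nodes i) := by rw [h16]; exact ht.stores i hi
  obtain ⟨j, c, e, hbr, hj, hjj, hu⟩ := pickKind_spec h hD hL hxi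
  have hA := agree_run pickProg m
  have hB := agree_run kindProg (pickProg.run m)
  set m₁ := kindProg.run (pickProg.run m) with hm₁
  have f : ∀ a, a ∉ pickProg.natWrites → a ∉ kindProg.natWrites → m₁.nat a = m.nat a :=
    fun a h1 h2 => by rw [hB.nat a h2, hA.nat a h1]
  have f0 := f 0 (by decide) (by decide)
  have f1 := f 1 (by decide) (by decide)
  have f2 := f 2 (by decide) (by decide)
  have f10 := f 10 (by decide) (by decide)
  have f11 := f 11 (by decide) (by decide)
  have f12 := f 12 (by decide) (by decide)
  have f13 := f 13 (by decide) (by decide)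
  have f15 := f 15 (by decide) (by decide)
  have f16 := f 16 (by decide) (by decide)
  have g : ∀ a, a ∉ pickProg.realWrites → a ∉ kindProg.realWrites → m₁.real a = m.real a :=
    fun a h1 h2 => by rw [hB.real a h2, hA.real a h1]
  have h₁ : HasInput S ε m₁ := h.congr f0 f1 f2 (g 0 (by decide) (by decide))
    (g 1 (by decide) (by decide)) (g 2 (by decide) (by decide))
  have hst : Stores m₁ (m₁.nat 16 0 0) (nodes i) := by
    rw [f16, h16]
    exact (ht.stores i hi).congr (fun w => by rw [f10]) (by rw [f11]) (by rw [f12])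
  rw [h16] at hj hjj
  obtain ⟨u, hu'⟩ : ∃ u : Fin n, 1 ≤ j → m₁.nat 26 0 0 = u ∧
      (∀ a, c a = ⟨m₁.nat 29 0 0, (nodes i).vertex, update (nodes i).config u (some a)⟩) ∧
      e = ⟨m₁.nat 31 0 0, u, (nodes i).config⟩ := by
    by_cases h1 : 1 ≤ j
    · obtain ⟨u, hu⟩ := hu h1
      exact ⟨u, fun _ => hu⟩
    · exact ⟨(nodes i).vertex, fun h => absurd h h1⟩
  obtain ⟨k13, kold, kleaf, knew⟩ := childrenProg_spec h₁ hst (by rw [f16, f15, h16]; exact hi) u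
    fun h => (hu' (by rwa [f16, h16, hj] at h)).1
  have k14 : (childrenProg.run m₁).nat 14 = m₁.nat 14 := run_nat _ _ (by decide)
  set m₂ := childrenProg.run m₁ with hm₂
  rw [f15] at k13 kold kleaf knew
  rw [f16, h16] at k13 kleaf knew
  rw [hj] at kleaf knew
  rw [f13] at k13
  rw [f10, f11, f12] at kold
  set N := m.nat 15 0 0 with hN
  have hvert := ht.vertex i hi
  by_cases h1 : 1 ≤ j
  · obtain ⟨k15, kc, ke⟩ := knew h1
    obtain ⟨-, hc, he⟩ := hu' h1
    let nodes' : ℕ → Node n q := fun id => if id < N then nodes id else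
      if h : id - N < q then c ⟨id - N, h⟩ else e
    have hold : ∀ id < N, nodes' id = nodes id := fun id hid => if_pos hid
    have hnc : ∀ a : Fin q, nodes' (N + a) = c a := fun a => by simp [nodes']
    have hne : nodes' (N + q) = e := by simp [nodes']
    have hsplit : ∀ P : ℕ → Prop, (∀ id < N, P id) → (∀ a : Fin q, P (N + a)) → P (N + q) →
        ∀ id < m₂.nat 15 0 0, P id := by
      intro P h1 h2 h3 id hid
      rw [k15] at hid
      by_cases hlt : id < N
      · exact h1 id hlt
      · by_cases hlt' : id - N < q
        · have := h2 ⟨id - N, hlt'⟩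
          rwa [show N + ((⟨id - N, hlt'⟩ : Fin q) : ℕ) = id by simp only; omega] at this
        · rwa [show id = N + q by omega]
    obtain ⟨vc, ve⟩ := hbr.vertex h1 (by omega) hvert
    refine ⟨nodes', ⟨?_, ?_, ?_, ?_, ?_, ?_⟩⟩
    · rw [hold 0 ht.count_pos, ht.root]
    · rw [k15]; omega
    · refine hsplit _ (fun id hid => ?_) (fun a => ?_) ?_
      · rw [hold id hid]
        obtain ⟨k10, k11, k12⟩ := kold id hid
        exact (ht.stores id hid).congr k10 k11 k12
      · rw [hnc, hc]; exact kc a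
      · rw [hne, he]; exact ke
    · refine hsplit _ (fun id hid => ?_) (fun a => ?_) ?_
      · rw [hold id hid]; exact ht.vertex id hid
      · rw [hnc]; exact vc a
      · rw [hne]; exact fun _ => ve
    · intro id hid hid'
      by_cases hidi : id = i
      · subst hidi
        refine ⟨j, c, e, by rwa [hold id hi], by rw [k14, hj], fun _ => ?_⟩
        rw [k13, if_pos rfl, k15]
        exact ⟨hi, by omega, hnc, hne⟩
      · have hlt : id < N := by omega
        obtain ⟨j', c', e', hbr', hj', hrest⟩ := ht.branching id hlt (by omega)
        refine ⟨j', c', e', by rwa [hold id hlt], by rw [k14, hjj id hidi, hj'], fun h => ?_⟩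
        obtain ⟨r1, r2, r3, r4⟩ := hrest h
        rw [k13, if_neg hidi, k15]
        refine ⟨r1, by omega, fun a => ?_, ?_⟩
        · rw [hold _ (by omega), r3]
        · rw [hold _ r2, r4]
    · intro s b hs hb
      have hold' := ht.size s b hs hb
      have hsz := hbr.size_le h1 hs hb
      rw [Finset.sum_eq_sum_Ico_succ_bot hi] at hold'
      rw [k15, ← Finset.sum_Ico_consecutive _ (show i + 1 ≤ N by omega)
        (show N ≤ N + (q + 1) by omega), Finset.sum_congr rfl fun id hid =>
          by rw [hold id (Finset.mem_Ico.1 hid).2],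
        Finset.sum_Ico_eq_sum_range (fun id => (nodes' id).size S _ s b) N,
        Nat.add_sub_cancel_left, Finset.sum_range_succ, hne, Finset.sum_range]
      simp only [hnc]
      omega
  · have hj0 : j = 0 := by omega
    have k15 := kleaf hj0
    refine ⟨nodes, ⟨ht.root, by rw [k15]; exact ht.count_pos, ?_, ?_, ?_, ?_⟩⟩
    · intro id hid
      rw [k15] at hid
      obtain ⟨k10, k11, k12⟩ := kold id hid
      exact (ht.stores id hid).congr k10 k11 k12
    · rw [k15]; exact ht.vertex
    · intro id hid hid'
      rw [k15] at hid
      by_cases hidi : id = i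
      · subst hidi
        exact ⟨j, c, e, hbr, by rw [k14, hj], fun h => absurd h h1⟩
      · obtain ⟨j', c', e', hbr', hj', hrest⟩ := ht.branching id hid (by omega)
        refine ⟨j', c', e', hbr', by rw [k14, hjj id hidi, hj'], fun h => ?_⟩
        rw [k13, if_neg hidi, k15]
        exact hrest h
    · intro s b hs hb
      have hold' := ht.size s b hs hb
      have h1 := (nodes i).one_le_size S (m.nat 6 0 0 + 1) s b
      rw [Finset.sum_eq_sum_Ico_succ_bot hi] at hold'
      rw [k15]
      omega

theorem treeProg_spec {S : SpinSystem (Fin n) q} {ε : ℝ} {m : State} {T : ℕ} {x₀ : Node n q}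
    (h : HasInput S ε m) (hT : m.nat 4 0 0 = T) (hD : HasDistances S T m)
    (hL : m.nat 6 0 0 + 1 ≤ T) (hx : Stores m 0 x₀) (hc : m.nat 15 0 0 = 1)
    (hv : x₀.level ≠ 0 → x₀.config x₀.vertex = none) :
    ∃ nodes, IsTree S (m.nat 6 0 0 + 1) x₀ nodes T (treeProg.run m) := by
  rw [treeProg]
  refine run_loop (Q := fun s => ∃ nodes, IsTree S (m.nat 6 0 0 + 1) x₀ nodes T s)
    (fun i s => ∃ nodes, IsTree S (m.nat 6 0 0 + 1) x₀ nodes i s) ?_ ?_ ?_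
  · refine ⟨fun _ => x₀, rfl, hc.ge, ?_, fun _ _ => hv, fun _ _ h => by omega, ?_⟩
    · intro id hid
      obtain rfl : id = 0 := by omega
      exact hx
    · intro s b _ _
      simp [hc]
  · rintro i s hi hA ⟨nodes, ht⟩
    have a6 : s.nat 6 0 0 = m.nat 6 0 0 := by rw [hA.nat 6 (by decide)]
    have ht' : IsTree S (m.nat 6 0 0 + 1) x₀ nodes i (s.setNat 16 0 0 i) :=
      ht.congr rfl rfl rfl rfl rfl rfl
    by_cases hlt : i < s.nat 15 0 0
    · rw [run_when, if_pos (by simpa using hlt), run_seq, run_seq]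
      rw [← a6] at hL ht' ⊢
      refine isTree_step (ε := ε) (T := T) (nodes := nodes) (m := s.setNat 16 0 0 i) ?_ ?_ hL ht' ?_ hlt
      · exact h.congr (hA.nat 0 (by decide)) (hA.nat 1 (by decide)) (hA.nat 2 (by decide))
          (hA.real 0 (by decide)) (hA.real 1 (by decide)) (hA.real 2 (by decide))
      · exact hD.congr (hA.nat 3 (by decide))
      · simp
    -- No node is waiting: all of them have been expanded, and the remaining iterations change
    -- nothing.
    · rw [run_when, if_neg (by simpa using hlt)]
      refine ⟨nodes, ht'.root, ht'.count_pos, ht'.stores, ht'.vertex, fun id hid _ =>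
        ht'.branching id hid (lt_of_lt_of_le hid (not_lt.1 hlt)), fun s' b hs hb => ?_⟩
      have := ht'.size s' b hs hb
      have e15 : (s.setNat 16 0 0 i).nat 15 0 0 = s.nat 15 0 0 := rfl
      rw [e15] at this ⊢
      rw [Finset.Ico_eq_empty (by omega), Finset.sum_empty] at this ⊢
      omega
  · rintro s _ ⟨nodes, ht⟩
    rw [hT] at ht ⊢
    exact ⟨nodes, ht.congr rfl rfl rfl rfl rfl rfl⟩

end RealRAM

/-! ### Evaluation of the recursion tree. -/

namespace RealRAM

open LoopProg Function SpinSystem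

variable {n q : ℕ}

theorem sumChildrenProg_spec {m : State} (hq : m.nat 1 0 0 = q) :
    (sumChildrenProg.run m).real 8 0 0 =
      ∑ a : Fin q, m.real 4 (m.nat 13 (m.nat 27 0 0) 0 + a) 0 := by
  rw [← Finset.sum_range fun a => m.real 4 (m.nat 13 (m.nat 27 0 0) 0 + a) 0, sumChildrenProg,
    run_seq]
  refine run_loop (Q := fun s => s.real 8 0 0 = _) (fun i s => s.real 8 0 0 =
    ∑ a ∈ Finset.range i, m.real 4 (m.nat 13 (m.nat 27 0 0) 0 + a) 0) ?_ ?_ ?_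
  · simp
  · intro i s _ hA hI
    have a13 : s.nat 13 = m.nat 13 := hA.nat 13 (by decide)
    have a27 : s.nat 27 = m.nat 27 := hA.nat 27 (by decide)
    have a4 : s.real 4 = m.real 4 := by rw [hA.real 4 (by decide)]; rfl
    rw [Finset.sum_range_succ, ← hI]
    simp [a13, a27, a4]
  · intro s _ hI
    have : ((setR 8 (.const 0)).run m).nat 1 0 0 = q := hq
    rw [this] at hI
    exact hI

/-- The children have larger numbers than the node, so writing its row does not disturb the values
still to be read. The running minimum starts at child 0, for which `q` must be positive. -/
theorem mixProg_spec {m : State} {f : ℕ} (hq : m.nat 1 0 0 = q) (hq0 : 0 < q)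
    (hf : m.nat 13 (m.nat 27 0 0) 0 = f) (hlt : m.nat 27 0 0 < f) :
    (∀ r, r ≠ m.nat 27 0 0 → (mixProg.run m).real 4 r = m.real 4 r) ∧
    ∃ mn : Fin q → ℝ, (∀ a i : Fin q, mn i ≤ m.real 4 (f + a) i) ∧
      (∀ i : Fin q, ∃ a : Fin q, mn i = m.real 4 (f + a) i) ∧
      ∀ i : Fin q, (mixProg.run m).real 4 (m.nat 27 0 0) i =
        ∑ a : Fin q, m.real 4 (f + q) a * m.real 4 (f + a) i +
          (1 - ∑ a : Fin q, m.real 4 (f + q) a) * mn i := by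
  set id := m.nat 27 0 0 with hid
  set p₁ : LoopProg := .seq (.setR 8 (.const 0))
    (.loop 19 1 (.setR 8 (.add (.reg 8) (childValue (.reg 1) (.reg 19))))) with hp₁
  have hsum : (p₁.run m).real 8 0 0 = ∑ a ∈ Finset.range q, m.real 4 (f + q) a := by
    rw [hp₁, run_seq]
    refine run_loop (Q := fun s => s.real 8 0 0 = _) (fun i s => s.real 8 0 0 =
      ∑ a ∈ Finset.range i, m.real 4 (f + q) a) ?_ ?_ ?_
    · simp
    · intro i s _ hA hI
      have a1 : s.nat 1 = m.nat 1 := hA.nat 1 (by decide)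
      have a13 : s.nat 13 = m.nat 13 := hA.nat 13 (by decide)
      have a27 : s.nat 27 = m.nat 27 := hA.nat 27 (by decide)
      have a4 : s.real 4 = m.real 4 := by rw [hA.real 4 (by decide)]; rfl
      rw [Finset.sum_range_succ, ← hI]
      simp [a13, a27, a4, a1, hq, ← hid, hf]
    · intro s _ hI
      have : ((setR 8 (.const 0)).run m).nat 1 0 0 = q := hq
      rw [this] at hI
      exact hI
  have hB := agree_run p₁ m
  have b1 := hB.nat 1 (by decide)
  have b13 := hB.nat 13 (by decide)
  have b27 := hB.nat 27 (by decide)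
  have b4 := hB.real 4 (by decide)
  set m₁ := p₁.run m with hm₁
  let good : State → ℕ → Prop := fun s i => ∃ mn : ℝ, (∀ a < q, mn ≤ m.real 4 (f + a) i) ∧
    (∃ a < q, mn = m.real 4 (f + a) i) ∧ s.real 4 id i =
      ∑ a ∈ Finset.range q, m.real 4 (f + q) a * m.real 4 (f + a) i +
          (1 - ∑ a ∈ Finset.range q, m.real 4 (f + q) a) * mn
  have key : (∀ r, r ≠ id → (mixProg.run m).real 4 r = m.real 4 r) ∧
      ∀ i < q, good (mixProg.run m) i := by
    have e : mixProg.run m = (LoopProg.loop 20 1 <|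
      .seq (.setR 9 (childValue (.const 0) (.reg 20))) <|
      .seq (.setR 10 (.const 0)) <|
      .seq
        (.loop 19 1 <|
          .seq (.setR 10 (.add (.reg 10)
            (.mul (childValue (.reg 1) (.reg 19)) (childValue (.reg 19) (.reg 20))))) <|
          .when (.realLe (childValue (.reg 19) (.reg 20)) (.reg 9)) <|
          .setR 9 (childValue (.reg 19) (.reg 20))) <|
      .writeReal 4 (.reg 27) (.reg 20)
        (.add (.reg 10) (.mul (.sub (.const 1) (.reg 8)) (.reg 9)))).run m₁ := rfl
    rw [e]
    refine run_loop (Q := fun s => (∀ r, r ≠ id → s.real 4 r = m.real 4 r) ∧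
      ∀ i < q, good s i) (fun i s => (∀ r, r ≠ id → s.real 4 r = m.real 4 r) ∧
      ∀ i' < i, good s i') ?_ ?_ ?_
    · exact ⟨fun r _ => by rw [b4], fun i hi => by omega⟩
    · intro i s hi hA hI
      have a1 : s.nat 1 0 0 = q := by rw [hA.nat 1 (by decide), b1, hq]
      have a13 : s.nat 13 = m.nat 13 := by rw [hA.nat 13 (by decide), b13]
      have a27 : s.nat 27 0 0 = id := by rw [hA.nat 27 (by decide), b27]
      have a8 : s.real 8 0 0 = m₁.real 8 0 0 := by rw [hA.real 8 (by decide)]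
      have hrd : ∀ c j, s.real 4 (f + c) j = m.real 4 (f + c) j := fun c j => by
        rw [hI.1 _ (by omega)]
      set s₁ := ((s.setNat 20 0 0 i).setReal 9 0 0 (m.real 4 (f + 0) i)).setReal 10 0 0 0 with hs₁
      set p₂ : LoopProg := (.loop 19 1 <|
          .seq (.setR 10 (.add (.reg 10)
            (.mul (childValue (.reg 1) (.reg 19)) (childValue (.reg 19) (.reg 20))))) <|
          .when (.realLe (childValue (.reg 19) (.reg 20)) (.reg 9)) <|
          .setR 9 (childValue (.reg 19) (.reg 20))) with hp₂
      let J : ℕ → State → Prop := fun c t => t.real 10 0 0 =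
          ∑ a ∈ Finset.range c, m.real 4 (f + q) a * m.real 4 (f + a) i ∧
        (∀ a < c, t.real 9 0 0 ≤ m.real 4 (f + a) i) ∧
        ∃ a < q, t.real 9 0 0 = m.real 4 (f + a) i
      have hJ : J q (p₂.run s₁) := by
        rw [hp₂]
        refine run_loop (Q := J q) J ?_ ?_ ?_
        · exact ⟨by simp [s₁], fun a ha => by omega, 0, hq0, by simp [s₁]⟩
        · intro c t hc hC hJ
          have c1 : t.nat 1 0 0 = q := by rw [hC.nat 1 (by decide), ← a1]; rfl
          have c13 : t.nat 13 = m.nat 13 := by rw [hC.nat 13 (by decide), ← a13]; rfl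
          have c27 : t.nat 27 0 0 = id := by rw [hC.nat 27 (by decide), ← a27]; rfl
          have c20 : t.nat 20 0 0 = i := by rw [hC.nat 20 (by decide)]; simp [s₁]
          have c4 : t.real 4 = s.real 4 := by
            rw [hC.real 4 (by decide)]; funext r j; simp [s₁]
          have hcq : c < q := by
            have : s₁.nat 1 0 0 = q := by rw [← a1]; rfl
            rwa [this] at hc
          obtain ⟨J1, J2, J3⟩ := hJ
          simp only [run_seq, run_when, run_setR]
          by_cases hle : m.real 4 (f + c) i ≤ t.real 9 0 0
          · rw [if_pos (by simpa [c1, c13, c27, c20, c4, hf, hrd] using hle)]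
            refine ⟨?_, fun a ha => ?_, c, hcq, ?_⟩
            · rw [Finset.sum_range_succ, ← J1]
              simp [c1, c13, c27, c20, c4, hf, hrd]
            · rcases Nat.lt_succ_iff_lt_or_eq.1 ha with hlt' | rfl
              · simpa [c1, c13, c27, c20, c4, hf, hrd] using hle.trans (J2 a hlt')
              · simp [c1, c13, c27, c20, c4, hf, hrd]
            · simp [c1, c13, c27, c20, c4, hf, hrd]
          · rw [if_neg (by simpa [c1, c13, c27, c20, c4, hf, hrd] using hle)]
            refine ⟨?_, fun a ha => ?_, ?_⟩
            · rw [Finset.sum_range_succ, ← J1]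
              simp [c1, c13, c27, c20, c4, hf, hrd]
            · rcases Nat.lt_succ_iff_lt_or_eq.1 ha with hlt' | rfl
              · simpa using J2 a hlt'
              · simpa using (not_le.1 hle).le
            · simpa using J3
        · intro t _ hJ
          have : s₁.nat 1 0 0 = q := by rw [← a1]; rfl
          rw [this] at hJ
          exact hJ
      have hC := agree_run p₂ s₁
      have c27 : (p₂.run s₁).nat 27 0 0 = id := by rw [hC.nat 27 (by decide), ← a27]; rfl
      have c20 : (p₂.run s₁).nat 20 0 0 = i := by rw [hC.nat 20 (by decide)]; simp [s₁]
      have c4 : (p₂.run s₁).real 4 = s.real 4 := by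
        rw [hC.real 4 (by decide)]; funext r j; simp [s₁]
      have c8 : (p₂.run s₁).real 8 0 0 = ∑ a ∈ Finset.range q, m.real 4 (f + q) a := by
        rw [hC.real 8 (by decide), ← hsum, ← a8]; simp [s₁]
      have hrun : (setR 10 (.const 0)).run ((setR 9 (childValue (.const 0) (.reg 20))).run
          (s.setNat 20 0 0 i)) = s₁ := by
        have := hrd 0 i
        rw [Nat.add_zero] at this
        simp [s₁, a13, a27, hf, this]
      simp only [run_seq]
      rw [hrun]
      refine ⟨fun r hr => ?_, fun i' hi' => ?_⟩
      · rw [← hI.1 r hr]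
        funext j
        simp [c27, hr, c4]
      · by_cases hii : i' = i
        · subst hii
          refine ⟨(p₂.run s₁).real 9 0 0, hJ.2.1, hJ.2.2, ?_⟩
          rw [← hJ.1]
          simp [c27, c20, c8]
        · obtain ⟨mn, g1, g2, g3⟩ := hI.2 i' (by omega)
          refine ⟨mn, g1, g2, ?_⟩
          rw [← g3]
          simp [c27, c20, c4, hii]
    · intro s _ hI
      rw [b1, hq] at hI
      exact hI
  refine ⟨key.1, ?_⟩
  choose mn h1 h2 h3 using fun i : Fin q => key.2 i i.2
  refine ⟨mn, fun a i => h1 i a a.2, fun i => ?_, fun i => ?_⟩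
  · obtain ⟨a, ha, e⟩ := h2 i
    exact ⟨⟨a, ha⟩, e⟩
  · rw [h3, Finset.sum_range, Finset.sum_range]

theorem normalizeProg_spec {m : State} (hq : m.nat 1 0 0 = q)
    (hlt : m.nat 27 0 0 < m.nat 13 (m.nat 27 0 0) 0) :
    (∀ r, r ≠ m.nat 27 0 0 → (normalizeProg.run m).real 4 r = m.real 4 r) ∧
    ∀ i : Fin q, (normalizeProg.run m).real 4 (m.nat 27 0 0) i =
      if ∑ a : Fin q, m.real 4 (m.nat 13 (m.nat 27 0 0) 0 + a) 0 ≤ 0 then 1 else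
        m.real 4 (m.nat 13 (m.nat 27 0 0) 0 + i) 0 /
          ∑ a : Fin q, m.real 4 (m.nat 13 (m.nat 27 0 0) 0 + a) 0 := by
  set id := m.nat 27 0 0 with hid
  set W := ∑ a : Fin q, m.real 4 (m.nat 13 id 0 + a) 0 with hW
  have hsum : (sumChildrenProg.run m).real 8 0 0 = W := sumChildrenProg_spec hq
  have hB := agree_run sumChildrenProg m
  have b1 := hB.nat 1 (by decide)
  have b13 := hB.nat 13 (by decide)
  have b27 := hB.nat 27 (by decide)
  have b4 := hB.real 4 (by decide)
  set m₁ := sumChildrenProg.run m with hm₁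
  have key : (∀ r, r ≠ id → (normalizeProg.run m).real 4 r = m.real 4 r) ∧
      ∀ i < q, (normalizeProg.run m).real 4 id i = if W ≤ 0 then 1 else
        m.real 4 (m.nat 13 id 0 + i) 0 / W := by
    rw [normalizeProg, run_seq, ← hm₁]
    refine run_loop (Q := fun s => (∀ r, r ≠ id → s.real 4 r = m.real 4 r) ∧
      ∀ i < q, s.real 4 id i = if W ≤ 0 then 1 else m.real 4 (m.nat 13 id 0 + i) 0 / W)
      (fun i s => (∀ r, r ≠ id → s.real 4 r = m.real 4 r) ∧
      ∀ i' < i, s.real 4 id i' = if W ≤ 0 then 1 else m.real 4 (m.nat 13 id 0 + i') 0 / W)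
      ?_ ?_ ?_
    · exact ⟨fun r _ => by rw [b4], fun i hi => by omega⟩
    · intro i s hi hA hI
      have a13 : s.nat 13 = m.nat 13 := by rw [hA.nat 13 (by decide), b13]
      have a27 : s.nat 27 0 0 = id := by rw [hA.nat 27 (by decide), b27]
      have a8 : s.real 8 0 0 = W := by rw [hA.real 8 (by decide), hsum]
      have hrd : ∀ c j, s.real 4 (m.nat 13 id 0 + c) j = m.real 4 (m.nat 13 id 0 + c) j :=
        fun c j => by rw [hI.1 _ (by omega)]
      have hrun : run (.ite (.realLe (.reg 8) (.const 0))
          (.writeReal 4 (.reg 27) (.reg 20) (.const 1))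
          (.writeReal 4 (.reg 27) (.reg 20) (.div (childValue (.reg 20) (.const 0)) (.reg 8))))
          (s.setNat 20 0 0 i) = (s.setNat 20 0 0 i).setReal 4 id i (if W ≤ 0 then 1 else
            m.real 4 (m.nat 13 id 0 + i) 0 / W) := by
        by_cases hW0 : W ≤ 0 <;> simp [hW0, a8, a27, a13, hrd]
      rw [hrun]
      refine ⟨fun r hr => ?_, fun i' hi' => ?_⟩
      · rw [← hI.1 r hr]
        funext j
        simp [hr]
      · by_cases hii : i' = i
        · subst hii; simp
        · simpa [hii] using hI.2 i' (by omega)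
    · intro s _ hI
      rw [b1, hq] at hI
      exact hI
  exact ⟨key.1, fun i => key.2 i i.2⟩

/-- The vector `y` is a correct value of the node `x`. -/
def IsValue [NeZero q] (S : SpinSystem (Fin n) q) (L : ℕ) (x : Node n q) (y : Fin q → ℝ) : Prop :=
  if x.level = 0 then S.IsBallWeight L x.vertex x.config (y 0)
  else S.IsLowerBound L x.level x.vertex x.config y

/-- Each kind of branching is matched with the lemma that combines the children's values. The ball
weight at level 0 is a single number and sits in column 0. -/
theorem evalProg_spec [NeZero q] {S : SpinSystem (Fin n) q} {ε : ℝ} {m : State} {L j : ℕ}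
    {x e : Node n q} {c : Fin q → Node n q} (hP : S.Permissive) (hL : 1 ≤ L)
    (h : HasInput S ε m) (hx : Stores m (m.nat 27 0 0) x)
    (hv : x.level ≠ 0 → x.config x.vertex = none) (hbr : Branching S L x j c e)
    (hj : m.nat 14 (m.nat 27 0 0) 0 = j)
    (hlt : 1 ≤ j → m.nat 27 0 0 < m.nat 13 (m.nat 27 0 0) 0)
    (hc : 1 ≤ j → ∀ a : Fin q,
      IsValue S L (c a) fun i => m.real 4 (m.nat 13 (m.nat 27 0 0) 0 + a) i)
    (he : 1 ≤ j → IsValue S L e fun i => m.real 4 (m.nat 13 (m.nat 27 0 0) 0 + q) i) :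
    (∀ r, r ≠ m.nat 27 0 0 → (evalProg.run m).real 4 r = m.real 4 r) ∧
      IsValue S L x fun i => (evalProg.run m).real 4 (m.nat 27 0 0) i := by
  set id := m.nat 27 0 0 with hid
  set m₁ := m.setNat 22 0 0 id with hm₁
  have h₁ : HasInput S ε m₁ := h.congr rfl rfl rfl rfl rfl rfl
  have e11 : m₁.nat 11 (m₁.nat 27 0 0) 0 = x.level := hx.level
  have e14 : m₁.nat 14 (m₁.nat 27 0 0) 0 = j := hj
  have e27 : m₁.nat 27 0 0 = id := rfl
  have hrun : evalProg.run m = (LoopProg.ite (.natLe (.read 11 (.reg 27) (.const 0)) (.const 1))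
    (.ite (.natLe (.read 11 (.reg 27) (.const 0)) (.const 0))
      (.ite (.natLe (.read 14 (.reg 27) (.const 0)) (.const 0))
        (.seq weightProg (.writeReal 4 (.reg 27) (.const 0) (.reg 7)))
        (.seq sumChildrenProg (.writeReal 4 (.reg 27) (.const 0) (.reg 8))))
      (.loop 20 1 (.writeReal 4 (.reg 27) (.reg 20) (.const 0))))
    (.ite (.natLe (.read 14 (.reg 27) (.const 0)) (.const 1)) mixProg normalizeProg)).run m₁ := rfl
  rw [hrun]
  simp only [run_ite, Test.holds_natLe, NExp.eval_read, NExp.eval_reg, NExp.eval_const, e11, e14]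
  have hweight : ∀ v τ, x = ⟨0, v, τ⟩ → (∀ r, r ≠ id →
      (run (.seq weightProg (.writeReal 4 (.reg 27) (.const 0) (.reg 7))) m₁).real 4 r =
        m.real 4 r) ∧ (run (.seq weightProg (.writeReal 4 (.reg 27) (.const 0) (.reg 7))) m₁).real
          4 id 0 = S.partialWeight τ := by
    rintro v τ rfl
    have hw := weightProg_spec h₁ (τ := τ) fun w => by
      have := hx.config w
      simpa [m₁] using this
    have w27 : (weightProg.run m₁).nat 27 = m.nat 27 := run_nat _ _ (by decide)
    have w4 : (weightProg.run m₁).real 4 = m.real 4 := run_real _ _ (by decide)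
    refine ⟨fun r hr => ?_, ?_⟩
    · funext i
      simp [w27, ← hid, hr, w4]
    · simp [w27, ← hid, hw]
  cases hbr with
  | @trivial v τ _ _ =>
    rw [if_pos le_rfl, if_neg (by simp)]
    have key : (∀ r, r ≠ id → (run (.loop 20 1 (.writeReal 4 (.reg 27) (.reg 20) (.const 0)))
        m₁).real 4 r = m.real 4 r) ∧ ∀ i < q, (run (.loop 20 1 (.writeReal 4 (.reg 27) (.reg 20)
          (.const 0))) m₁).real 4 id i = 0 := by
      refine run_loop (Q := fun s => (∀ r, r ≠ id → s.real 4 r = m.real 4 r) ∧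
        ∀ i < q, s.real 4 id i = 0) (fun i s => (∀ r, r ≠ id → s.real 4 r = m.real 4 r) ∧
        ∀ i' < i, s.real 4 id i' = 0) ?_ ?_ ?_
      · exact ⟨fun r _ => rfl, fun i hi => by omega⟩
      · intro i s _ hA hI
        have a27 : s.nat 27 0 0 = id := by rw [hA.nat 27 (by decide)]; rfl
        refine ⟨fun r hr => ?_, fun i' hi' => ?_⟩
        · rw [← hI.1 r hr]
          funext j
          simp [hr, a27]
        · by_cases hii : i' = i
          · simp [a27, hii]
          · simpa [a27, hii] using hI.2 i' (by omega)
      · intro s _ hI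
        have : m₁.nat 1 0 0 = q := h.q_eq
        rw [this] at hI
        exact hI
    refine ⟨key.1, ?_⟩
    rw [IsValue, if_neg one_ne_zero]
    have : (fun i : Fin q => (run (.loop 20 1 (.writeReal 4 (.reg 27) (.reg 20) (.const 0)))
        m₁).real 4 id i) = 0 := funext fun i => key.2 i i.2
    rw [this]
    exact isLowerBound_zero
  | @leaf v τ _ _ hfull =>
    rw [if_pos (Nat.zero_le 1), if_pos le_rfl, if_pos le_rfl]
    obtain ⟨hw1, hw2⟩ := hweight v τ rfl
    refine ⟨hw1, ?_⟩
    rw [IsValue, if_pos rfl, Fin.val_zero, hw2]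
    exact isBallWeight_leaf hP hfull
  | @ball u v τ hu huv =>
    rw [if_pos (Nat.zero_le 1), if_pos le_rfl, if_neg (by omega)]
    have hsum : (sumChildrenProg.run m₁).real 8 0 0 =
        ∑ a : Fin q, m.real 4 (m.nat 13 id 0 + a) 0 := sumChildrenProg_spec h.q_eq
    have w27 : (sumChildrenProg.run m₁).nat 27 = m.nat 27 := run_nat _ _ (by decide)
    have w4 : (sumChildrenProg.run m₁).real 4 = m.real 4 := run_real _ _ (by decide)
    refine ⟨fun r hr => ?_, ?_⟩
    · funext i
      simp [w27, ← hid, hr, w4]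
    · rw [IsValue, if_pos rfl]
      have : ((seq sumChildrenProg (writeReal 4 (.reg 27) (.const 0) (.reg 8))).run m₁).real 4 id
          ((0 : Fin q) : ℕ) = ∑ a : Fin q, m.real 4 (m.nat 13 id 0 + a) 0 := by
        simp [w27, ← hid, hsum]
      rw [this]
      refine isBallWeight_branch hu huv fun a => ?_
      have := hc le_rfl a
      rwa [IsValue, if_pos rfl, Fin.val_zero] at this
  | @sphere k u v τ hk hu huv =>
    rw [if_neg (by simp only; omega), if_pos le_rfl]
    obtain ⟨hr, mn, hmn1, hmn2, hval⟩ := mixProg_spec (m := m₁) (q := q) h.q_eq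
      (NeZero.pos q) rfl (hlt le_rfl)
    refine ⟨hr, ?_⟩
    rw [IsValue, if_neg (by simp only; omega)]
    have : (fun i : Fin q => (mixProg.run m₁).real 4 id i) = fun i : Fin q =>
        ∑ a : Fin q, m.real 4 (m.nat 13 id 0 + q) a * m.real 4 (m.nat 13 id 0 + a) i +
          (1 - ∑ a : Fin q, m.real 4 (m.nat 13 id 0 + q) a) * mn i := funext hval
    rw [this]
    refine isLowerBound_branch (u := u) (f := fun a i => m.real 4 (m.nat 13 id 0 + a) i)
      (lo := fun a => m.real 4 (m.nat 13 id 0 + q) a) hL hk hu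
      (hv (by simp only; omega)) huv (fun a => ?_) ?_ hmn1 hmn2
    · have := hc le_rfl a
      rwa [IsValue, if_neg (by simp only; omega)] at this
    · have := he le_rfl
      rwa [IsValue, if_neg (by simp only; omega)] at this
  | @center k v τ hk hs =>
    rw [if_neg (by simp only; omega), if_neg (by omega)]
    obtain ⟨hr, hval⟩ := normalizeProg_spec (m := m₁) (q := q) h.q_eq (hlt (by omega))
    refine ⟨hr, ?_⟩
    rw [IsValue, if_neg (by simp only; omega)]
    have : (fun i : Fin q => (normalizeProg.run m₁).real 4 id i) = fun i : Fin q =>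
        if ∑ a : Fin q, m.real 4 (m.nat 13 id 0 + a) 0 ≤ 0 then 1 else
        m.real 4 (m.nat 13 id 0 + i) 0 / ∑ a : Fin q, m.real 4 (m.nat 13 id 0 + a) 0 :=
      funext hval
    rw [this]
    refine isLowerBound_of_ballWeight hL (hv (by simp only; omega)) hs fun a => ?_
    have := hc (by omega) a
    rwa [IsValue, if_pos rfl, Fin.val_zero] at this

/-- Children have larger numbers than their parents, so evaluation in decreasing order finds their
values ready. The bound on the count guarantees that every node has been expanded; rows beyond the
count may receive meaningless values, which no node of the tree reads. -/
theorem valuesProg_spec [NeZero q] {S : SpinSystem (Fin n) q} {ε : ℝ} {m : State} {L T : ℕ}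
    {x₀ : Node n q} {nodes : ℕ → Node n q} (hP : S.Permissive) (hL : 1 ≤ L)
    (h : HasInput S ε m) (hT : m.nat 4 0 0 = T) (ht : IsTree S L x₀ nodes T m)
    (hc : m.nat 15 0 0 ≤ T) : IsValue S L x₀ fun i => (valuesProg.run m).real 4 0 i := by
  have key : ∀ id < m.nat 15 0 0,
      IsValue S L (nodes id) fun i => (valuesProg.run m).real 4 id i := by
    rw [valuesProg]
    refine run_loop (Q := fun s => ∀ id < m.nat 15 0 0,
      IsValue S L (nodes id) fun i => s.real 4 id i) (fun t s => ∀ id < m.nat 15 0 0, T - t ≤ id →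
      IsValue S L (nodes id) fun i => s.real 4 id i) ?_ ?_ ?_
    · intro id hid h; omega
    · intro t s htT hA hI
      rw [hT] at htT
      set id₀ := T - (t + 1) with hid₀
      have a0 := hA.nat 0 (by decide)
      have a1 := hA.nat 1 (by decide)
      have a2 := hA.nat 2 (by decide)
      have a4 := hA.nat 4 (by decide)
      have a10 := hA.nat 10 (by decide)
      have a11 := hA.nat 11 (by decide)
      have a12 := hA.nat 12 (by decide)
      have a13 := hA.nat 13 (by decide)
      have a14 := hA.nat 14 (by decide)
      have hrun : (set 27 (.sub (.reg 4) (.add (.reg 28) (.const 1)))).run (s.setNat 28 0 0 t) =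
          (s.setNat 28 0 0 t).setNat 27 0 0 id₀ := by
        simp [a4, hT, id₀]
      rw [run_seq, hrun]
      set s₁ := (s.setNat 28 0 0 t).setNat 27 0 0 id₀ with hs₁
      have s27 : s₁.nat 27 0 0 = id₀ := by simp [s₁]
      have s13 : s₁.nat 13 = m.nat 13 := by rw [← a13]; rfl
      have s14 : s₁.nat 14 = m.nat 14 := by rw [← a14]; rfl
      have s4 : s₁.real 4 = s.real 4 := rfl
      intro id hid hle
      by_cases hid₀' : id₀ < m.nat 15 0 0
      · obtain ⟨j, c, e, hbr, hj, hrest⟩ := ht.branching id₀ hid₀' (by omega)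
        have hst : Stores s₁ (s₁.nat 27 0 0) (nodes id₀) := by
          rw [s27]
          exact (ht.stores id₀ hid₀').congr (fun w => by rw [← a10]; rfl) (by rw [← a11]; rfl)
            (by rw [← a12]; rfl)
        have hin : HasInput S ε s₁ := h.congr a0 a1 a2 (hA.real 0 (by decide))
          (hA.real 1 (by decide)) (hA.real 2 (by decide))
        obtain ⟨hold, hnew⟩ := evalProg_spec hP hL hin hst (ht.vertex id₀ hid₀') hbr
          (by rw [s27, s14, hj]) (fun h1 => by rw [s27, s13]; exact (hrest h1).1)
          (fun h1 a => by
            obtain ⟨r1, r2, r3, r4⟩ := hrest h1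
            rw [s27, s13, s4, ← r3]
            exact hI _ (by omega) (by omega))
          (fun h1 => by
            obtain ⟨r1, r2, r3, r4⟩ := hrest h1
            rw [s27, s13, s4, ← r4]
            exact hI _ r2 (by omega))
        rw [s27] at hold hnew
        by_cases hii : id = id₀
        · rw [hii]; exact hnew
        · rw [hold id hii, s4]
          exact hI id hid (by omega)
      · omega
    · intro s _ hI id hid
      exact hI id hid (by omega)
  have := key 0 ht.count_pos
  rwa [ht.root] at this

end RealRAM

/-! ### Assignment of the vertices, and the certificate of an attempt. -/

namespace RealRAM

open LoopProg Function SpinSystem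

variable {n q : ℕ}

theorem argmaxProg_spec {m : State} (hq : m.nat 1 0 0 = q) (hq0 : 0 < q) :
    (argmaxProg.run m).real 8 0 0 = ∑ a : Fin q, m.real 4 0 a ∧
      ∃ c : Fin q, (argmaxProg.run m).nat 23 0 0 = c ∧
        ∀ a : Fin q, m.real 4 0 a ≤ m.real 4 0 c := by
  have key : (argmaxProg.run m).real 8 0 0 = ∑ a ∈ Finset.range q, m.real 4 0 a ∧
      (argmaxProg.run m).nat 23 0 0 < q ∧
      ∀ a < q, m.real 4 0 a ≤ m.real 4 0 ((argmaxProg.run m).nat 23 0 0) := by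
    rw [argmaxProg, run_seq, run_seq]
    let I : ℕ → State → Prop := fun i s => s.real 8 0 0 = ∑ a ∈ Finset.range i, m.real 4 0 a ∧
      s.nat 23 0 0 < q ∧ ∀ a < i, m.real 4 0 a ≤ m.real 4 0 (s.nat 23 0 0)
    refine run_loop (Q := I q) I ?_ ?_ ?_
    · exact ⟨by simp, by simpa using hq0, fun a ha => by omega⟩
    · intro i s hi hA hI
      have hiq : i < q := hq ▸ hi
      have a4 : s.real 4 = m.real 4 := by rw [hA.real 4 (by decide)]; rfl
      obtain ⟨I1, I2, I3⟩ := hI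
      rw [run_seq, run_when]
      by_cases hle : m.real 4 0 (s.nat 23 0 0) ≤ m.real 4 0 i
      · rw [if_pos (by simpa [a4] using hle)]
        refine ⟨?_, by simpa using hiq, fun a ha => ?_⟩
        · rw [Finset.sum_range_succ, ← I1]
          simp [a4]
        · rcases Nat.lt_succ_iff_lt_or_eq.1 ha with hlt | rfl
          · simpa using (I3 a hlt).trans hle
          · simp
      · rw [if_neg (by simpa [a4] using hle)]
        refine ⟨?_, by simpa using I2, fun a ha => ?_⟩
        · rw [Finset.sum_range_succ, ← I1]
          simp [a4]
        · rcases Nat.lt_succ_iff_lt_or_eq.1 ha with hlt | rfl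
          · simpa using I3 a hlt
          · simpa using (not_le.1 hle).le
    · intro s _ hI
      have : ((setR 8 (.const 0)).run ((set 23 (.const 0)).run m)).nat 1 0 0 = q := hq
      rw [this] at hI
      exact hI
  obtain ⟨h1, h2, h3⟩ := key
  exact ⟨by rw [h1, Finset.sum_range], ⟨_, h2⟩, rfl, fun a => h3 a a.2⟩

/-- Here `fits` says that the tree was completed within the budget. Only then is `y` a certified
lower bound; otherwise the validity flag is cleared, as it is when the chosen value is not positive,
and the remaining computation does no harm. -/
theorem assignProg_spec [NeZero q] {S : SpinSystem (Fin n) q} {ε : ℝ} {m : State} {T : ℕ}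
    {x : Fin n} {τ : Fin n → Option (Fin q)} (hP : S.Permissive) (h : HasInput S ε m)
    (hD : HasDistances S T m) (hT : m.nat 4 0 0 = T) (hL : m.nat 6 0 0 + 1 ≤ T)
    (hτ : ∀ w : Fin n, m.nat 10 0 w = code (τ w)) (hx : m.nat 8 0 0 = x) (hτx : τ x = none) :
    let m' := assignProg.run m
    let L := m.nat 6 0 0 + 1
    let k := m.nat 7 0 0 + 1
    ∃ (a : Fin q) (y : Fin q → ℝ) (fits : Prop),
      (∀ w : Fin n, m'.nat 10 0 w = code (update τ x (some a) w)) ∧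
      m'.real 5 0 0 = m.real 5 0 0 * y a ∧
      m'.real 6 0 0 = m.real 6 0 0 * (y a + (1 - ∑ a, y a)) ∧
      (1 ≤ m'.nat 21 0 0 ↔ 1 ≤ m.nat 21 0 0 ∧ fits ∧ 0 < y a) ∧
      (fits → S.IsLowerBound L k x τ y) ∧ (∀ a', y a' ≤ y a) ∧
      ∀ s b, (∀ v, {u | S.G.edist u v = L}.ncard ≤ s) →
        (∀ v, {u | S.G.edist u v < L}.ncard ≤ b) →
        (⟨k, x, τ⟩ : Node n q).size S L s b ≤ T → fits := by
  intro m' L k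
  set m₁ := ((m.setNat 11 0 0 k).setNat 12 0 0 x).setNat 15 0 0 1 with hm₁
  have hrun : m' = run (.seq treeProg <| .seq valuesProg <| .seq argmaxProg <|
      .seq (.when (.not (.natLe (.reg 15) (.reg 4))) (.set 21 (.const 0))) <|
      .seq (.when (.realLe (.read 4 (.const 0) (.reg 23)) (.const 0)) (.set 21 (.const 0))) <|
      .seq (.setR 5 (.mul (.reg 5) (.read 4 (.const 0) (.reg 23)))) <|
      .seq (.setR 6 (.mul (.reg 6)
        (.add (.read 4 (.const 0) (.reg 23)) (.sub (.const 1) (.reg 8))))) <|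
      .writeNat 10 (.const 0) (.reg 8) (.add (.reg 23) (.const 1))) m₁ := by
    simp only [m', assignProg, run_seq (p := .writeNat _ _ _ _), run_seq (p := .set _ _)]
    congr 1
    simp [m₁, hx, k]
  clear_value m'
  simp only [run_seq] at hrun
  have h₁ : HasInput S ε m₁ := h.congr rfl rfl rfl rfl rfl rfl
  have hst : Stores m₁ 0 (⟨k, x, τ⟩ : Node n q) := by
    refine ⟨by simp [m₁], by simp [m₁], fun w => ?_⟩
    rw [← hτ]; simp [m₁]
  obtain ⟨nodes, ht⟩ := treeProg_spec h₁ (T := T) (by rw [← hT]; rfl) (hD.congr rfl) hL hst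
    (by simp [m₁]) fun _ => hτx
  have hA := agree_run treeProg m₁
  set m₂ := treeProg.run m₁ with hm₂
  have h₂ : HasInput S ε m₂ := h₁.congr (hA.nat 0 (by decide)) (hA.nat 1 (by decide))
    (hA.nat 2 (by decide)) (hA.real 0 (by decide)) (hA.real 1 (by decide)) (hA.real 2 (by decide))
  have a4 : m₂.nat 4 0 0 = T := by rw [hA.nat 4 (by decide), ← hT]; rfl
  have a8 : m₂.nat 8 0 0 = x := by rw [hA.nat 8 (by decide), ← hx]; rfl
  have a21 : m₂.nat 21 0 0 = m.nat 21 0 0 := by rw [hA.nat 21 (by decide)]; rfl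
  have r5 : m₂.real 5 = m.real 5 := by rw [hA.real 5 (by decide)]; rfl
  have r6 : m₂.real 6 = m.real 6 := by rw [hA.real 6 (by decide)]; rfl
  have hval := valuesProg_spec (L := L) (m := m₂) hP (by simp [L]) h₂ a4 ht
  have hconf := ht.stores 0 ht.count_pos
  rw [ht.root] at hconf
  have hB := agree_run valuesProg m₂
  set m₃ := valuesProg.run m₂ with hm₃
  have b1 : m₃.nat 1 0 0 = q := by rw [hB.nat 1 (by decide), h₂.q_eq]
  obtain ⟨hsum, c, hc, hmax⟩ := argmaxProg_spec b1 (NeZero.pos q)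
  have hC := agree_run argmaxProg m₃
  set m₄ := argmaxProg.run m₃ with hm₄
  set y : Fin q → ℝ := fun a => m₃.real 4 0 a with hy
  have c4 : m₄.nat 4 0 0 = T := by rw [hC.nat 4 (by decide), hB.nat 4 (by decide), a4]
  have c8 : m₄.nat 8 0 0 = x := by rw [hC.nat 8 (by decide), hB.nat 8 (by decide), a8]
  have c10 : m₄.nat 10 = m₂.nat 10 := by rw [hC.nat 10 (by decide), hB.nat 10 (by decide)]
  have c15 : m₄.nat 15 = m₂.nat 15 := by rw [hC.nat 15 (by decide), hB.nat 15 (by decide)]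
  have c21 : m₄.nat 21 0 0 = m.nat 21 0 0 := by
    rw [hC.nat 21 (by decide), hB.nat 21 (by decide), a21]
  have s5 : m₄.real 5 = m.real 5 := by rw [hC.real 5 (by decide), hB.real 5 (by decide), r5]
  have s6 : m₄.real 6 = m.real 6 := by rw [hC.real 6 (by decide), hB.real 6 (by decide), r6]
  have s4 : m₄.real 4 = m₃.real 4 := hC.real 4 (by decide)
  have hfin : (∀ w, m'.nat 10 0 w = if w = x then (c : ℕ) + 1 else m₂.nat 10 0 w) ∧
      m'.real 5 0 0 = m.real 5 0 0 * y c ∧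
      m'.real 6 0 0 = m.real 6 0 0 * (y c + (1 - ∑ a, y a)) ∧
      m'.nat 21 0 0 = if m₂.nat 15 0 0 ≤ T ∧ 0 < y c then m.nat 21 0 0 else 0 := by
    have hyc : m₃.real 4 0 (c : ℕ) = y c := rfl
    have hsumy : m₄.real 8 0 0 = ∑ a, y a := hsum
    clear_value y m₄ m₃ m₂
    by_cases e1 : m₂.nat 15 0 0 ≤ T <;> by_cases e2 : y c ≤ 0
    · have e3 : ¬ 0 < y c := not_lt.2 e2
      simp [hrun, c15, c4, hc, s4, s5, s6, hsumy, hyc, e1, e2, e3, c8, c10]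
    · have e3 : 0 < y c := not_le.1 e2
      simp [hrun, c15, c4, hc, s4, s5, s6, hsumy, hyc, e1, e2, e3, c8, c10, c21]
    · have e3 : ¬ 0 < y c := not_lt.2 e2
      simp [hrun, c15, c4, hc, s4, s5, s6, hsumy, hyc, e1, e2, e3, c8, c10]
    · have e3 : 0 < y c := not_le.1 e2
      simp [hrun, c15, c4, hc, s4, s5, s6, hsumy, hyc, e1, e2, e3, c8, c10]
  obtain ⟨f1, f2, f3, f4⟩ := hfin
  refine ⟨c, y, m₂.nat 15 0 0 ≤ T, fun w => ?_, f2, f3, ?_, fun hfit => ?_, hmax,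
    fun s b hs hb hsz => ht.count_le hs hb hsz⟩
  · rw [f1]
    by_cases hw : w = x
    · simp [hw]
    · have : (w : ℕ) ≠ x := fun e => hw (Fin.ext e)
      rw [if_neg this, update_of_ne hw]
      exact hconf.config w
  · rw [f4]
    split_ifs with hh <;> simp [hh]
  · have := hval hfit
    rwa [IsValue, if_neg (by simp [k])] at this

/-- Conditions under which an attempt with budget `T`, radius `L` and level `k` succeeds. -/
def Suffices (S : SpinSystem (Fin n) q) (ε : ℝ) (T L k : ℕ) : Prop :=
  ∃ (d : ℝ) (s b : ℕ), 0 ≤ d ∧ S.MixesAt L d ∧ (∀ v, {u | S.G.edist u v = L}.ncard ≤ s) ∧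
    (∀ v, {u | S.G.edist u v < L}.ncard ≤ b) ∧ (q + 2) ^ (b + 1 + s * k) ≤ T ∧
    (q * s * d) ^ (k - 1) ≤ 1 / 2 ∧ (1 + 2 * q * (q * s * d) ^ (k - 1)) ^ n ≤ 1 + ε

/-- If a success is reported, then the output is correct. -/
def IsSound (S : SpinSystem (Fin n) q) (ε : ℝ) (m : State) : Prop :=
  1 ≤ m.nat 5 0 0 → (1 - ε) * S.partitionFunction ≤ m.real 3 0 0 ∧
    m.real 3 0 0 ≤ (1 + ε) * S.partitionFunction

theorem node_size_le (S : SpinSystem (Fin n) q) {L s b k : ℕ} (hk : 1 ≤ k) (x : Fin n)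
    (τ : Fin n → Option (Fin q)) (hs : ∀ v, {u | S.G.edist u v = L}.ncard ≤ s) :
    (⟨k, x, τ⟩ : Node n q).size S L s b ≤ (q + 2) ^ (b + 1 + s * k) := by
  rw [Node.size, if_neg (by simp only; omega)]
  split_ifs with h1
  · exact Nat.one_le_pow _ _ (by omega)
  · refine Nat.pow_le_pow_right (by omega) ?_
    have h2 : S.unassignedSphere L x τ ≤ s :=
      (Set.ncard_le_ncard (fun x (hx : _ ∧ _) => hx.1) (Set.toFinite _)).trans (hs x)
    have h3 : s * k = s * (k - 1) + s := by
      rw [← Nat.mul_succ]; congr 1; omega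
    simp only
    omega

/-- The gaps between marginals and lower bounds are nonnegative and add up to the slack, so each of
them is at most the slack. -/
theorem marg_le_of_isLowerBound {S : SpinSystem (Fin n) q} {L k : ℕ} {v : Fin n}
    {τ : Fin n → Option (Fin q)} {y : Fin q → ℝ} (h : S.IsLowerBound L k v τ y)
    (hv : τ v = none) (hτ : 0 < S.total τ) (a : Fin q) :
    S.marg τ v a ≤ y a + (1 - ∑ a, y a) := by
  have h1 : ∑ a, (S.marg τ v a - y a) = 1 - ∑ a, y a := by
    rw [Finset.sum_sub_distrib, S.sum_marg hv hτ]
  have h2 := Finset.single_le_sum (f := fun a => S.marg τ v a - y a)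
    (fun a _ => sub_nonneg.2 (h.le_marg hτ a)) (Finset.mem_univ a)
  linarith

/-- The state of an attempt after `i` vertices have been assigned. -/
structure AttemptInv (S : SpinSystem (Fin n) q) (ε : ℝ) (T L k i : ℕ) (m : State)
    (τ : Fin n → Option (Fin q)) : Prop where
  config : ∀ w : Fin n, m.nat 10 0 w = code (τ w)
  assigned : ∀ w : Fin n, τ w = none ↔ i ≤ w
  pos : 1 ≤ m.nat 21 0 0 → 0 < m.real 5 0 0
  total_pos : 1 ≤ m.nat 21 0 0 → 0 < S.total τ
  le : 1 ≤ m.nat 21 0 0 → m.real 5 0 0 * S.partitionFunction ≤ S.total τ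
  ge : 1 ≤ m.nat 21 0 0 → S.total τ ≤ m.real 6 0 0 * S.partitionFunction
  complete : ∀ (d : ℝ) (s b : ℕ), 0 ≤ d → S.MixesAt L d →
    (∀ v, {u | S.G.edist u v = L}.ncard ≤ s) → (∀ v, {u | S.G.edist u v < L}.ncard ≤ b) →
    (q + 2) ^ (b + 1 + s * k) ≤ T → (q * s * d) ^ (k - 1) ≤ 1 / 2 →
    1 ≤ m.nat 21 0 0 ∧
      m.real 6 0 0 ≤ (1 + 2 * q * (q * s * d) ^ (k - 1)) ^ i * m.real 5 0 0

/-- By the chain rule the probability of the partial configuration is multiplied by the marginal of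
the chosen spin, which lies between `y a` and `y a` plus the slack. Under the mixing assumptions the
slack is at most $\eta$, and the ratio of the two bounds grows by at most $1+2q\eta$. -/
theorem attemptInv_step [NeZero q] {S : SpinSystem (Fin n) q} {ε : ℝ} {m : State} {T i : ℕ}
    {τ : Fin n → Option (Fin q)} (hP : S.Permissive) (h : HasInput S ε m)
    (hD : HasDistances S T m) (hT : m.nat 4 0 0 = T) (hL : m.nat 6 0 0 + 1 ≤ T)
    (hi : i < n) (hx : m.nat 8 0 0 = i)
    (hI : AttemptInv S ε T (m.nat 6 0 0 + 1) (m.nat 7 0 0 + 1) i m τ) :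
    ∃ τ', AttemptInv S ε T (m.nat 6 0 0 + 1) (m.nat 7 0 0 + 1) (i + 1) (assignProg.run m) τ' := by
  have hτx : τ ⟨i, hi⟩ = none := (hI.assigned _).2 le_rfl
  obtain ⟨a, y, fits, e10, e5, e6, e21, hlow, hmax, hfits⟩ :=
    assignProg_spec (x := ⟨i, hi⟩) hP h hD hT hL hI.config hx hτx
  set m' := assignProg.run m
  set x : Fin n := ⟨i, hi⟩ with hxdef
  have hZ := hP.partitionFunction_pos
  have htot : 0 < S.total τ → S.total (update τ x (some a)) = S.marg τ x a * S.total τ :=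
    fun hτ => by rw [marg, div_mul_cancel₀ _ hτ.ne']
  refine ⟨update τ x (some a), e10, fun w => ?_, fun hok => ?_, fun hok => ?_, fun hok => ?_,
    fun hok => ?_, fun d s b hd hmix hs hb hsz hη => ?_⟩
  · by_cases hw : w = x
    · subst hw; simp [hxdef]
    · have : (w : ℕ) ≠ i := fun e => hw (Fin.ext e)
      rw [update_of_ne hw, hI.assigned]
      omega
  · obtain ⟨h1, h2, h3⟩ := e21.1 hok
    rw [e5]; exact mul_pos (hI.pos h1) h3
  · obtain ⟨h1, h2, h3⟩ := e21.1 hok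
    have hτ := hI.total_pos h1
    rw [htot hτ]
    exact mul_pos (h3.trans_le ((hlow h2).le_marg hτ a)) hτ
  · obtain ⟨h1, h2, h3⟩ := e21.1 hok
    have hτ := hI.total_pos h1
    rw [htot hτ, e5]
    calc m.real 5 0 0 * y a * S.partitionFunction = y a * (m.real 5 0 0 * S.partitionFunction) := by
          ring
      _ ≤ S.marg τ x a * S.total τ :=
          mul_le_mul ((hlow h2).le_marg hτ a) (hI.le h1)
            (mul_nonneg (hI.pos h1).le hZ.le) (S.marg_nonneg _ _ _)
  · obtain ⟨h1, h2, h3⟩ := e21.1 hok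
    have hτ := hI.total_pos h1
    have hle := marg_le_of_isLowerBound (hlow h2) hτx hτ a
    rw [htot hτ, e6]
    calc S.marg τ x a * S.total τ
        ≤ (y a + (1 - ∑ a, y a)) * (m.real 6 0 0 * S.partitionFunction) :=
          mul_le_mul hle (hI.ge h1) hτ.le ((S.marg_nonneg _ _ _).trans hle)
      _ = _ := by ring
  · obtain ⟨h1, h2⟩ := hI.complete d s b hd hmix hs hb hsz hη
    have hfit := hfits s b hs hb ((node_size_le S (by omega) x τ hs).trans hsz)
    have hτ := hI.total_pos h1
    set η : ℝ := (q * s * d) ^ (m.nat 7 0 0 + 1 - 1) with hηdef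
    have hη0 : 0 ≤ η := by positivity
    have hslack : 1 - ∑ a, y a ≤ η := (hlow hfit).one_sub_le d s hd hmix hs hτ
    have hq0 : (0 : ℝ) < q := by exact_mod_cast NeZero.pos q
    have hsum : ∑ a, y a ≤ q * y a := by
      have : ∑ a', y a' ≤ ∑ _a' : Fin q, y a := Finset.sum_le_sum fun a' _ => hmax a'
      simpa using this
    -- The largest of `q` values with sum at least $1-\eta\ge 1/2$ is at least $1/(2q)$. This turns
    -- the additive slack into a relative error.
    have hya : 1 ≤ 2 * q * y a := by nlinarith
    have hya0 : 0 < y a := by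
      by_contra! hneg
      nlinarith
    refine ⟨e21.2 ⟨h1, hfit, hya0⟩, ?_⟩
    rw [e5, e6]
    have hstep : y a + (1 - ∑ a, y a) ≤ (1 + 2 * q * η) * y a := by nlinarith
    have hnn : 0 ≤ y a + (1 - ∑ a, y a) :=
      (S.marg_nonneg τ x a).trans (marg_le_of_isLowerBound (hlow hfit) hτx hτ a)
    have hP0 := (hI.pos h1).le
    calc m.real 6 0 0 * (y a + (1 - ∑ a, y a))
        ≤ ((1 + 2 * q * η) ^ i * m.real 5 0 0) * ((1 + 2 * q * η) * y a) :=
          mul_le_mul h2 hstep hnn (by positivity)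
      _ = _ := by ring

/-- When all vertices are assigned, the total of the configuration is its weight, so $w$ lies
between $Z$ times the lower and $Z$ times the upper product. The final comparison of the products is
the whole certificate. -/
theorem attemptProg_spec [NeZero q] {S : SpinSystem (Fin n) q} {ε : ℝ} {m : State} {T : ℕ}
    (hε : 0 < ε) (hP : S.Permissive) (h : HasInput S ε m)
    (hD : HasDistances S T m) (hT : m.nat 4 0 0 = T) (hL : m.nat 6 0 0 + 1 ≤ T)
    (hs : IsSound S ε m) :
    IsSound S ε (attemptProg.run m) ∧
      (1 ≤ m.nat 5 0 0 → 1 ≤ (attemptProg.run m).nat 5 0 0) ∧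
      (Suffices S ε T (m.nat 6 0 0 + 1) (m.nat 7 0 0 + 1) →
        1 ≤ (attemptProg.run m).nat 5 0 0) := by
  have hZ := hP.partitionFunction_pos
  set m₁ := ((m.setNat 21 0 0 1).setReal 5 0 0 1).setReal 6 0 0 1 with hm₁
  set p : LoopProg := .loop 17 0 (.writeNat 10 (.const 0) (.reg 17) (.const 0)) with hp
  have hclear : ∀ w < n, (p.run m₁).nat 10 0 w = 0 := by
    rw [hp]
    refine run_loop (Q := fun s => ∀ w < n, s.nat 10 0 w = 0)
      (fun i s => ∀ w < i, s.nat 10 0 w = 0) ?_ ?_ ?_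
    · intro w hw; omega
    · intro i s _ _ hI w hw
      by_cases hwi : w = i
      · simp [hwi]
      · simpa [hwi] using hI w (by omega)
    · intro s _ hI
      have : m₁.nat 0 0 0 = n := h.n_eq
      rw [this] at hI
      exact hI
  have hA := agree_run p m₁
  set m₂ := p.run m₁ with hm₂
  have b0 : m₂.nat 0 0 0 = n := by rw [hA.nat 0 (by decide), ← h.n_eq]; rfl
  have b3 : m₂.nat 3 = m.nat 3 := by rw [hA.nat 3 (by decide)]; rfl
  have b4 : m₂.nat 4 = m.nat 4 := by rw [hA.nat 4 (by decide)]; rfl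
  have b6 : m₂.nat 6 = m.nat 6 := by rw [hA.nat 6 (by decide)]; rfl
  have b7 : m₂.nat 7 = m.nat 7 := by rw [hA.nat 7 (by decide)]; rfl
  have b21 : m₂.nat 21 0 0 = 1 := by rw [hA.nat 21 (by decide)]; simp [m₁]
  have r5 : m₂.real 5 0 0 = 1 := by rw [hA.real 5 (by decide)]; simp [m₁]
  have r6 : m₂.real 6 0 0 = 1 := by rw [hA.real 6 (by decide)]; simp [m₁]
  have h₂ : HasInput S ε m₂ := h.congr (by rw [hA.nat 0 (by decide)]; rfl)
    (by rw [hA.nat 1 (by decide)]; rfl) (by rw [hA.nat 2 (by decide)]; rfl)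
    (by rw [hA.real 0 (by decide)]; rfl) (by rw [hA.real 1 (by decide)]; rfl)
    (by rw [hA.real 2 (by decide)]; rfl)
  set L := m.nat 6 0 0 + 1 with hLdef
  set k := m.nat 7 0 0 + 1 with hkdef
  have hloop : ∃ τ, AttemptInv S ε T L k n ((LoopProg.loop 8 0 assignProg).run m₂) τ := by
    refine run_loop (Q := fun s => ∃ τ, AttemptInv S ε T L k n s τ)
      (fun i s => ∃ τ, AttemptInv S ε T L k i s τ) ?_ ?_ ?_
    · refine ⟨fun _ => none, ⟨fun w => ?_, fun w => by simp, ?_, ?_, ?_, ?_, ?_⟩⟩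
      · rw [hclear w w.2]; rfl
      · rw [r5]; exact fun _ => one_pos
      · rw [total_none]; exact fun _ => hZ
      · rw [total_none, r5, one_mul]; exact fun _ => le_rfl
      · rw [total_none, r6, one_mul]; exact fun _ => le_rfl
      · intro d s b _ _ _ _ _ _
        rw [b21, r5, r6]
        simp
    · rintro i s hi hB ⟨τ, hI⟩
      have c0 := hB.nat 0 (by decide)
      have c3 := hB.nat 3 (by decide)
      have c4 := hB.nat 4 (by decide)
      have c6 := hB.nat 6 (by decide)
      have c7 := hB.nat 7 (by decide)
      set s₁ := s.setNat 8 0 0 i with hs₁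
      have d6 : s₁.nat 6 0 0 = m.nat 6 0 0 := by rw [← b6, ← c6]; rfl
      have d7 : s₁.nat 7 0 0 = m.nat 7 0 0 := by rw [← b7, ← c7]; rfl
      have hin : HasInput S ε s₁ := h₂.congr c0 (hB.nat 1 (by decide)) (hB.nat 2 (by decide))
        (hB.real 0 (by decide)) (hB.real 1 (by decide)) (hB.real 2 (by decide))
      have hI' : AttemptInv S ε T L k i s₁ τ :=
        ⟨hI.config, hI.assigned, hI.pos, hI.total_pos, hI.le, hI.ge, hI.complete⟩
      rw [hLdef, hkdef, ← d6, ← d7] at hI' ⊢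
      refine attemptInv_step (ε := ε) hP hin (hD.congr ?_) ?_ ?_ (b0 ▸ hi) ?_ hI'
      · rw [← b3, ← c3]; rfl
      · rw [← hT, ← b4, ← c4]; rfl
      · rw [d6]; exact hL
      · simp [s₁]
    · rintro s _ ⟨τ, hI⟩
      rw [b0] at hI ⊢
      exact ⟨τ, hI.config, hI.assigned, hI.pos, hI.total_pos, hI.le, hI.ge, hI.complete⟩
  obtain ⟨τ, hτ⟩ := hloop
  have hC := agree_run (LoopProg.loop 8 0 assignProg) m₂
  set m₃ := (LoopProg.loop 8 0 assignProg).run m₂ with hm₃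
  have h₃ : HasInput S ε (m₃.setNat 22 0 0 0) := h₂.congr (hC.nat 0 (by decide))
    (hC.nat 1 (by decide)) (hC.nat 2 (by decide)) (hC.real 0 (by decide))
    (hC.real 1 (by decide)) (hC.real 2 (by decide))
  have c5 : m₃.nat 5 = m.nat 5 := by
    rw [hC.nat 5 (by decide), hA.nat 5 (by decide)]; rfl
  have t3 : m₃.real 3 = m.real 3 := by
    rw [hC.real 3 (by decide), hA.real 3 (by decide)]
    funext i j
    simp [m₁]
  have hw := weightProg_spec h₃ (τ := τ) fun w => by simpa using hτ.config w
  have hE := agree_run weightProg (m₃.setNat 22 0 0 0)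
  set m₄ := weightProg.run (m₃.setNat 22 0 0 0) with hm₄
  have e5 : m₄.nat 5 = m.nat 5 := by rw [hE.nat 5 (by decide), ← c5]; rfl
  have e21 : m₄.nat 21 = m₃.nat 21 := by rw [hE.nat 21 (by decide)]; rfl
  have u0 : m₄.real 0 0 0 = ε := by rw [hE.real 0 (by decide), h₃.ε_eq]
  have u3 : m₄.real 3 = m.real 3 := by rw [hE.real 3 (by decide), ← t3]; rfl
  have u5 : m₄.real 5 = m₃.real 5 := by rw [hE.real 5 (by decide)]; rfl
  have u6 : m₄.real 6 = m₃.real 6 := by rw [hE.real 6 (by decide)]; rfl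
  have hrun : attemptProg.run m = run (.when (.natLe (.const 1) (.reg 21)) <|
      .when (.realLe (.reg 6) (.mul (.add (.const 1) (.reg 0)) (.reg 5))) <|
      .seq (.setR 3 (.div (.reg 7) (.reg 5))) (.set 5 (.const 1))) m₄ := by
    have hinit : (setR 6 (.const 1)).run ((setR 5 (.const 1)).run ((set 21 (.const 1)).run m)) =
        m₁ := by simp [m₁]
    rw [attemptProg, run_seq, run_seq, run_seq, run_seq, run_seq, run_seq, run_seq, hinit, ← hp,
      ← hm₂, ← hm₃]
    rfl
  have htot : S.total τ = S.partialWeight τ := by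
    have hne : ∀ w, τ w ≠ none := fun w hw => by
      have := (hτ.assigned w).1 hw
      omega
    choose ρ hρ using fun w => Option.ne_none_iff_exists'.1 (hne w)
    obtain rfl : τ = fun w => some (ρ w) := funext hρ
    rw [total_some, partialWeight_some]
  simp only [hrun, run_when, run_seq, run_setR, run_set, Test.holds_natLe, NExp.eval_const,
    NExp.eval_reg, Test.holds_realLe, RExp.eval_reg, RExp.eval_mul, RExp.eval_add, RExp.eval_const,
    RExp.eval_div, e21, u0, u5, u6, hw, Nat.cast_one]
  by_cases hok : 1 ≤ m₃.nat 21 0 0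
  · rw [if_pos hok]
    have hpos := hτ.pos hok
    by_cases hgap : m₃.real 6 0 0 ≤ (1 + ε) * m₃.real 5 0 0
    · rw [if_pos hgap]
      refine ⟨fun _ => ?_, fun _ => by simp, fun _ => by simp⟩
      simp only [State.setNat_real, State.setReal_real, and_self, if_true]
      have h1 := hτ.le hok
      have h2 := hτ.ge hok
      rw [htot] at h1 h2
      constructor
      -- With $P$ the lower product, $PZ\le w\le(1+\varepsilon)PZ$; hence $w/P$ lies between $Z$ and
      -- $(1+\varepsilon)Z$.
      · rw [le_div_iff₀ hpos]
        nlinarith [mul_pos hpos hZ]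
      · rw [div_le_iff₀ hpos]
        nlinarith
    · rw [if_neg hgap]
      refine ⟨fun hd => ?_, fun hd => by rwa [e5], ?_⟩
      · rw [e5] at hd; rw [u3]; exact hs hd
      · rintro ⟨d, s, b, hd, hmix, hsp, hb, hsz, hη, hpow⟩
        obtain ⟨-, hle⟩ := hτ.complete d s b hd hmix hsp hb hsz hη
        exact absurd (hle.trans (mul_le_mul_of_nonneg_right hpow hpos.le)) hgap
  · rw [if_neg hok]
    refine ⟨fun hd => ?_, fun hd => by rwa [e5], ?_⟩
    · rw [e5] at hd; rw [u3]; exact hs hd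
    · rintro ⟨d, s, b, hd, hmix, hsp, hb, hsz, hη, hpow⟩
      exact absurd (hτ.complete d s b hd hmix hsp hb hsz hη).1 hok

theorem roundProg_spec [NeZero q] {S : SpinSystem (Fin n) q} {ε : ℝ} {m : State} {T : ℕ}
    (hε : 0 < ε) (hP : S.Permissive) (h : HasInput S ε m)
    (hD : HasDistances S T m) (hT : m.nat 4 0 0 = T + 1) (hs : IsSound S ε m) :
    HasDistances S (T + 1) (roundProg.run m) ∧ IsSound S ε (roundProg.run m) ∧
      ∀ L k, 1 ≤ L → L ≤ T + 1 → 1 ≤ k → k ≤ T + 1 → Suffices S ε (T + 1) L k →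
        1 ≤ (roundProg.run m).nat 5 0 0 := by
  have hD' := layerProg_spec h hD hT
  have hA := agree_run layerProg m
  set m₁ := layerProg.run m with hm₁
  have h₁ : HasInput S ε m₁ := h.congr (hA.nat 0 (by decide)) (hA.nat 1 (by decide))
    (hA.nat 2 (by decide)) (hA.real 0 (by decide)) (hA.real 1 (by decide)) (hA.real 2 (by decide))
  have a4 : m₁.nat 4 0 0 = T + 1 := by rw [hA.nat 4 (by decide), hT]
  have hs₁ : IsSound S ε m₁ := by
    rw [IsSound, hA.nat 5 (by decide), hA.real 3 (by decide)]; exact hs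
  rw [roundProg, run_seq, ← hm₁]
  have hB := agree_run (LoopProg.loop 6 4 (.loop 7 4 attemptProg)) m₁
  refine ⟨hD'.congr (hB.nat 3 (by decide)), ?_⟩
  -- Pairs of radius and level are processed in lexicographic order. Once a processed pair suffices,
  -- the success flag is set, and later attempts never reset it.
  let I : ℕ → ℕ → State → Prop := fun i j s => IsSound S ε s ∧
    ((∃ i' j', i' < T + 1 ∧ j' < T + 1 ∧ (i' < i ∨ i' = i ∧ j' < j) ∧
      Suffices S ε (T + 1) (i' + 1) (j' + 1)) → 1 ≤ s.nat 5 0 0)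
  have key : I (T + 1) 0 ((LoopProg.loop 6 4 (.loop 7 4 attemptProg)).run m₁) := by
    refine run_loop (Q := fun s => I (T + 1) 0 s) (fun i s => I i 0 s) ?_ ?_ ?_
    · refine ⟨hs₁, ?_⟩
      rintro ⟨i', j', -, -, hlt, -⟩
      omega
    · intro i s hi hC hI
      rw [a4] at hi
      have c4 : (s.setNat 6 0 0 i).nat 4 0 0 = T + 1 := by rw [← a4, ← hC.nat 4 (by decide)]; rfl
      refine run_loop (Q := fun s => I (i + 1) 0 s) (fun j s => I i j s) hI ?_ ?_
      · intro j t hj hE hJ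
        rw [c4] at hj
        set t₁ := t.setNat 7 0 0 j with ht₁
        have e4 : t₁.nat 4 0 0 = T + 1 := by rw [← c4, ← hE.nat 4 (by decide)]; rfl
        have e6 : t₁.nat 6 0 0 = i := by
          have : t₁.nat 6 = t.nat 6 := by rw [ht₁, State.setNat_nat_of_ne _ (by decide)]
          rw [this, hE.nat 6 (by decide)]; simp
        have e7 : t₁.nat 7 0 0 = j := by simp [t₁]
        have hin : HasInput S ε t₁ := by
          have := h₁.congr (hC.nat 0 (by decide)) (hC.nat 1 (by decide))
            (hC.nat 2 (by decide)) (hC.real 0 (by decide)) (hC.real 1 (by decide))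
            (hC.real 2 (by decide))
          exact this.congr (hE.nat 0 (by decide)) (hE.nat 1 (by decide)) (hE.nat 2 (by decide))
            (hE.real 0 (by decide)) (hE.real 1 (by decide)) (hE.real 2 (by decide))
        have hDt : HasDistances S (T + 1) t₁ :=
          (hD'.congr (hC.nat 3 (by decide))).congr (hE.nat 3 (by decide))
        obtain ⟨g1, g2, g3⟩ := attemptProg_spec hε hP hin hDt e4 (by rw [e6]; omega)
          (show IsSound S ε t₁ from hJ.1)
        refine ⟨g1, ?_⟩
        rintro ⟨i', j', hi', hj', hlt, hsuf⟩
        by_cases hij : i' = i ∧ j' = j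
        · obtain ⟨rfl, rfl⟩ := hij
          rw [e6, e7] at g3
          exact g3 hsuf
        · exact g2 (hJ.2 ⟨i', j', hi', hj', by omega, hsuf⟩)
      · intro t _ hJ
        rw [c4] at hJ
        refine ⟨hJ.1, ?_⟩
        rintro ⟨i', j', hi', hj', hlt, hsuf⟩
        exact hJ.2 ⟨i', j', hi', hj', by omega, hsuf⟩
    · intro s _ hI
      rw [a4] at hI
      exact hI
  refine ⟨key.1, fun L k hL hLT hk hkT hsuf => key.2 ⟨L - 1, k - 1, by omega, by omega,
    Or.inl (by omega), ?_⟩⟩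
  rwa [Nat.sub_add_cancel hL, Nat.sub_add_cancel hk]

end RealRAM

/-! ### Rounds and their total running time. -/

namespace RealRAM

open LoopProg Function SpinSystem

variable {n q : ℕ}

/-- What holds between two rounds of the algorithm, `T` being the budget of the last round. -/
structure RoundInvariant (S : SpinSystem (Fin n) q) (ε : ℝ) (T : ℕ) (m : State) : Prop where
  input : HasInput S ε m
  distances : HasDistances S T m
  budget : m.nat 4 0 0 = T
  sound : IsSound S ε m

/-- Induction on the number of rounds left before the budget `T'`, which is sure to succeed. An
earlier success also ends the loop, and its output is correct because soundness does not depend on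
the budget. -/
theorem exec_rounds [NeZero q] {S : SpinSystem (Fin n) q} {ε : ℝ} {T' L k X : ℕ}
    (hε : 0 < ε) (hP : S.Permissive) (hL : 1 ≤ L) (hLT : L ≤ T') (hk : 1 ≤ k) (hkT : k ≤ T')
    (hsuf : Suffices S ε T' L k) (hnX : n ≤ X) (hqX : q ≤ X) (hTX : T' ≤ X) (N : ℕ) :
    ∀ (T : ℕ) (m : State), T + N = T' → RoundInvariant S ε T m → (N = 0 → 1 ≤ m.nat 5 0 0) →
      ∃ m' t, Exec (.while (.natLe (.reg 5) (.const 0))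
          (.seq (.writeNat 4 (.const 0) (.const 0) (.add (.reg 4) (.const 1)))
            roundProg.compile)) m m' t ∧
        t ≤ N * (roundProg.cost X + 16) + 6 ∧ 1 ≤ m'.nat 5 0 0 ∧ IsSound S ε m' := by
  have hcost : (Test.natLe (.reg 5) (.const 0)).cost = 5 := rfl
  induction N with
  | zero =>
    intro T m _ hI h5
    refine ⟨m, _, Exec.while_false ?_, ?_, h5 rfl, hI.sound⟩
    · have := h5 rfl
      simp only [Test.Holds, NExp.eval_reg, NExp.eval_const]; omega
    · rw [hcost]; omega
  | succ N ih =>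
    intro T m hT hI _
    by_cases h5 : 1 ≤ m.nat 5 0 0
    · refine ⟨m, _, Exec.while_false ?_, ?_, h5, hI.sound⟩
      · simp only [Test.Holds, NExp.eval_reg, NExp.eval_const]; omega
      · rw [hcost]; omega
    · set m₁ := m.setNat 4 0 0 (T + 1) with hm₁
      have hw : Exec (.writeNat 4 (.const 0) (.const 0) (.add (.reg 4) (.const 1))) m m₁ 8 := by
        have := Exec.writeNat 4 (.const 0) (.const 0) (.add (.reg 4) (.const 1)) m
        simpa [NExp.eval, NExp.reg, NExp.cost, hI.budget, hm₁] using this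
      have e : ∀ a, a ≠ 4 → m₁.nat a = m.nat a := fun a ha => m.setNat_nat_of_ne ha _ _ _
      have h₁ : HasInput S ε m₁ :=
        hI.input.congr (e 0 (by decide)) (e 1 (by decide)) (e 2 (by decide)) rfl rfl rfl
      have e4 : m₁.nat 4 0 0 = T + 1 := by simp [m₁]
      have hs₁ : IsSound S ε m₁ := by
        have := hI.sound
        rw [IsSound] at this ⊢
        rwa [e 5 (by decide)]
      obtain ⟨r1, r2, r3⟩ :=
        roundProg_spec hε hP h₁ (hI.distances.congr (e 3 (by decide))) e4 hs₁
      obtain ⟨t, ht, hx, hbs⟩ := exec_compile (bs := [0, 1, 4]) (X := X) roundProg m₁ (by decide) (by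
        have := h₁.n_eq
        have := h₁.q_eq
        simp only [List.mem_cons, List.not_mem_nil, or_false, forall_eq_or_imp, forall_eq]
        omega)
      have hA := agree_run roundProg m₁
      have hI₂ : RoundInvariant S ε (T + 1) (roundProg.run m₁) :=
        ⟨h₁.congr (hA.nat 0 (by decide)) (hA.nat 1 (by decide)) (hA.nat 2 (by decide))
          (hA.real 0 (by decide)) (hA.real 1 (by decide)) (hA.real 2 (by decide)), r1, by
          rw [hbs 4 (by decide), e4], r2⟩
      obtain ⟨m', t', hx', ht', h5', hs'⟩ := ih (T + 1) _ (by omega) hI₂ (by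
        rintro rfl
        obtain rfl : T + 1 = T' := by omega
        exact r3 L k hL hLT hk hkT hsuf)
      refine ⟨m', _, Exec.while_true ?_ (Exec.seq hw hx) hx', ?_, h5', hs'⟩
      · simp only [Test.Holds, NExp.eval_reg, NExp.eval_const]; omega
      · rw [hcost, Nat.succ_mul]; omega

/-- At most `T` rounds are run, each polynomial in the bound `n + q + T` on all loop lengths. The
constants come from the program alone and thus precede all parameters. -/
theorem exists_exec_countingProg : ∃ c D : ℕ, 1 ≤ D ∧ ∀ {n q : ℕ} [NeZero q]
    (S : SpinSystem (Fin n) q) (ε : ℝ), 0 < ε → S.Permissive →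
    ∀ T L k : ℕ, 1 ≤ L → L ≤ T → 1 ≤ k → k ≤ T → Suffices S ε T L k →
    ∃ m t, Exec countingProg (S.input ε) m t ∧ t ≤ c * (n + q + T) ^ D ∧
      (1 - ε) * S.partitionFunction ≤ m.output ∧ m.output ≤ (1 + ε) * S.partitionFunction := by
  obtain ⟨c, d, h⟩ := exists_cost_le initProg
  obtain ⟨c', d', h'⟩ := exists_cost_le roundProg
  refine ⟨c + c' + 22, d + d' + 1, by omega, ?_⟩
  intro n q _ S ε hε hP T L k hL hLT hk hkT hsuf
  set X := n + q + T with hX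
  have hX1 : 1 ≤ X := by omega
  have h₀ := hasInput_input S ε
  have i4 : (S.input ε).nat 4 0 0 = 0 := by simp [SpinSystem.input]
  have i5 : (S.input ε).nat 5 0 0 = 0 := by simp [SpinSystem.input]
  obtain ⟨t, ht, hx, hbs⟩ := exec_compile (bs := [0, 1, 4]) (X := X) initProg (S.input ε)
    (by decide) (by
      have := h₀.n_eq
      have := h₀.q_eq
      simp only [List.mem_cons, List.not_mem_nil, or_false, forall_eq_or_imp, forall_eq]
      omega)
  have hA := agree_run initProg (S.input ε)
  have hI : RoundInvariant S ε 0 (initProg.run (S.input ε)) :=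
    ⟨h₀.congr (hA.nat 0 (by decide)) (hA.nat 1 (by decide)) (hA.nat 2 (by decide))
      (hA.real 0 (by decide)) (hA.real 1 (by decide)) (hA.real 2 (by decide)), initProg_spec S, by
      rw [hbs 4 (by decide), i4], by
      intro h5
      rw [hA.nat 5 (by decide), i5] at h5
      omega⟩
  obtain ⟨m, t', hx', ht', h5, hs⟩ := exec_rounds hε hP hL hLT hk hkT hsuf (X := X) (by omega)
    (by omega) (by omega) T 0 _ (by omega) hI (by omega)
  refine ⟨m, _, Exec.seq hx hx', ?_, (hs h5).1, (hs h5).2⟩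
  have b1 : initProg.cost X ≤ c * X ^ (d + d' + 1) :=
    (h X hX1).trans (Nat.mul_le_mul_left _ (Nat.pow_le_pow_right hX1 (by omega)))
  have b2 : T * roundProg.cost X ≤ c' * X ^ (d + d' + 1) := by
    calc T * roundProg.cost X ≤ X * (c' * X ^ d') := Nat.mul_le_mul (by omega) (h' X hX1)
      _ = c' * X ^ (d' + 1) := by ring
      _ ≤ _ := Nat.mul_le_mul_left _ (Nat.pow_le_pow_right hX1 (by omega))
  have b3 : X ≤ X ^ (d + d' + 1) := Nat.le_self_pow (by omega) X
  have b4 : T ≤ X := by omega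
  calc t + t' ≤ initProg.cost X + (T * roundProg.cost X + 16 * T + 6) := by
        rw [mul_add] at ht'; omega
    _ ≤ c * X ^ (d + d' + 1) + c' * X ^ (d + d' + 1) + 22 * X ^ (d + d' + 1) := by omega
    _ = _ := by ring

end RealRAM

/-! ### Sufficient radius, level and budget, and the final estimate. -/

namespace SpinSystem

variable {n q : ℕ}

theorem ncard_sphere_le {V : Type} {G : SimpleGraph V} {s : ℕ → ℕ} (h : HasSubexpGrowth G s)
    (v : V) {ℓ : ℕ} (hℓ : 0 < ℓ) : {u | G.edist u v = ℓ}.ncard ≤ s ℓ :=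
  ENat.toNat_le_of_le_natCast (h.2 v ℓ hℓ)

/-- A ball is a union of spheres. The growth condition says nothing about radius 0, where the sphere
is a single point; the added 1 covers this case. -/
theorem ncard_ball_le {V : Type} [Finite V] {G : SimpleGraph V} {s : ℕ → ℕ}
    (h : HasSubexpGrowth G s) (v : V) (L : ℕ) :
    {u | G.edist u v < L}.ncard ≤ ∑ ℓ ∈ Finset.range L, (s ℓ + 1) := by
  induction L with
  | zero => simp
  | succ L ih =>
    have hsub : {u | G.edist u v < (L + 1 : ℕ)} ⊆
        {u | G.edist u v < L} ∪ {u | G.edist u v = L} := by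
      intro u hu
      have : G.edist u v ≤ L := by
        have hu : G.edist u v < (L + 1 : ℕ) := hu
        push_cast at hu
        exact Order.le_of_lt_add_one hu
      exact this.lt_or_eq
    have hsph : {u | G.edist u v = L}.ncard ≤ s L + 1 := by
      rcases Nat.eq_zero_or_pos L with rfl | hL
      · have : {u | G.edist u v = (0 : ℕ)} = {v} := by ext u; simp
        rw [this, Set.ncard_singleton]; omega
      · exact (ncard_sphere_le h v hL).trans (Nat.le_succ _)
    rw [Finset.sum_range_succ]
    exact (Set.ncard_le_ncard hsub (Set.toFinite _)).trans
      ((Set.ncard_union_le _ _).trans (add_le_add ih hsph))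

/-- The hypothesis at distance `L` gives $qs\delta\le 1/2$, so the slack $\eta$ is at most
$2^{-(k-1)}$ and $4qn\eta\le\varepsilon$. Then $(1+2q\eta)^n\le e^{\varepsilon/2}\le
1/(1-\varepsilon/2)\le 1+\varepsilon$. -/
theorem suffices_of_mixing [NeZero q] {S : SpinSystem (Fin n) q} {s : ℕ → ℕ} {δ : ℕ → ℝ} {ε : ℝ}
    {T L k : ℕ} (hn : 1 ≤ n) (hL : 1 ≤ L) (hε : 0 < ε) (hε1 : ε < 1) (hP : S.Permissive)
    (hG : HasSubexpGrowth S.G s) (hS : S.StrongSpatialMixing δ) (hδ : 0 ≤ δ L)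
    (hδL : 2 * Real.exp 1 * (q : ℝ) * (1 + (s L : ℝ)) * δ L ≤ 1)
    (hk : 4 * q * n / ε ≤ (2 : ℝ) ^ (k - 1))
    (hT : (q + 2) ^ ((∑ ℓ ∈ Finset.range L, (s ℓ + 1)) + 1 + s L * k) ≤ T) :
    RealRAM.Suffices S ε T L k := by
  have hq1 : (1 : ℝ) ≤ q := by exact_mod_cast Nat.one_le_iff_ne_zero.2 (NeZero.ne q)
  have hn1 : (1 : ℝ) ≤ n := by exact_mod_cast hn
  have he : (1 : ℝ) ≤ Real.exp 1 := Real.one_le_exp (by norm_num)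
  have hx0 : 0 ≤ q * s L * δ L := by positivity
  have hx : q * s L * δ L ≤ 1 / 2 := by
    have h0 : 0 ≤ (q : ℝ) * (1 + s L) * δ L := by positivity
    have h1 : (q : ℝ) * s L * δ L ≤ q * (1 + s L) * δ L := by
      have : 0 ≤ (q : ℝ) * δ L := by positivity
      nlinarith
    nlinarith
  set η := (q * s L * δ L) ^ (k - 1) with hη
  have hη0 : 0 ≤ η := pow_nonneg hx0 _
  have hη1 : η * (2 : ℝ) ^ (k - 1) ≤ 1 := by
    rw [hη, ← mul_pow]
    exact pow_le_one₀ (by positivity) (by linarith)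
  have hη2 : η * (4 * q * n) ≤ ε := by
    have := mul_le_mul_of_nonneg_left hk hη0
    rw [mul_div_assoc', div_le_iff₀ hε] at this
    nlinarith
  refine ⟨δ L, s L, _, hδ, hS.mixesAt hP hδ, fun v => ncard_sphere_le hG v hL,
    fun v => ncard_ball_le hG v L, hT, ?_, ?_⟩
  · have : (4 : ℝ) ≤ 4 * q * n := by nlinarith
    nlinarith
  · calc (1 + 2 * q * η) ^ n ≤ Real.exp (2 * q * η) ^ n := by
          refine pow_le_pow_left₀ (by positivity) ?_ n
          linarith [Real.add_one_le_exp (2 * q * η)]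
      _ = Real.exp (η * (4 * q * n) / 2) := by rw [← Real.exp_nat_mul]; ring_nf
      _ ≤ Real.exp (ε / 2) := Real.exp_le_exp.2 (by linarith)
      _ ≤ 1 / (1 - ε / 2) := by
          have := Real.exp_bound_div_one_sub_of_interval (x := ε / 2) (by linarith) (by linarith)
          exact this
      _ ≤ 1 + ε := by
          rw [div_le_iff₀ (by linarith)]
          nlinarith

end SpinSystem

/-- The budget is polynomial in `n / ε`, with an exponent proportional to `σ log q`. -/
theorem budget_pow_le {n q σ k D : ℕ} {ε : ℝ} (hn : 1 ≤ n) (hq : 2 ≤ q) (hσ : 1 ≤ σ)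
    (hε : 0 < ε) (hε1 : ε < 1) (hk : (2 : ℝ) ^ k ≤ 16 * q * (n / ε)) :
    ((n : ℝ) * (q + 2) ^ (σ * k)) ^ D ≤
      (16 * q : ℝ) ^ (4 * D * σ * Real.log q) * (n / ε) ^ (6 * D * σ * Real.log q) := by
  have hq2 : (2 : ℝ) ≤ q := by exact_mod_cast hq
  have hn1 : (1 : ℝ) ≤ n := by exact_mod_cast hn
  have hσ1 : (1 : ℝ) ≤ σ := by exact_mod_cast hσ
  have hlog2 : (1 : ℝ) / 2 ≤ Real.log 2 := by linarith [Real.log_two_gt_d9]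
  have hlogq : (1 : ℝ) / 2 ≤ Real.log q := hlog2.trans (Real.log_le_log (by norm_num) hq2)
  set y : ℝ := n / ε with hy
  have hny : (n : ℝ) ≤ y := by
    rw [hy, le_div_iff₀ hε]; nlinarith
  have hy1 : 1 ≤ y := hn1.trans hny
  have hy0 : 0 < y := by linarith
  have hD : (0 : ℝ) ≤ D := Nat.cast_nonneg D
  have h1 : (n : ℝ) ^ D ≤ y ^ (2 * D * σ * Real.log q) := by
    calc (n : ℝ) ^ D ≤ y ^ D := pow_le_pow_left₀ (by linarith) hny D
      _ = y ^ (D : ℝ) := (Real.rpow_natCast y D).symm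
      _ ≤ _ := by
        refine Real.rpow_le_rpow_of_exponent_le hy1 ?_
        -- This is where $\log q\ge 1/2$ enters: the plain exponent `D` is absorbed into one
        -- proportional to $\sigma\log q$.
        have : 1 ≤ 2 * (σ * Real.log q) := by nlinarith
        nlinarith
  have h2 : (((q : ℝ) + 2) ^ (σ * k)) ^ D ≤ (16 * q * y) ^ (4 * D * σ * Real.log q) := by
    have hk' : (k : ℝ) * Real.log 2 ≤ Real.log (16 * q * y) := by
      rw [← Real.log_pow]
      exact Real.log_le_log (by positivity) hk
    have hz : 0 < 16 * q * y := by positivity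
    -- The level is logarithmic, with $1/\log 2\le 2$. Together with $q+2\le q^2$ this gives the
    -- exponent 4; the factor $n^D$ contributes 2 more, hence 6.
    have hkk : (k : ℝ) ≤ 2 * Real.log (16 * q * y) := by
      have : (0 : ℝ) ≤ k := Nat.cast_nonneg k
      nlinarith
    calc (((q : ℝ) + 2) ^ (σ * k)) ^ D = ((q : ℝ) + 2) ^ (σ * k * D) := (pow_mul _ _ _).symm
      _ ≤ ((q : ℝ) ^ 2) ^ (σ * k * D) := pow_le_pow_left₀ (by positivity) (by nlinarith) _
      _ = Real.exp (2 * (σ * D * Real.log q) * k) := by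
        rw [← pow_mul, ← Real.exp_log (show (0 : ℝ) < q by linarith), ← Real.exp_nat_mul,
          Real.log_exp]
        push_cast
        ring_nf
      _ ≤ Real.exp (2 * (σ * D * Real.log q) * (2 * Real.log (16 * q * y))) := by
        gcongr
      _ = _ := by
        rw [Real.rpow_def_of_pos hz]
        ring_nf
  calc ((n : ℝ) * (q + 2) ^ (σ * k)) ^ D = (n : ℝ) ^ D * (((q : ℝ) + 2) ^ (σ * k)) ^ D :=
        mul_pow _ _ _
    _ ≤ y ^ (2 * D * σ * Real.log q) * (16 * q * y) ^ (4 * D * σ * Real.log q) :=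
        mul_le_mul h1 h2 (by positivity) (by positivity)
    _ = (16 * q : ℝ) ^ (4 * D * σ * Real.log q) *
          (y ^ (2 * D * σ * Real.log q) * y ^ (4 * D * σ * Real.log q)) := by
        rw [Real.mul_rpow (by positivity) hy0.le]; ring
    _ = _ := by
        rw [← Real.rpow_add hy0]; ring_nf

theorem mainTheorem8 :
    ∃ (prog : RealRAM.Prog) (C : ℝ), 0 < C ∧
      ∀ (q : ℕ) (s : ℕ → ℕ) (L : ℕ), 2 ≤ q → 1 ≤ L →
        ∃ K : ℝ, 0 < K ∧
          ∀ δ : ℕ → ℝ, (∀ ℓ, 0 ≤ δ ℓ) → Antitone δ →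
            (∀ ℓ, L ≤ ℓ → 2 * Real.exp 1 * (q : ℝ) * (1 + (s ℓ : ℝ)) * δ ℓ ≤ 1) →
            ∀ (n : ℕ), 1 ≤ n → ∀ S : SpinSystem (Fin n) q,
              S.Permissive → HasSubexpGrowth S.G s → S.StrongSpatialMixing δ →
              ∀ b : ℝ, 0 < b → S.MarginalLowerBound b →
              ∀ ε : ℝ, 0 < ε → ε < 1 →
                ∃ (m : RealRAM.State) (t : ℕ), RealRAM.Exec prog (S.input ε) m t ∧
                  (t : ℝ) ≤ K * ((n : ℝ) / (b * ε)) ^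
                    (C * max 1 (s L : ℝ) * Real.log (q : ℝ)) ∧
                  (1 - ε) * S.partitionFunction ≤ m.output ∧
                  m.output ≤ (1 + ε) * S.partitionFunction := by
  obtain ⟨c, D, hD, hexec⟩ := RealRAM.exists_exec_countingProg
  have hD1 : (1 : ℝ) ≤ D := by exact_mod_cast hD
  refine ⟨RealRAM.countingProg, 6 * D, by positivity, fun q s L hq hL => ?_⟩
  have : NeZero q := ⟨by omega⟩
  have hq2 : (2 : ℝ) ≤ q := by exact_mod_cast hq
  have hlogq : 0 ≤ Real.log q := Real.log_nonneg (by linarith)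
  set σ := max 1 (s L) with hσ
  have hσ1 : 1 ≤ σ := le_max_left _ _
  have hσs : s L ≤ σ := le_max_right _ _
  have hσc : max 1 (s L : ℝ) = (σ : ℝ) := by rw [hσ]; push_cast; rfl
  rw [hσc]
  set B := (∑ ℓ ∈ Finset.range L, (s ℓ + 1)) + 1 with hB
  set K₁ : ℕ := q + L + 2 + (q + 2) ^ B with hK₁
  refine ⟨(c + 1) * (K₁ : ℝ) ^ D * (16 * q : ℝ) ^ (4 * D * σ * Real.log q), by positivity, ?_⟩
  intro δ hδ _ hδL n hn S hP hG hS b hb hMLB ε hε hε1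
  have hn1 : (1 : ℝ) ≤ n := by exact_mod_cast hn
  have hny : (1 : ℝ) ≤ n / ε := by rw [le_div_iff₀ hε]; linarith
  -- The exponent satisfies $2^j\le 4qn/\varepsilon<2^{j+1}$. With `k = j + 2` the error condition
  -- $4qn/\varepsilon\le 2^{k-1}$ holds, while $2^k$ is at most $16qn/\varepsilon$.
  obtain ⟨j, hj, hj'⟩ := exists_nat_pow_near (x := 4 * q * n / ε) (y := (2 : ℝ))
    (by rw [mul_div_assoc]; nlinarith) (by norm_num)
  set k := j + 2 with hk
  have hk2 : (2 : ℝ) ^ k ≤ 16 * q * (n / ε) := by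
    rw [hk, pow_add]
    calc (2 : ℝ) ^ j * 2 ^ 2 ≤ 4 * q * n / ε * 2 ^ 2 := by gcongr
      _ = _ := by ring
  set T := L + k + (q + 2) ^ (B + s L * k) with hT
  have hsuf : RealRAM.Suffices S ε T L k :=
    SpinSystem.suffices_of_mixing hn hL hε hε1 hP hG hS (hδ L) (hδL L le_rfl)
      (by rw [hk, Nat.add_sub_assoc (by norm_num)]; exact hj'.le) (by rw [hT, hB]; omega)
  obtain ⟨m, t, hx, ht, hlo, hhi⟩ :=
    hexec S ε hε hP T L k hL (by omega) (by omega) (by omega) hsuf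
  refine ⟨m, t, hx, ?_, hlo, hhi⟩
  -- The part of the budget that depends on `k` is separated from constants in `q`, `s` and `L`. In
  -- `K₁`, `q + L` absorbs `q` and `L`, the 2 absorbs `n` and `k`, and the power absorbs the cost of
  -- the balls.
  have hX : n + q + T ≤ K₁ * (n * (q + 2) ^ (σ * k)) := by
    have h1 : 1 ≤ (q + 2) ^ (σ * k) := Nat.one_le_pow _ _ (by omega)
    have h2 : k ≤ (q + 2) ^ (σ * k) :=
      (Nat.le_mul_of_pos_left k hσ1).trans (Nat.lt_pow_self (by omega)).le
    have h3 : (q + 2) ^ (B + s L * k) ≤ (q + 2) ^ B * (q + 2) ^ (σ * k) := by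
      rw [← pow_add]
      exact Nat.pow_le_pow_right (by omega)
        (Nat.add_le_add_left (Nat.mul_le_mul_right k hσs) B)
    set P := (q + 2) ^ (σ * k)
    set Q := (q + 2) ^ B
    have h4 : P ≤ n * P := Nat.le_mul_of_pos_left P hn
    have h5 : n ≤ n * P := Nat.le_mul_of_pos_right n h1
    have h6 : q + L ≤ (q + L) * (n * P) := Nat.le_mul_of_pos_right _ (by omega)
    have h7 : Q * P ≤ Q * (n * P) := Nat.mul_le_mul_left Q h4
    calc n + q + T ≤ (q + L) * (n * P) + 2 * (n * P) + Q * (n * P) := by omega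
      _ = _ := by rw [hK₁]; ring
  -- The bound obtained is already in terms of $n/\varepsilon$; since $b\le 1$, passing to
  -- $n/(b\varepsilon)$ only enlarges it.
  have hbase : (n : ℝ) / ε ≤ n / (b * ε) := by
    have hb1 : b ≤ 1 := hMLB.le_one hP ⟨0, hn⟩
    exact div_le_div_of_nonneg_left (by linarith) (by positivity) (by nlinarith)
  have hXD : ((n + q + T : ℕ) : ℝ) ^ D ≤
      (K₁ : ℝ) ^ D * ((n : ℝ) * (q + 2) ^ (σ * k)) ^ D := by
    rw [← mul_pow]
    exact pow_le_pow_left₀ (by positivity) (by exact_mod_cast hX) D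
  calc (t : ℝ) ≤ c * ((n + q + T : ℕ) : ℝ) ^ D := by exact_mod_cast ht
    _ ≤ (c + 1) * ((K₁ : ℝ) ^ D * ((n : ℝ) * (q + 2) ^ (σ * k)) ^ D) :=
      mul_le_mul (by linarith) hXD (by positivity) (by positivity)
    _ ≤ (c + 1) * ((K₁ : ℝ) ^ D * ((16 * q : ℝ) ^ (4 * D * σ * Real.log q) *
          (n / ε) ^ (6 * D * σ * Real.log q))) := by
      gcongr
      exact budget_pow_le hn hq hσ1 hε hε1 hk2
    _ ≤ (c + 1) * ((K₁ : ℝ) ^ D * ((16 * q : ℝ) ^ (4 * D * σ * Real.log q) *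
          (n / (b * ε)) ^ (6 * D * σ * Real.log q))) := by
      gcongr
    _ = _ := by ring
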